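/- Let $p$ be an odd prime, let $R$ be the complete discrete valuation ring with maximal ideal $(p)$ and residue field $\overline{\mathbb F}_p$ (so $R=W(\overline{\mathbb F}_p)$), let $\phi$ be its Frobenius automorphism and put $\delta a=(\phi(a)-a^p)/p$. *Conventions.* On $R\{x\}=R[x,x',x'',\dots]$ let $\phi$ be the ring endomorphism extending $\phi$ on $R$ with $\phi(x^{(i)})=(x^{(i)})^p+p\,x^{(i+1)}$, and put $\delta f=(\phi(f)-f^p)/p$. For $X=\mathrm{Spec}\,R[x]/(f)$ (or the $\mathrm{Spf}$ of its $p$-adic completion) let $J^n(X)=\mathrm{Spf}\,R[x,\dots,x^{(n)}]^{\wedge}/(f,\delta f,\dots,\delta^n f)$, with the projections $\pi:J^n(X)\to J^{n-1}(X)$ induced by the inclusions and the $\phi$-linear morphisms $\pi_\phi:J^n(X)\to J^{n-1}(X)$ induced by $\phi$. Let $\nabla^n:X(R)\to J^n(X)(R)$ be the map given in coordinates by $a\mapsto(a,\delta a,\dots,\delta^n a)$. A $\phi^r$-linear morphism $h$ acts on $R$-points by $P\mapsto h\circ P\circ\phi^{-r}$. A $\delta$-map $X\to Y$ of order $n$ is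 a morphism $J^n(X)\to\widehat Y$ over $R$; it acts on $R$-points by $P\mapsto f(\nabla^n P)$. For an affine group scheme $G$ and $r\ge 1$ let $L^r_\delta(G)=\mathrm{Ker}(\pi:J^r(G)\to J^{r-1}(G))$, with group law $+_{\delta}$ and neutral element $0$, and let $ex^r:L^r_\delta(G)\to G$ be the map on $R$-points induced by the composition of the inclusion $L_\delta^r(G)\subset J^r(G)$ with the $r$ morphisms $\pi_\phi:J^r(G)\to J^{r-1}(G)\to\cdots\to\widehat G$. A homomorphism $f:G\to G'$ induces $L^r_\delta(f):L^r_\delta(G)\to L^r_\delta(G')$. We write $a\equiv b$ mod $p^m$ if the $R/p^m$-points induced by the $R$-points $a,b$ coincide. "Linear" means isomorphic to a closed subgroup scheme of some $GL_n$. All points below are $R$-points. **Proposition.** Let $G$ be a smooth linear group scheme over $R$ and let $r,s,t\ge 1$. 1. There is a unique $\delta$-map $[\ ,\ ]_\delta:L^r_\delta(G)\times L^s_\delta(G)\to L^{r+s}_\delta(G)$ of order $\max\{r,s\}$ such that $ex^{r+s}([\alpha,\beta]_\delta)=ex^r(\alpha)\,ex^s(\beta)\,ex^r(\alpha)^{-1}\,ex^s(\beta)^{-1}$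 for all $\alpha\in L^r_\delta(G)$, $\beta\in L^s_\delta(G)$. 2. (Functoriality) For every homomorphism $f:G\to G'$ of smooth linear group schemes over $R$ and all $\alpha,\beta$ as above, $[L^r_\delta(f)(\alpha),L^s_\delta(f)(\beta)]_\delta=L^{r+s}_\delta(f)([\alpha,\beta]_\delta)$. 3. For every $m\geq 0$: if $\alpha_1\equiv\alpha_2$ mod $p^m$ in $L^r_\delta(G)$ and $\beta_1\equiv\beta_2$ mod $p^m$ in $L^s_\delta(G)$, then $[\alpha_1,\beta_1]_\delta\equiv[\alpha_2,\beta_2]_\delta$ mod $p^m$. 4. (Linearity) $[\alpha_1+_\delta\alpha_2,\beta]_\delta\equiv[\alpha_1,\beta]_\delta+_\delta[\alpha_2,\beta]_\delta$ mod $p$ for $\alpha_1,\alpha_2\in L^r_\delta(G)$, $\beta\in L^s_\delta(G)$. 5. (Antisymmetry) $[\alpha,\beta]_\delta+_\delta[\beta,\alpha]_\delta\equiv 0$ mod $p$ for $\alpha\in L^r_\delta(G)$, $\beta\in L^s_\delta(G)$. 6. (Jacobi identity) $[[\alpha,\beta]_\delta,\gamma]_\delta+_\delta[[\beta,\gamma]_\delta,\alpha]_\delta+_\delta[[\gamma,\alpha]_\delta,\beta]_\delta\equiv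 0$ mod $p$ for $\alpha\in L^r_\delta(G)$, $\beta\in L^s_\delta(G)$, $\gamma\in L^t_\delta(G)$. 7. Let $G=GL_n=\mathrm{Spec}\,R[x,\det(x)^{-1}]$, and identify $L^i_\delta(GL_n)$ with $\mathfrak{gl}_n$ by means of the coordinates $x^{(i)}=(\delta^i x_{jk})$. Then for $\alpha\in L^r_\delta(GL_n)$ and $\beta\in L^s_\delta(GL_n)$ $$[\alpha,\beta]_\delta\equiv\alpha^{(p^s)}\beta^{(p^r)}-\beta^{(p^r)}\alpha^{(p^s)}\ \text{ mod } p$$ as $n\times n$ matrices over $R$, where $a^{(q)}$ denotes the matrix whose entries are the $q$-th powers of the entries of $a$. -/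

import Mathlib

open scoped TensorProduct

universe u v w

set_option linter.unusedSectionVars false

namespace DeltaLie

noncomputable section

/-! ### The base ring -/

/-- A domain `R` in which `p ≠ 0`, with an automorphism `φ` that lifts the `p`-power Frobenius. -/
class FrobeniusRing (p : ℕ) (R : Type w) [CommRing R] [IsDomain R] where
  /-- The automorphism `φ`. -/
  frob : R ≃+* R
  dvd_frob_sub_pow : ∀ x, (p : R) ∣ frob x - x ^ p
  p_ne_zero : (p : R) ≠ 0

/-- The complete discrete valuation ring with maximal ideal generated by `p` and residue field an
algebraic closure of `𝔽_p`, realised as a ring of Witt vectors. -/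
def BaseRing (p : ℕ) [Fact p.Prime] : Type := WittVector p (AlgebraicClosure (ZMod p))

section Base

variable (p : ℕ) [Fact p.Prime]

instance : CommRing (BaseRing p) :=
  inferInstanceAs (CommRing (WittVector p (AlgebraicClosure (ZMod p))))

instance : IsDomain (BaseRing p) :=
  inferInstanceAs (IsDomain (WittVector p (AlgebraicClosure (ZMod p))))

instance : IsDiscreteValuationRing (BaseRing p) :=
  inferInstanceAs (IsDiscreteValuationRing (WittVector p (AlgebraicClosure (ZMod p))))

instance : IsAdicComplete (Ideal.span {(p : BaseRing p)}) (BaseRing p) :=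
  inferInstanceAs (IsAdicComplete
    (Ideal.span {(p : WittVector p (AlgebraicClosure (ZMod p)))})
    (WittVector p (AlgebraicClosure (ZMod p))))

theorem witt_dvd_frobenius_sub_pow (x : WittVector p (AlgebraicClosure (ZMod p))) :
    (p : WittVector p (AlgebraicClosure (ZMod p))) ∣
      WittVector.frobeniusEquiv p (AlgebraicClosure (ZMod p)) x - x ^ p := by
  rw [← Ideal.mem_span_singleton,
    ← WittVector.ker_constantCoeff (p := p) (k := AlgebraicClosure (ZMod p)), RingHom.mem_ker,
    map_sub, map_pow, sub_eq_zero]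
  exact WittVector.coeff_frobenius_charP p x 0

/-- The base ring with its Frobenius automorphism. -/
instance : FrobeniusRing p (BaseRing p) where
  frob := WittVector.frobeniusEquiv p (AlgebraicClosure (ZMod p))
  dvd_frob_sub_pow := witt_dvd_frobenius_sub_pow p
  p_ne_zero := WittVector.p_nonzero p (AlgebraicClosure (ZMod p))

end Base

section Delta

variable (p : ℕ) {R : Type w} [CommRing R] [IsDomain R] [FrobeniusRing p R]

/-- The automorphism `φ` of the base ring that lifts the `p`-power Frobenius. -/
def frob : R ≃+* R := FrobeniusRing.frob p

theorem dvd_frob_sub_pow (x : R) : (p : R) ∣ frob p x - x ^ p :=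
  FrobeniusRing.dvd_frob_sub_pow x

variable (R) in
theorem p_ne_zero : (p : R) ≠ 0 := FrobeniusRing.p_ne_zero

/-- The `p`-derivation `δ x = (φ x - x ^ p) / p` of the base ring. -/
def delta (x : R) : R := (dvd_frob_sub_pow p x).choose

theorem frob_eq (x : R) : frob p x = x ^ p + p * delta p x := by
  rw [delta, ← (dvd_frob_sub_pow p x).choose_spec]; ring

end Delta

/-! ### Differential polynomials -/

section Poly

/-- The ring `R{x} = R[x, x', x'', …]`; the pair `(a, i)` stands for the variable `x_a^{(i)}`. -/
abbrev DPoly (R : Type w) [CommRing R] (σ : Type u) : Type (max u w) := MvPolynomial (σ × ℕ) R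

variable {R : Type w} [CommRing R] {σ : Type u}

/-- The subring `R[x, x', …, x^{(n)}]` of `R{x}`. -/
def upTo (R : Type w) [CommRing R] (σ : Type u) (n : ℕ) : Subalgebra R (DPoly R σ) :=
  MvPolynomial.supported R {v | v.2 ≤ n}

theorem X_mem_upTo {n : ℕ} {v : σ × ℕ} (h : v.2 ≤ n) :
    (MvPolynomial.X v : DPoly R σ) ∈ upTo R σ n :=
  Algebra.subset_adjoin ⟨v, h, rfl⟩

theorem upTo_mono {m n : ℕ} (h : m ≤ n) : upTo R σ m ≤ upTo R σ n :=
  MvPolynomial.supported_mono fun _ hv => le_trans hv h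

/-- The embedding of the ordinary polynomial ring `R[x]` in `R{x}`. -/
def const : MvPolynomial σ R →ₐ[R] DPoly R σ :=
  MvPolynomial.rename fun a => (a, 0)

theorem upTo_induction {n : ℕ} {P : DPoly R σ → Prop} (hC : ∀ r, P (MvPolynomial.C r))
    (hX : ∀ a i, i ≤ n → P (MvPolynomial.X (a, i))) (hadd : ∀ f g, P f → P g → P (f + g))
    (hmul : ∀ f g, P f → P g → P (f * g)) {f : DPoly R σ} (hf : f ∈ upTo R σ n) : P f := by
  refine Algebra.adjoin_induction (R := R) (p := fun x _ => P x) ?_ hC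
    (fun x y _ _ => hadd x y) (fun x y _ _ => hmul x y) hf
  rintro _ ⟨⟨a, i⟩, h, rfl⟩
  exact hX a i h

theorem const_mem_upTo (n : ℕ) (f : MvPolynomial σ R) : const f ∈ upTo R σ n := by
  induction f using MvPolynomial.induction_on with
  | C r => simpa [const] using (upTo R σ n).algebraMap_mem r
  | add f g hf hg => rw [map_add]; exact add_mem hf hg
  | mul_X f v hf =>
    rw [map_mul]
    refine mul_mem hf ?_
    simpa [const] using X_mem_upTo (v := (v, 0)) (Nat.zero_le n)

variable {τ : Type v}

/-- The homomorphism `R{x} → R{y}` of differential polynomials induced by a map of variables. -/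
def dmap (f : σ → τ) : DPoly R σ →ₐ[R] DPoly R τ :=
  MvPolynomial.rename fun v => (f v.1, v.2)

theorem dmap_const (f : σ → τ) (g : MvPolynomial σ R) :
    dmap f (const g) = const (MvPolynomial.rename f g) := by
  simp only [dmap, const, MvPolynomial.rename_rename]; rfl

theorem dmap_mem_upTo (f : σ → τ) {n : ℕ} {g : DPoly R σ} (hg : g ∈ upTo R σ n) :
    dmap f g ∈ upTo R τ n := by
  refine upTo_induction (P := fun g => dmap f g ∈ upTo R τ n) ?_ ?_ ?_ ?_ hg
  · intro r; simpa [dmap] using (upTo R τ n).algebraMap_mem r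
  · intro a i hi; simpa [dmap] using X_mem_upTo (v := (f a, i)) hi
  · intro f g hf hg; rw [map_add]; exact add_mem hf hg
  · intro f g hf hg; rw [map_mul]; exact mul_mem hf hg

end Poly

section DPoly

variable (p : ℕ) [Fact p.Prime] {R : Type w} [CommRing R] [IsDomain R] [FrobeniusRing p R]
  {σ : Type u}

theorem dpoly_p_ne_zero : (p : DPoly R σ) ≠ 0 := by
  rw [← map_natCast (MvPolynomial.C : R →+* DPoly R σ), Ne, MvPolynomial.C_eq_zero]
  exact p_ne_zero p R

/-- The lift of Frobenius on `R{x}` that extends `φ` and has `φ(x^{(i)}) = (x^{(i)})^p + p x^{(i+1)}`. -/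
def dfrob : DPoly R σ →+* DPoly R σ :=
  MvPolynomial.eval₂Hom (MvPolynomial.C.comp ((frob p : R ≃+* R) : R →+* R))
    fun v => MvPolynomial.X v ^ p + (p : DPoly R σ) * MvPolynomial.X (v.1, v.2 + 1)

@[simp] theorem dfrob_C (r : R) :
    dfrob p (MvPolynomial.C r : DPoly R σ) = MvPolynomial.C (frob p r) := by
  simp [dfrob]

@[simp] theorem dfrob_X (v : σ × ℕ) :
    dfrob p (MvPolynomial.X v : DPoly R σ) =
      MvPolynomial.X v ^ p + (p : DPoly R σ) * MvPolynomial.X (v.1, v.2 + 1) := by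
  simp [dfrob]

theorem dvd_dfrob_sub_pow (f : DPoly R σ) : (p : DPoly R σ) ∣ dfrob p f - f ^ p := by
  induction f using MvPolynomial.induction_on with
  | C r =>
    rw [dfrob_C, ← map_pow, ← map_sub, ← map_natCast (MvPolynomial.C : R →+* DPoly R σ)]
    exact map_dvd _ (dvd_frob_sub_pow p r)
  | add f g hf hg =>
    obtain ⟨c, hc⟩ := exists_add_pow_prime_eq (Fact.out : p.Prime) f g
    rw [map_add, hc]
    have : dfrob p f + dfrob p g - (f ^ p + g ^ p + p * f * g * c)
        = (dfrob p f - f ^ p) + (dfrob p g - g ^ p) - p * (f * g * c) := by ring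
    rw [this]
    exact dvd_sub (dvd_add hf hg) (dvd_mul_right _ _)
  | mul_X f v hf =>
    rw [map_mul, dfrob_X, mul_pow]
    have : dfrob p f * (MvPolynomial.X v ^ p + (p : DPoly R σ) * MvPolynomial.X (v.1, v.2 + 1))
        - f ^ p * MvPolynomial.X v ^ p = (dfrob p f - f ^ p) * MvPolynomial.X v ^ p
          + (p : DPoly R σ) * (dfrob p f * MvPolynomial.X (v.1, v.2 + 1)) := by ring
    rw [this]
    exact dvd_add (Dvd.dvd.mul_right hf _) (dvd_mul_right _ _)

/-- The `p`-derivation `δ f = (φ f - f ^ p) / p` of `R{x}`. -/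
def ddelta (f : DPoly R σ) : DPoly R σ := (dvd_dfrob_sub_pow p f).choose

theorem dfrob_eq (f : DPoly R σ) : dfrob p f = f ^ p + p * ddelta p f := by
  rw [ddelta, ← (dvd_dfrob_sub_pow p f).choose_spec]; ring

theorem dfrob_mem_upTo {n : ℕ} {f : DPoly R σ} (hf : f ∈ upTo R σ n) :
    dfrob p f ∈ upTo R σ (n + 1) := by
  refine upTo_induction (P := fun f => dfrob p f ∈ upTo R σ (n + 1)) ?_ ?_ ?_ ?_ hf
  · intro r; rw [dfrob_C]; exact (upTo R σ (n + 1)).algebraMap_mem _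
  · intro a i hi
    rw [dfrob_X]
    exact add_mem (pow_mem (X_mem_upTo (by simpa using by omega)) _)
      (mul_mem (natCast_mem _ _) (X_mem_upTo (by simpa using hi)))
  · intro f g hf hg; rw [map_add]; exact add_mem hf hg
  · intro f g hf hg; rw [map_mul]; exact mul_mem hf hg

theorem ddelta_mem_upTo {n : ℕ} {f : DPoly R σ} (hf : f ∈ upTo R σ n) :
    ddelta p f ∈ upTo R σ (n + 1) := by
  have h : (MvPolynomial.C (p : R) : DPoly R σ) * ddelta p f ∈ upTo R σ (n + 1) := by
    have : (MvPolynomial.C (p : R) : DPoly R σ) * ddelta p f = dfrob p f - f ^ p := by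
      rw [dfrob_eq, map_natCast]; ring
    rw [this]
    exact sub_mem (dfrob_mem_upTo p hf) (pow_mem (upTo_mono (Nat.le_succ n) hf) _)
  classical
  rw [upTo, MvPolynomial.mem_supported] at h ⊢
  rwa [MvPolynomial.vars_C_mul _ (p_ne_zero p R)] at h

theorem iterate_ddelta_mem_upTo {i n : ℕ} (hi : i ≤ n) (f : MvPolynomial σ R) :
    (ddelta p)^[i] (const f) ∈ upTo R σ n := by
  refine upTo_mono hi ?_
  clear hi
  induction i with
  | zero => exact const_mem_upTo 0 f
  | succ i ih => rw [Function.iterate_succ_apply']; exact ddelta_mem_upTo p ih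

variable {τ : Type v}

theorem dmap_dfrob (f : σ → τ) (g : DPoly R σ) : dmap f (dfrob p g) = dfrob p (dmap f g) := by
  induction g using MvPolynomial.induction_on with
  | C r => simp [dmap]
  | add g h hg hh => simp only [map_add, hg, hh]
  | mul_X g v hg =>
    rw [map_mul, map_mul, hg, map_mul, map_mul]
    congr 1
    simp [dmap]

theorem dmap_ddelta (f : σ → τ) (g : DPoly R σ) :
    dmap f (ddelta p g) = ddelta p (dmap f g) := by
  have h := dmap_dfrob p f g
  rw [dfrob_eq, dfrob_eq, map_add, map_mul, map_pow, map_natCast] at h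
  exact mul_left_cancel₀ (dpoly_p_ne_zero p) (add_left_cancel h)

theorem dmap_iterate (f : σ → τ) (i : ℕ) (g : DPoly R σ) :
    dmap f ((ddelta p)^[i] g) = (ddelta p)^[i] (dmap f g) := by
  induction i with
  | zero => rfl
  | succ i ih => rw [Function.iterate_succ_apply', Function.iterate_succ_apply', dmap_ddelta, ih]

end DPoly

/-! ### `p`-jet algebras -/

section Jet

variable (p : ℕ) [Fact p.Prime] (R : Type w) [CommRing R] [IsDomain R] [FrobeniusRing p R]
  (B : Type u) [CommRing B] [Algebra R B]

/-- The ideal of relations of the presentation of `B` in which every element is a generator. -/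
abbrev relIdeal : Ideal (MvPolynomial B R) :=
  RingHom.ker (MvPolynomial.aeval (R := R) (id : B → B))

/-- The ideal `(f, δ f, …, δ^n f)` of `R[x, x', …, x^{(n)}]`, where `f` runs over the relations
of `B`. -/
def jetIdeal (n : ℕ) : Ideal (upTo R B n) :=
  Ideal.span {g | ∃ f ∈ relIdeal R B, ∃ i ≤ n, (g : DPoly R B) = (ddelta p)^[i] (const f)}

/-- The algebra `R[x, x', …, x^{(n)}] / (f, δ f, …, δ^n f)`, where `B = R[x] / (f)`. Its `p`-adic
completion is the ring of functions of the `p`-jet space of order `n` of `Spec B`, or of the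
`p`-formal scheme `Spf` of the `p`-adic completion of `B`. -/
def Jet (n : ℕ) : Type (max u w) := upTo R B n ⧸ jetIdeal p R B n

instance (n : ℕ) : CommRing (Jet p R B n) :=
  inferInstanceAs (CommRing (upTo R B n ⧸ jetIdeal p R B n))

instance (n : ℕ) : Algebra R (Jet p R B n) :=
  inferInstanceAs (Algebra R (upTo R B n ⧸ jetIdeal p R B n))

variable {R B}

/-- The quotient map `R[x, x', …, x^{(n)}] → O(J^n)`. -/
def Jet.mk (n : ℕ) : upTo R B n →ₐ[R] Jet p R B n := Ideal.Quotient.mkₐ _ (jetIdeal p R B n)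

theorem Jet.mk_surjective (n : ℕ) : Function.Surjective (Jet.mk p (R := R) (B := B) n) :=
  Ideal.Quotient.mk_surjective

theorem Jet.mk_eq_zero {n i : ℕ} (hi : i ≤ n) {f : MvPolynomial B R}
    (hf : f ∈ relIdeal R B) (g : upTo R B n) (hg : (g : DPoly R B) = (ddelta p)^[i] (const f)) :
    Jet.mk p n g = 0 :=
  Ideal.Quotient.eq_zero_iff_mem.2 (Ideal.subset_span ⟨f, hf, i, hi, hg⟩)

theorem jetIdeal_le_ker {n : ℕ} {S : Type v} [CommRing S] (θ : upTo R B n →+* S)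
    (h : ∀ f ∈ relIdeal R B, ∀ i ≤ n, ∀ g : upTo R B n,
      (g : DPoly R B) = (ddelta p)^[i] (const f) → θ g = 0) : jetIdeal p R B n ≤ RingHom.ker θ := by
  refine Ideal.span_le.2 ?_
  rintro g ⟨f, hf, i, hi, hg⟩
  exact h f hf i hi g hg

/-- Homomorphisms out of the jet algebra. -/
def Jet.lift {n : ℕ} {S : Type v} [CommRing S] [Algebra R S]
    (θ : upTo R B n →ₐ[R] S)
    (h : ∀ f ∈ relIdeal R B, ∀ i ≤ n, ∀ g : upTo R B n,
      (g : DPoly R B) = (ddelta p)^[i] (const f) → θ g = 0) : Jet p R B n →ₐ[R] S :=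
  Ideal.Quotient.liftₐ (jetIdeal p R B n) θ fun _ ha =>
    (jetIdeal_le_ker p (θ : upTo R B n →+* S) h) ha

@[simp] theorem Jet.lift_mk {n : ℕ} {S : Type v} [CommRing S] [Algebra R S]
    (θ : upTo R B n →ₐ[R] S) (h) (g : upTo R B n) :
    Jet.lift p θ h (Jet.mk p n g) = θ g := rfl

/-- The class of the variable `x_b^{(i)}`. -/
def Jet.var (n : ℕ) (b : B) (i : ℕ) (hi : i ≤ n) : Jet p R B n :=
  Jet.mk p n ⟨MvPolynomial.X (b, i), X_mem_upTo hi⟩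

theorem upTo_algHom_ext {n : ℕ} {S : Type v} [CommRing S] [Algebra R S]
    {θ θ' : upTo R B n →ₐ[R] S}
    (h : ∀ b i (hi : i ≤ n), θ ⟨MvPolynomial.X (b, i), X_mem_upTo hi⟩ =
      θ' ⟨MvPolynomial.X (b, i), X_mem_upTo hi⟩) : θ = θ' := by
  refine AlgHom.adjoin_ext (s := MvPolynomial.X '' {v : B × ℕ | v.2 ≤ n}) ?_
  rintro _ ⟨⟨b, i⟩, hi, rfl⟩
  exact h b i hi

theorem Jet.algHom_ext {n : ℕ} {S : Type v} [CommRing S] [Algebra R S]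
    {ψ ψ' : Jet p R B n →ₐ[R] S}
    (h : ∀ b i (hi : i ≤ n), ψ (Jet.var p n b i hi) = ψ' (Jet.var p n b i hi)) : ψ = ψ' := by
  have : ψ.comp (Jet.mk p n) = ψ'.comp (Jet.mk p n) := upTo_algHom_ext h
  refine AlgHom.ext fun y => ?_
  obtain ⟨g, rfl⟩ := Jet.mk_surjective p n y
  exact DFunLike.congr_fun this g

/-- The homomorphism `O(J^m) → O(J^n)`, `m ≤ n`, of the projection `π : J^n → J^m`. -/
def Jet.incl {m n : ℕ} (h : m ≤ n) : Jet p R B m →ₐ[R] Jet p R B n :=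
  Jet.lift p ((Jet.mk p n).comp (Subalgebra.inclusion (upTo_mono h)))
    fun _ hf _ hi g hg => by
      rw [AlgHom.comp_apply]
      exact Jet.mk_eq_zero p (hi.trans h) hf _ ((Subalgebra.coe_inclusion _ g).trans hg)

@[simp] theorem Jet.incl_var {m n : ℕ} (h : m ≤ n) (b : B) (i : ℕ) (hi : i ≤ m) :
    Jet.incl p h (Jet.var p (R := R) m b i hi) = Jet.var p n b i (hi.trans h) := rfl

/-- The homomorphism `φ : R[x, …, x^{(n)}] → R[x, …, x^{(n+1)}]`. -/
def upTo.frob (n : ℕ) : upTo R B n →+* upTo R B (n + 1) :=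
  ((dfrob p).comp (upTo R B n).val.toRingHom).codRestrict (upTo R B (n + 1)) fun x =>
    dfrob_mem_upTo p x.2

theorem upTo.coe_frob (n : ℕ) (g : upTo R B n) :
    (upTo.frob p n g : DPoly R B) = dfrob p (g : DPoly R B) := rfl

theorem upTo.frob_eq (n : ℕ) (g : upTo R B n) :
    upTo.frob p n g = Subalgebra.inclusion (upTo_mono (Nat.le_succ n)) g ^ p +
      p * ⟨ddelta p (g : DPoly R B), ddelta_mem_upTo p g.2⟩ := by
  apply Subtype.ext
  rw [upTo.coe_frob, dfrob_eq, Subalgebra.coe_add, Subalgebra.coe_mul, Subalgebra.coe_pow,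
    Subalgebra.coe_inclusion]
  rfl

theorem Jet.frob_aux (n : ℕ) (a : upTo R B n) (ha : a ∈ jetIdeal p R B n) :
    ((Jet.mk p (n + 1)).toRingHom.comp (upTo.frob p n)) a = 0 := by
  refine jetIdeal_le_ker p ((Jet.mk p (n + 1)).toRingHom.comp (upTo.frob p n)) ?_ ha
  intro f hf i hi g hg
  rw [RingHom.comp_apply, upTo.frob_eq, map_add, map_mul, map_pow]
  have h1 : (Jet.mk p (n + 1)).toRingHom (Subalgebra.inclusion (upTo_mono (Nat.le_succ n)) g) = 0 :=
    Jet.mk_eq_zero p (hi.trans (Nat.le_succ n)) hf _ ((Subalgebra.coe_inclusion _ g).trans hg)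
  have h2 : (Jet.mk p (n + 1)).toRingHom
      ⟨ddelta p (g : DPoly R B), ddelta_mem_upTo p g.2⟩ = 0 :=
    Jet.mk_eq_zero p (Nat.succ_le_succ hi) hf _ (by rw [Function.iterate_succ_apply', ← hg])
  rw [h1, h2, zero_pow (Fact.out : p.Prime).ne_zero, mul_zero, add_zero]

/-- The homomorphism `φ : O(J^n) → O(J^{n+1})` of the `φ`-linear morphism
`π_φ : J^{n+1} → J^n`. -/
def Jet.frob (n : ℕ) : Jet p R B n →+* Jet p R B (n + 1) :=
  Ideal.Quotient.lift (jetIdeal p R B n) ((Jet.mk p (n + 1)).toRingHom.comp (upTo.frob p n))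
    (Jet.frob_aux p n)

theorem Jet.frob_mk (n : ℕ) (g : upTo R B n) :
    Jet.frob p n (Jet.mk p n g) = Jet.mk p (n + 1) (upTo.frob p n g) := rfl

theorem Jet.frob_algebraMap (n : ℕ) (r : R) :
    Jet.frob p n (algebraMap R (Jet p R B n) r) = algebraMap R _ (DeltaLie.frob p r) := by
  rw [← (Jet.mk p n).commutes, Jet.frob_mk, ← (Jet.mk p (n + 1)).commutes]
  exact congrArg _ (Subtype.ext (dfrob_C p r))

theorem aeval_id_surjective :
    Function.Surjective (MvPolynomial.aeval (R := R) (id : B → B)) :=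
  fun b => ⟨MvPolynomial.X b, by simp⟩

/-- The homomorphism `B → O(J^0)`, `b ↦ x_b`. -/
def Jet.ofRing : B →ₐ[R] Jet p R B 0 :=
  (Ideal.Quotient.liftₐ (relIdeal R B)
    ((Jet.mk p 0).comp (const.codRestrict (upTo R B 0) (const_mem_upTo 0)))
    fun _ hf => Jet.mk_eq_zero p le_rfl hf _ rfl).comp
  (Ideal.quotientKerAlgEquivOfSurjective (aeval_id_surjective (R := R) (B := B))).symm.toAlgHom

theorem Jet.ofRing_aeval (f : MvPolynomial B R) :
    Jet.ofRing p (MvPolynomial.aeval (id : B → B) f) =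
      Jet.mk p 0 ⟨const f, const_mem_upTo 0 f⟩ := by
  have : (Ideal.quotientKerAlgEquivOfSurjective (aeval_id_surjective (R := R) (B := B))).symm
      (MvPolynomial.aeval (id : B → B) f) = Ideal.Quotient.mk _ f := by
    rw [AlgEquiv.symm_apply_eq]; rfl
  exact congrArg (Ideal.Quotient.liftₐ (relIdeal R B)
    ((Jet.mk p 0).comp (const.codRestrict (upTo R B 0) (const_mem_upTo 0)))
    fun _ hf => Jet.mk_eq_zero p le_rfl hf _ rfl) this

theorem Jet.ofRing_apply (b : B) : Jet.ofRing p (R := R) b = Jet.var p 0 b 0 le_rfl := by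
  have h := Jet.ofRing_aeval p (R := R) (B := B) (MvPolynomial.X b)
  rw [MvPolynomial.aeval_X, id] at h
  rw [h]
  exact congrArg _ (Subtype.ext (by simp [const]))

variable (R B) in
/-- The homomorphism `φ^n : B → O(J^n)` of the composition
`J^n → J^{n-1} → ⋯ → J^0` of the morphisms `π_φ`. -/
def Jet.frobPow : (n : ℕ) → B →+* Jet p R B n
  | 0 => (Jet.ofRing p).toRingHom
  | n + 1 => (Jet.frob p n).comp (Jet.frobPow n)

theorem Jet.frobPow_algebraMap (n : ℕ) (r : R) :
    Jet.frobPow p R B n (algebraMap R B r) = algebraMap R _ ((DeltaLie.frob p)^[n] r) := by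
  induction n with
  | zero => exact (Jet.ofRing p (R := R) (B := B)).commutes r
  | succ n ih =>
    rw [Function.iterate_succ_apply', ← Jet.frob_algebraMap, ← ih, Jet.frobPow, RingHom.comp_apply]

theorem iterate_dfrob_mem_upTo (n : ℕ) {f : DPoly R B} (hf : f ∈ upTo R B 0) :
    (dfrob p)^[n] f ∈ upTo R B n := by
  induction n with
  | zero => exact hf
  | succ n ih => rw [Function.iterate_succ_apply']; exact dfrob_mem_upTo p ih

theorem Jet.frobPow_apply (n : ℕ) (b : B) :
    Jet.frobPow p R B n b = Jet.mk p n ⟨(dfrob p)^[n] (MvPolynomial.X (b, 0)),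
      iterate_dfrob_mem_upTo p n (X_mem_upTo le_rfl)⟩ := by
  induction n with
  | zero => exact Jet.ofRing_apply p b
  | succ n ih =>
    change Jet.frob p n (Jet.frobPow p R B n b) = _
    rw [ih, Jet.frob_mk]
    exact congrArg _ (Subtype.ext ((upTo.coe_frob p n _).trans
      (Function.iterate_succ_apply' (dfrob p) _ _).symm))

/-! #### Functoriality -/

variable {B' : Type v} [CommRing B'] [Algebra R B']

theorem rename_mem_relIdeal (f : B →ₐ[R] B') {g : MvPolynomial B R}
    (hg : g ∈ relIdeal R B) : MvPolynomial.rename f g ∈ relIdeal R B' := by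
  rw [relIdeal, RingHom.mem_ker] at hg ⊢
  rw [MvPolynomial.aeval_rename]
  have h2 : MvPolynomial.aeval (R := R) (id ∘ f) g = f (MvPolynomial.aeval id g) := by
    rw [MvPolynomial.comp_aeval_apply]; rfl
  rw [h2, hg, map_zero]

/-- The homomorphism `R[x, …, x^{(n)}] → R[y, …, y^{(n)}]` induced by a map of variables. -/
def upTo.map (R : Type w) [CommRing R] {σ : Type u} {τ : Type v} (f : σ → τ) (n : ℕ) :
    upTo R σ n →ₐ[R] upTo R τ n :=
  ((dmap f).comp (upTo R σ n).val).codRestrict (upTo R τ n) fun x => dmap_mem_upTo f x.2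

theorem upTo.coe_map {σ : Type u} {τ : Type v} (f : σ → τ) (n : ℕ) (g : upTo R σ n) :
    (upTo.map R f n g : DPoly R τ) = dmap f (g : DPoly R σ) := rfl

/-- Functoriality of the jet algebras: `x_b^{(i)} ↦ x_{f b}^{(i)}`. -/
def Jet.map (f : B →ₐ[R] B') (n : ℕ) : Jet p R B n →ₐ[R] Jet p R B' n :=
  Jet.lift p ((Jet.mk p n).comp (upTo.map R f n)) fun g hg i hi k hk => by
    rw [AlgHom.comp_apply]
    exact Jet.mk_eq_zero p hi (rename_mem_relIdeal f hg) _
      (by rw [upTo.coe_map, hk, dmap_iterate, dmap_const])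

@[simp] theorem Jet.map_var (f : B →ₐ[R] B') (n : ℕ) (b : B) (i : ℕ) (hi : i ≤ n) :
    Jet.map p f n (Jet.var p n b i hi) = Jet.var p n (f b) i hi :=
  congrArg (Jet.mk p n) (Subtype.ext ((upTo.coe_map f n _).trans (by simp [dmap])))

end Jet

/-! ### Points of `p`-jet spaces -/

section Ghost

variable (p : ℕ) [Fact p.Prime] {R : Type w} [CommRing R] [IsDomain R] [FrobeniusRing p R]

/-- The value of `φ^i(x)` at `x = c 0, x' = c 1, x'' = c 2, …`. -/
def ghost : (ℕ → R) → ℕ → R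
  | c, 0 => c 0
  | c, i + 1 => ghost c i ^ p + p * ghost (fun k => c (k + 1)) i

theorem ghost_congr {i : ℕ} {c d : ℕ → R} (h : ∀ k ≤ i, c k = d k) :
    ghost p c i = ghost p d i := by
  induction i generalizing c d with
  | zero => exact h 0 le_rfl
  | succ i ih =>
    rw [ghost, ghost, ih fun k hk => h k (hk.trans (Nat.le_succ i)),
      ih fun k hk => h (k + 1) (Nat.succ_le_succ hk)]

theorem ghost_injective {n : ℕ} {c d : ℕ → R} (h : ∀ i ≤ n, ghost p c i = ghost p d i) :
    ∀ i ≤ n, c i = d i := by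
  induction n generalizing c d with
  | zero =>
    intro i hi
    obtain rfl : i = 0 := by omega
    exact h 0 le_rfl
  | succ n ih =>
    have h1 : ∀ i ≤ n, ghost p (fun k => c (k + 1)) i = ghost p (fun k => d (k + 1)) i := by
      intro i hi
      have h2 := h (i + 1) (Nat.succ_le_succ hi)
      rw [ghost, ghost, h i (hi.trans (Nat.le_succ n))] at h2
      exact mul_left_cancel₀ (p_ne_zero p R) (add_left_cancel h2)
    intro i hi
    cases i with
    | zero => exact h 0 (Nat.zero_le _)
    | succ i => exact ih h1 i (Nat.le_of_succ_le_succ hi)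

theorem dvd_pow_p_sub {x y : R} {i : ℕ} (h : (p : R) ^ (i + 1) ∣ x - y) :
    (p : R) ^ (i + 2) ∣ x ^ p - y ^ p := by
  rw [← (Commute.all x y).geom_sum₂_mul, pow_succ' (p : R) (i + 1)]
  exact mul_dvd_mul (dvd_geom_sum₂_self (dvd_trans (Dvd.intro_left _ (pow_succ _ i).symm) h)) h

theorem ghost_dvd (c : ℕ → R) (i : ℕ) :
    (p : R) ^ (i + 1) ∣ ghost p c (i + 1) - frob p (ghost p c i) := by
  induction i generalizing c with
  | zero =>
    simp only [ghost, frob_eq, zero_add, pow_one]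
    exact ⟨c 1 - delta p (c 0), by ring⟩
  | succ i ih =>
    have h1 := dvd_pow_p_sub p (ih c)
    have h2 := mul_dvd_mul_left (p : R) (ih fun k => c (k + 1))
    rw [← pow_succ'] at h2
    have e : ghost p c (i + 1 + 1) - frob p (ghost p c (i + 1)) =
        (ghost p c (i + 1) ^ p - frob p (ghost p c i) ^ p) +
        p * (ghost p (fun k => c (k + 1)) (i + 1) - frob p (ghost p (fun k => c (k + 1)) i)) := by
      rw [ghost, show frob p (ghost p c (i + 1)) = frob p (ghost p c i ^ p +
        p * ghost p (fun k => c (k + 1)) i) from rfl, map_add, map_mul, map_pow, map_natCast]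
      ring
    rw [e]
    exact dvd_add h1 h2

theorem exists_ghost_eq (n : ℕ) (g : ℕ → R)
    (h : ∀ i < n, (p : R) ^ (i + 1) ∣ g (i + 1) - frob p (g i)) :
    ∃ c : ℕ → R, ∀ i ≤ n, ghost p c i = g i := by
  induction n generalizing g with
  | zero =>
    refine ⟨g, fun i hi => ?_⟩
    obtain rfl : i = 0 := by omega
    rfl
  | succ n ih =>
    have hd : ∀ i, ∃ y, i ≤ n → g (i + 1) - g i ^ p = p * y := by
      intro i
      by_cases hi : i ≤ n
      · obtain ⟨y, hy⟩ := dvd_trans (Dvd.intro_left ((p : R) ^ i) (pow_succ _ _).symm)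
          (h i (by omega))
        refine ⟨y + delta p (g i), fun _ => ?_⟩
        rw [mul_add, ← hy, frob_eq]; ring
      · exact ⟨0, fun h => absurd h hi⟩
    choose g' hg' using hd
    obtain ⟨c, hc⟩ := ih g' fun i hi => by
      have h1 := h (i + 1) (by omega)
      have h2 := dvd_pow_p_sub p (h i (by omega))
      have e : (p : R) * (g' (i + 1) - frob p (g' i)) =
          (g (i + 1 + 1) - frob p (g (i + 1))) - (g (i + 1) ^ p - frob p (g i) ^ p) := by
        have e1 := hg' (i + 1) (by omega)
        have e2 := congrArg (frob p) (hg' i (by omega))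
        rw [map_sub, map_pow, map_mul, map_natCast] at e2
        rw [mul_sub, ← e1, ← e2]; ring
      have h3 := dvd_sub h1 h2
      rw [← e, pow_succ' (p : R) (i + 1)] at h3
      exact (mul_dvd_mul_iff_left (p_ne_zero p R)).1 h3
    refine ⟨fun k => Nat.casesOn k (g 0) c, fun i => ?_⟩
    induction i with
    | zero => intro _; rfl
    | succ i ih' =>
      intro hi
      have hi' : i ≤ n := Nat.le_of_succ_le_succ hi
      rw [ghost, ih' (hi'.trans (Nat.le_succ n))]
      have := hg' i hi'
      rw [show ghost p (fun k => (Nat.casesOn (k + 1) (g 0) c : R)) i = g' i from hc i hi', ← this]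
      ring

theorem iterate_dfrob_natCast {σ : Type u} (i m : ℕ) :
    (dfrob p)^[i] ((m : DPoly R σ)) = m := by
  induction i with
  | zero => rfl
  | succ i ih => rw [Function.iterate_succ_apply, map_natCast, ih]

theorem aeval_iterate_dfrob_X {σ : Type u} (c : σ × ℕ → R) (a : σ) (i j : ℕ) :
    MvPolynomial.aeval c ((dfrob p)^[i] (MvPolynomial.X (a, j) : DPoly R σ)) =
      ghost p (fun k => c (a, k + j)) i := by
  induction i generalizing j with
  | zero => simp [ghost]
  | succ i ih =>
    rw [Function.iterate_succ_apply, dfrob_X, iterate_map_add, iterate_map_mul, iterate_map_pow,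
      iterate_dfrob_natCast, map_add, map_mul, map_pow, map_natCast, ih, ih, ghost]
    simp only [add_assoc, add_comm 1 j]

theorem aeval_ddelta_eq_zero {σ : Type u} (c : σ × ℕ → R) (n : ℕ) (f : DPoly R σ)
    (h : ∀ i ≤ n, MvPolynomial.aeval c ((dfrob p)^[i] f) = 0) :
    ∀ i ≤ n, MvPolynomial.aeval c ((ddelta p)^[i] f) = 0 := by
  induction n generalizing f with
  | zero =>
    intro i hi
    obtain rfl : i = 0 := by omega
    exact h 0 le_rfl
  | succ n ih =>
    intro i hi
    cases i with
    | zero => exact h 0 (Nat.zero_le _)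
    | succ i =>
      rw [Function.iterate_succ_apply]
      refine ih (ddelta p f) (fun j hj => ?_) i (Nat.le_of_succ_le_succ hi)
      have h1 := h (j + 1) (Nat.succ_le_succ hj)
      rw [Function.iterate_succ_apply, dfrob_eq, iterate_map_add, iterate_map_mul, iterate_map_pow,
        iterate_dfrob_natCast, map_add, map_mul, map_pow, map_natCast,
        h j (hj.trans (Nat.le_succ n)), zero_pow (Fact.out : p.Prime).ne_zero, zero_add] at h1
      exact (mul_eq_zero.1 h1).resolve_left (p_ne_zero p R)

/-- The automorphism `φ^i` of the base ring. -/
def frobIter : ℕ → (R ≃+* R)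
  | 0 => RingEquiv.refl R
  | i + 1 => (frobIter i).trans (frob p)

theorem frobIter_apply (i : ℕ) (r : R) : frobIter p i r = (frob p)^[i] r := by
  induction i with
  | zero => rfl
  | succ i ih => rw [Function.iterate_succ_apply', ← ih]; rfl

theorem iterate_dfrob_C {σ : Type u} (i : ℕ) (r : R) :
    (dfrob p)^[i] (MvPolynomial.C r : DPoly R σ) = MvPolynomial.C (frobIter p i r) := by
  induction i with
  | zero => rfl
  | succ i ih => rw [Function.iterate_succ_apply', ih, dfrob_C]; rfl

theorem dvd_frob {k : ℕ} {x : R} (h : (p : R) ^ k ∣ x) : (p : R) ^ k ∣ frob p x := by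
  simpa using map_dvd (frob p : R ≃+* R) h

theorem dvd_frobIter {k i : ℕ} {x : R} (h : (p : R) ^ k ∣ x) : (p : R) ^ k ∣ frobIter p i x := by
  simpa using map_dvd (frobIter p i : R ≃+* R) h

theorem dvd_of_dvd_frobIter {k i : ℕ} {x : R} (h : (p : R) ^ k ∣ frobIter p i x) :
    (p : R) ^ k ∣ x := by
  simpa using map_dvd (frobIter p i : R ≃+* R).symm h

end Ghost

section Points

variable (p : ℕ) [Fact p.Prime] {R : Type w} [CommRing R] [IsDomain R] [FrobeniusRing p R]
  {B : Type u} [CommRing B] [Algebra R B]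

theorem aeval_iterate_dfrob_const (c : B × ℕ → R) (i : ℕ) (P : B →ₐ[R] R)
    (h : ∀ b, ghost p (fun k => c (b, k)) i = frobIter p i (P b)) (f : MvPolynomial B R) :
    MvPolynomial.aeval c ((dfrob p)^[i] (const f)) =
      frobIter p i (P (MvPolynomial.aeval (id : B → B) f)) := by
  induction f using MvPolynomial.induction_on with
  | C r => simp [const, iterate_dfrob_C]
  | add f g hf hg => rw [map_add, iterate_map_add, map_add, hf, hg]; simp
  | mul_X f b hf =>
    rw [map_mul, iterate_map_mul, map_mul, hf]
    have : const (MvPolynomial.X b : MvPolynomial B R) = MvPolynomial.X (b, 0) := by simp [const]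
    rw [this, aeval_iterate_dfrob_X]
    simp [h]

/-- The point of `J^n` with coordinates `x_b^{(k)} = c (b, k)`. -/
def Jet.ofCoord (n : ℕ) (c : B × ℕ → R) (P : ℕ → (B →ₐ[R] R))
    (h : ∀ i ≤ n, ∀ b, ghost p (fun k => c (b, k)) i = frobIter p i (P i b)) :
    Jet p R B n →ₐ[R] R :=
  Jet.lift p ((MvPolynomial.aeval c).comp (upTo R B n).val) fun f hf i hi g hg => by
    rw [AlgHom.comp_apply, Subalgebra.val_apply, hg]
    refine aeval_ddelta_eq_zero p c n (const f) (fun j hj => ?_) i hi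
    rw [aeval_iterate_dfrob_const p c j (P j) (h j hj), show MvPolynomial.aeval (id : B → B) f = 0 from
      RingHom.mem_ker.1 hf, map_zero, map_zero]

theorem Jet.ofCoord_var (n : ℕ) (c : B × ℕ → R) (P : ℕ → (B →ₐ[R] R)) (h) (b : B) (i : ℕ)
    (hi : i ≤ n) : Jet.ofCoord p n c P h (Jet.var p n b i hi) = c (b, i) := by
  change MvPolynomial.aeval c (MvPolynomial.X (b, i)) = c (b, i)
  simp

theorem ghost_delta (i : ℕ) (x : R) :
    ghost p (fun k => (delta p)^[k] x) i = frobIter p i x := by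
  have key : ∀ i (x : R), ghost p (fun k => (delta p)^[k] x) i = (frob p)^[i] x := by
    intro i
    induction i with
    | zero => intro x; rfl
    | succ i ih =>
      intro x
      have : (fun k => (delta p)^[k + 1] x) = fun k => (delta p)^[k] (delta p x) := by
        funext k; rw [Function.iterate_succ_apply]
      rw [ghost, this, ih, ih, Function.iterate_succ_apply, frob_eq, iterate_map_add,
        iterate_map_mul, iterate_map_pow, ← frobIter_apply p i (p : R), map_natCast]
  rw [key, frobIter_apply]

/-- The map `∇^n` from `R`-points of `X = Spec B` to `R`-points of `J^n(X)`:
the point `∇^n P` has coordinates `x_b^{(k)} = δ^k (P b)`. -/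
def Jet.nabla (n : ℕ) (P : B →ₐ[R] R) : Jet p R B n →ₐ[R] R :=
  Jet.ofCoord p n (fun v => (delta p)^[v.2] (P v.1)) (fun _ => P) fun i _ b => ghost_delta p i (P b)

theorem Jet.nabla_var (n : ℕ) (P : B →ₐ[R] R) (b : B) (i : ℕ) (hi : i ≤ n) :
    Jet.nabla p n P (Jet.var p n b i hi) = (delta p)^[i] (P b) :=
  Jet.ofCoord_var p n _ _ _ b i hi

theorem Jet.nabla_comp_incl {m n : ℕ} (h : m ≤ n) (P : B →ₐ[R] R) :
    (Jet.nabla p n P).comp (Jet.incl p h) = Jet.nabla p m P :=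
  Jet.algHom_ext p fun b i hi => by
    rw [AlgHom.comp_apply, Jet.incl_var, Jet.nabla_var, Jet.nabla_var]

theorem Jet.nabla_comp_map {B' : Type v} [CommRing B'] [Algebra R B'] (f : B →ₐ[R] B') (n : ℕ)
    (P : B' →ₐ[R] R) : (Jet.nabla p n P).comp (Jet.map p f n) = Jet.nabla p n (P.comp f) :=
  Jet.algHom_ext p fun b i hi => by
    rw [AlgHom.comp_apply, Jet.map_var, Jet.nabla_var, Jet.nabla_var, AlgHom.comp_apply]

/-- The map from `R`-points of `J^n(X)` to `R`-points of `X` induced by the `φ^n`-linear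
composition `J^n(X) → J^{n-1}(X) → ⋯ → X` of the morphisms `π_φ`; it sends `ψ` to
`φ^{-n} ∘ ψ ∘ φ^n`. -/
def Jet.ex (n : ℕ) (ψ : Jet p R B n →ₐ[R] R) : B →ₐ[R] R :=
  { (frobIter p n).symm.toRingHom.comp (ψ.toRingHom.comp (Jet.frobPow p R B n)) with
    commutes' := fun r => by
      change (frobIter p n).symm (ψ (Jet.frobPow p R B n (algebraMap R B r))) = r
      rw [Jet.frobPow_algebraMap, ψ.commutes, ← frobIter_apply]
      exact (frobIter p n).symm_apply_apply r }

theorem Jet.ex_apply (n : ℕ) (ψ : Jet p R B n →ₐ[R] R) (b : B) :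
    Jet.ex p n ψ b = (frobIter p n).symm (ψ (Jet.frobPow p R B n b)) := rfl

/-- The coordinates of a point of `J^n`. -/
def Jet.coord {n : ℕ} (ψ : Jet p R B n →ₐ[R] R) (v : B × ℕ) : R :=
  if h : v.2 ≤ n then ψ (Jet.var p n v.1 v.2 h) else 0

theorem Jet.coord_of_le {n : ℕ} (ψ : Jet p R B n →ₐ[R] R) (b : B) (i : ℕ) (h : i ≤ n) :
    Jet.coord p ψ (b, i) = ψ (Jet.var p n b i h) := dif_pos h

theorem Jet.apply_mk {n : ℕ} (ψ : Jet p R B n →ₐ[R] R) (g : upTo R B n) :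
    ψ (Jet.mk p n g) = MvPolynomial.aeval (Jet.coord p ψ) (g : DPoly R B) := by
  have : ψ.comp (Jet.mk p n) = (MvPolynomial.aeval (Jet.coord p ψ)).comp (upTo R B n).val :=
    upTo_algHom_ext fun b i hi => by
      rw [AlgHom.comp_apply, AlgHom.comp_apply, Subalgebra.val_apply, MvPolynomial.aeval_X,
        Jet.coord_of_le p ψ b i hi]
      rfl
  exact DFunLike.congr_fun this g

theorem Jet.frobIter_ex (n : ℕ) (ψ : Jet p R B n →ₐ[R] R) (b : B) :
    frobIter p n (Jet.ex p n ψ b) = ghost p (fun k => Jet.coord p ψ (b, k)) n := by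
  rw [Jet.ex_apply, RingEquiv.apply_symm_apply, Jet.frobPow_apply, Jet.apply_mk,
    aeval_iterate_dfrob_X]
  rfl

theorem Jet.frobIter_ex_incl {i n : ℕ} (hi : i ≤ n) (ψ : Jet p R B n →ₐ[R] R) (b : B) :
    frobIter p i (Jet.ex p i (ψ.comp (Jet.incl p hi)) b) =
      ghost p (fun k => Jet.coord p ψ (b, k)) i := by
  rw [Jet.frobIter_ex]
  refine ghost_congr p fun k hk => ?_
  rw [Jet.coord_of_le p _ b k hk, Jet.coord_of_le p _ b k (hk.trans hi), AlgHom.comp_apply,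
    Jet.incl_var]

theorem Jet.ex_nabla (n : ℕ) (P : B →ₐ[R] R) : Jet.ex p n (Jet.nabla p n P) = P := by
  refine AlgHom.ext fun b => (frobIter p n).injective ?_
  rw [Jet.frobIter_ex, ← ghost_delta]
  refine ghost_congr p fun k hk => ?_
  rw [Jet.coord_of_le p _ b k hk, Jet.nabla_var]

theorem Jet.ex_comp_map {B' : Type v} [CommRing B'] [Algebra R B'] (f : B →ₐ[R] B') (n : ℕ)
    (ψ : Jet p R B' n →ₐ[R] R) : Jet.ex p n (ψ.comp (Jet.map p f n)) = (Jet.ex p n ψ).comp f := by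
  refine AlgHom.ext fun b => (frobIter p n).injective ?_
  rw [Jet.frobIter_ex, AlgHom.comp_apply, Jet.frobIter_ex]
  refine ghost_congr p fun k hk => ?_
  rw [Jet.coord_of_le p _ b k hk, Jet.coord_of_le p _ (f b) k hk, AlgHom.comp_apply, Jet.map_var]

theorem Jet.incl_self (n : ℕ) : Jet.incl p (R := R) (B := B) (le_refl n) = AlgHom.id R _ :=
  Jet.algHom_ext p fun b i hi => by rw [Jet.incl_var]; rfl

theorem Jet.incl_comp_incl {l m n : ℕ} (h : l ≤ m) (h' : m ≤ n) :
    (Jet.incl p h').comp (Jet.incl p h) = Jet.incl p (R := R) (B := B) (h.trans h') :=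
  Jet.algHom_ext p fun b i hi => by
    rw [AlgHom.comp_apply, Jet.incl_var, Jet.incl_var, Jet.incl_var]

theorem Jet.map_comp_incl {B' : Type v} [CommRing B'] [Algebra R B'] (f : B →ₐ[R] B') {m n : ℕ}
    (h : m ≤ n) : (Jet.map p f n).comp (Jet.incl p h) = (Jet.incl p h).comp (Jet.map p f m) :=
  Jet.algHom_ext p fun b i hi => by
    rw [AlgHom.comp_apply, AlgHom.comp_apply, Jet.incl_var, Jet.map_var, Jet.map_var, Jet.incl_var]

theorem Jet.ex_succ_sub_dvd {i n : ℕ} (h : i < n) (ψ : Jet p R B n →ₐ[R] R) (b : B) :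
    (p : R) ^ (i + 1) ∣ Jet.ex p (i + 1) (ψ.comp (Jet.incl p h)) b -
      Jet.ex p i (ψ.comp (Jet.incl p h.le)) b := by
  refine dvd_of_dvd_frobIter p (i := i + 1) ?_
  rw [map_sub, Jet.frobIter_ex_incl, frobIter, RingEquiv.trans_apply]
  rw [Jet.frobIter_ex_incl]
  exact ghost_dvd p _ i

theorem Jet.ext_of_ex {n : ℕ} {ψ ψ' : Jet p R B n →ₐ[R] R}
    (h : ∀ i (hi : i ≤ n), Jet.ex p i (ψ.comp (Jet.incl p hi)) =
      Jet.ex p i (ψ'.comp (Jet.incl p hi))) : ψ = ψ' := by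
  refine Jet.algHom_ext p fun b i hi => ?_
  rw [← Jet.coord_of_le, ← Jet.coord_of_le]
  refine ghost_injective p (c := fun k => Jet.coord p ψ (b, k))
    (d := fun k => Jet.coord p ψ' (b, k)) (n := n) (fun j hj => ?_) i hi
  rw [← Jet.frobIter_ex_incl p hj, ← Jet.frobIter_ex_incl p hj, h j hj]

theorem exists_coord (n : ℕ) (P : ℕ → (B →ₐ[R] R))
    (h : ∀ i < n, ∀ b, (p : R) ^ (i + 1) ∣ P (i + 1) b - P i b) (b : B) :
    ∃ c : ℕ → R, ∀ i ≤ n, ghost p c i = frobIter p i (P i b) :=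
  exists_ghost_eq p n (fun i => frobIter p i (P i b)) fun i hi => by
    have := dvd_frobIter p (i := i + 1) (h i hi b)
    rw [map_sub] at this
    exact this

/-- The point `ψ` of `J^n(X)` such that, for `i ≤ n`, the image of `ψ` under the composition
`J^n(X) → J^i(X) → X` of `π`'s and `π_φ`'s is the given point `P i`. -/
def Jet.ofSeq (n : ℕ) (P : ℕ → (B →ₐ[R] R))
    (h : ∀ i < n, ∀ b, (p : R) ^ (i + 1) ∣ P (i + 1) b - P i b) : Jet p R B n →ₐ[R] R :=
  Jet.ofCoord p n (fun v => (exists_coord p n P h v.1).choose v.2) P fun i hi b =>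
    (exists_coord p n P h b).choose_spec i hi

theorem Jet.ex_ofSeq (n : ℕ) (P : ℕ → (B →ₐ[R] R)) (h) (i : ℕ) (hi : i ≤ n) :
    Jet.ex p i ((Jet.ofSeq p n P h).comp (Jet.incl p hi)) = P i := by
  refine AlgHom.ext fun b => (frobIter p i).injective ?_
  rw [Jet.frobIter_ex_incl, ← (exists_coord p n P h b).choose_spec i hi]
  refine ghost_congr p fun k hk => ?_
  rw [Jet.coord_of_le p _ b k (hk.trans hi)]
  exact Jet.ofCoord_var p n _ _ _ b k (hk.trans hi)

/-! #### Products -/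

variable {B' : Type v} [CommRing B'] [Algebra R B']

/-- The `R`-point of `X × X'` with components `P` and `P'`. -/
def pairPt (P : B →ₐ[R] R) (P' : B' →ₐ[R] R) : B ⊗[R] B' →ₐ[R] R :=
  Algebra.TensorProduct.lift P P' fun _ _ => Commute.all _ _

theorem pairPt_sub_dvd {k : ℕ} {P Q : B →ₐ[R] R} {P' Q' : B' →ₐ[R] R}
    (h : ∀ b, (p : R) ^ k ∣ P b - Q b) (h' : ∀ b, (p : R) ^ k ∣ P' b - Q' b) (y : B ⊗[R] B') :
    (p : R) ^ k ∣ pairPt P P' y - pairPt Q Q' y := by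
  induction y with
  | zero => simp
  | tmul b b' =>
    simp only [pairPt, Algebra.TensorProduct.lift_tmul]
    have e : P b * P' b' - Q b * Q' b' = (P b - Q b) * P' b' + Q b * (P' b' - Q' b') := by ring
    rw [e]
    exact dvd_add (Dvd.dvd.mul_right (h b) _) (Dvd.dvd.mul_left (h' b') _)
  | add x y hx hy =>
    rw [map_add, map_add, add_sub_add_comm]
    exact dvd_add hx hy

/-- The point of `J^n(X × X') = J^n(X) × J^n(X')` with components `ψ` and `ψ'`. -/
def Jet.pair {n : ℕ} (ψ : Jet p R B n →ₐ[R] R) (ψ' : Jet p R B' n →ₐ[R] R) :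
    Jet p R (B ⊗[R] B') n →ₐ[R] R :=
  Jet.ofSeq p n
    (fun i => if hi : i ≤ n then pairPt (Jet.ex p i (ψ.comp (Jet.incl p hi)))
      (Jet.ex p i (ψ'.comp (Jet.incl p hi))) else
        pairPt (Jet.ex p n ψ) (Jet.ex p n ψ')) fun i hi y => by
    rw [dif_pos (Nat.succ_le_of_lt hi), dif_pos hi.le]
    exact pairPt_sub_dvd p (Jet.ex_succ_sub_dvd p hi ψ) (Jet.ex_succ_sub_dvd p hi ψ') y

theorem Jet.ex_pair {i n : ℕ} (hi : i ≤ n) (ψ : Jet p R B n →ₐ[R] R)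
    (ψ' : Jet p R B' n →ₐ[R] R) : Jet.ex p i ((Jet.pair p ψ ψ').comp (Jet.incl p hi)) =
      pairPt (Jet.ex p i (ψ.comp (Jet.incl p hi))) (Jet.ex p i (ψ'.comp (Jet.incl p hi))) := by
  rw [Jet.pair, Jet.ex_ofSeq, dif_pos hi]

/-- The first component of `Jet.pair ψ ψ'` is `ψ`. -/
theorem Jet.pair_comp_left {n : ℕ} (ψ : Jet p R B n →ₐ[R] R) (ψ' : Jet p R B' n →ₐ[R] R) :
    (Jet.pair p ψ ψ').comp (Jet.map p Algebra.TensorProduct.includeLeft n) = ψ := by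
  refine Jet.ext_of_ex p fun i hi => ?_
  rw [AlgHom.comp_assoc, Jet.map_comp_incl, ← AlgHom.comp_assoc, Jet.ex_comp_map, Jet.ex_pair]
  exact Algebra.TensorProduct.lift_comp_includeLeft _ _ fun _ _ => Commute.all _ _

/-- The second component of `Jet.pair ψ ψ'` is `ψ'`. -/
theorem Jet.pair_comp_right {n : ℕ} (ψ : Jet p R B n →ₐ[R] R) (ψ' : Jet p R B' n →ₐ[R] R) :
    (Jet.pair p ψ ψ').comp (Jet.map p Algebra.TensorProduct.includeRight n) = ψ' := by
  refine Jet.ext_of_ex p fun i hi => ?_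
  rw [AlgHom.comp_assoc, Jet.map_comp_incl, ← AlgHom.comp_assoc, Jet.ex_comp_map, Jet.ex_pair]
  exact Algebra.TensorProduct.lift_comp_includeRight _ _ fun _ _ => Commute.all _ _

/-- A point of `J^n(X × X')` is determined by its components. -/
theorem Jet.pair_unique {n : ℕ} (χ : Jet p R (B ⊗[R] B') n →ₐ[R] R) :
    Jet.pair p (χ.comp (Jet.map p Algebra.TensorProduct.includeLeft n))
      (χ.comp (Jet.map p Algebra.TensorProduct.includeRight n)) = χ := by
  refine Jet.ext_of_ex p fun i hi => ?_
  rw [Jet.ex_pair, AlgHom.comp_assoc, AlgHom.comp_assoc, Jet.map_comp_incl, Jet.map_comp_incl,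
    ← AlgHom.comp_assoc, ← AlgHom.comp_assoc, Jet.ex_comp_map, Jet.ex_comp_map]
  refine Algebra.TensorProduct.ext ?_ ?_
  · exact Algebra.TensorProduct.lift_comp_includeLeft _ _ fun _ _ => Commute.all _ _
  · exact Algebra.TensorProduct.lift_comp_includeRight _ _ fun _ _ => Commute.all _ _

end Points

/-! ### `δ`-maps -/

section DeltaMap

variable (p : ℕ) [Fact p.Prime] {R : Type w} [CommRing R] [IsDomain R] [FrobeniusRing p R]
  [IsAdicComplete (Ideal.span {(p : R)}) R]
  {B : Type u} [CommRing B] [Algebra R B] {C : Type v} [CommRing C] [Algebra R C]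

/-- The `p`-adic completion of the jet algebra: the ring of functions of `J^n(Spec B)`. -/
abbrev JetHat (R : Type w) [CommRing R] [IsDomain R] [FrobeniusRing p R]
    (B : Type u) [CommRing B] [Algebra R B] (n : ℕ) : Type (max u w) :=
  AdicCompletion (Ideal.span {(p : Jet p R B n)}) (Jet p R B n)

/-- The reduction modulo `p^k` of an `R`-algebra homomorphism from the jet algebra to `R`. -/
def Jet.evalMod {n : ℕ} (ψ : Jet p R B n →ₐ[R] R) (k : ℕ) :
    Jet p R B n ⧸ Ideal.span {(p : Jet p R B n)} ^ k →ₐ[R] R ⧸ Ideal.span {(p : R)} ^ k :=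
  Ideal.quotientMapₐ _ ψ <| by
    rw [← Ideal.map_le_iff_le_comap, Ideal.map_pow, Ideal.map_span, Set.image_singleton]
    exact (congrArg (fun x : R => Ideal.span {x} ^ k) (map_natCast ψ p)).le

theorem Jet.evalMod_compat {n : ℕ} (ψ : Jet p R B n →ₐ[R] R) {k l : ℕ} (hkl : k ≤ l) :
    (Ideal.Quotient.factorₐ R (Ideal.pow_le_pow_right hkl)).comp ((Jet.evalMod p ψ l).comp
      ((AdicCompletion.evalₐ (Ideal.span {(p : Jet p R B n)}) l).restrictScalars R)) =
    (Jet.evalMod p ψ k).comp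
      ((AdicCompletion.evalₐ (Ideal.span {(p : Jet p R B n)}) k).restrictScalars R) := by
  refine AlgHom.ext fun x => ?_
  obtain ⟨y, rfl⟩ := AdicCompletion.mk_surjective _ _ x
  have h := AdicCompletion.Ideal.mk_eq_mk (I := Ideal.span {(p : Jet p R B n)}) hkl y
  simp only [AlgHom.comp_apply, AlgHom.restrictScalars_apply, AdicCompletion.evalₐ_mk]
  rw [← h]
  rfl

/-- The value at an `R`-point of `J^n` of the functions on `J^n`: the extension of `ψ` to the
`p`-adic completion. -/
def JetHat.eval {n : ℕ} (ψ : Jet p R B n →ₐ[R] R) : JetHat p R B n →ₐ[R] R :=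
  IsAdicComplete.liftAlgHom (Ideal.span {(p : R)})
    (fun k => (Jet.evalMod p ψ k).comp
      ((AdicCompletion.evalₐ (Ideal.span {(p : Jet p R B n)}) k).restrictScalars R))
    fun hkl => Jet.evalMod_compat p ψ hkl

/-- On the jet algebra itself, `JetHat.eval ψ` is `ψ`. -/
theorem JetHat.eval_of {n : ℕ} (ψ : Jet p R B n →ₐ[R] R) (y : Jet p R B n) :
    JetHat.eval p ψ (algebraMap (Jet p R B n) (JetHat p R B n) y) = ψ y := by
  refine IsHausdorff.eq_iff_smodEq (I := Ideal.span {(p : R)}) |>.2 fun k => ?_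
  rw [smul_eq_mul, Ideal.mul_top, SModEq]
  exact IsAdicComplete.mk_liftAlgHom (Ideal.span {(p : R)}) _
    (fun hkl => Jet.evalMod_compat p ψ hkl) k _

variable (R B C) in
/-- The `δ`-maps of order `n` from `X = Spf B^` to `Y = Spf C^`, that is, the morphisms
`J^n(X) → Y` over `R`. -/
abbrev DeltaMap (n : ℕ) : Type (max u v w) := C →ₐ[R] JetHat p R B n

/-- The map `X(R) → Y(R)`, `P ↦ f(∇^n P)`, induced by a `δ`-map `f`. -/
def DeltaMap.onPoints {n : ℕ} (f : DeltaMap p R B C n) (P : B →ₐ[R] R) : C →ₐ[R] R :=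
  (JetHat.eval p (Jet.nabla p n P)).comp f

end DeltaMap

/-! ### `δ`-Lie algebras -/

section Lie

variable (p : ℕ) [Fact p.Prime] (R : Type w) [CommRing R] [IsDomain R] [FrobeniusRing p R]
  (A : Type u) [CommRing A] [HopfAlgebra R A]

/-- The unit section of `J^n(G)`, `G = Spec A`. -/
def Jet.one (n : ℕ) : Jet p R A n →ₐ[R] R := Jet.nabla p n (Bialgebra.counitAlgHom R A)

/-- The ideal of the kernel of `π : J^r(G) → J^{r-1}(G)`, that is, of the fibre of `π` over the
unit section. -/
def lieIdeal (r : ℕ) : Ideal (Jet p R A r) :=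
  (RingHom.ker (Jet.one p R A (r - 1))).map (Jet.incl p (Nat.sub_le r 1))

/-- For `r ≥ 1`, the algebra whose `p`-adic completion is the ring of functions of
`L_δ^r(G) = Ker(π : J^r(G) → J^{r-1}(G))`, where `G = Spec A`. -/
def Lie (r : ℕ) : Type (max u w) := Jet p R A r ⧸ lieIdeal p R A r

instance (r : ℕ) : CommRing (Lie p R A r) :=
  inferInstanceAs (CommRing (Jet p R A r ⧸ lieIdeal p R A r))

instance (r : ℕ) : Algebra R (Lie p R A r) :=
  inferInstanceAs (Algebra R (Jet p R A r ⧸ lieIdeal p R A r))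

/-- The `R`-points of `L_δ^r(G)`. -/
abbrev LiePt (r : ℕ) : Type (max u w) := Lie p R A r →ₐ[R] R

/-- The quotient map `O(J^r(G)) → O(L_δ^r(G))`. -/
def Lie.mk (r : ℕ) : Jet p R A r →ₐ[R] Lie p R A r := Ideal.Quotient.mkₐ R (lieIdeal p R A r)

variable {R A}

/-- The inclusion `L_δ^r(G) ⊆ J^r(G)` on points. -/
def LiePt.toJet {r : ℕ} (α : LiePt p R A r) : Jet p R A r →ₐ[R] R := α.comp (Lie.mk p R A r)

theorem LiePt.toJet_comp_incl {r : ℕ} (α : LiePt p R A r) :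
    (LiePt.toJet p α).comp (Jet.incl p (Nat.sub_le r 1)) = Jet.one p R A (r - 1) := by
  refine AlgHom.ext fun y => ?_
  have hy : y - algebraMap R _ (Jet.one p R A (r - 1) y) ∈
      RingHom.ker (Jet.one p R A (r - 1)) := by
    rw [RingHom.mem_ker, map_sub, AlgHom.commutes]; exact sub_self _
  have h1 : Lie.mk p R A r (Jet.incl p (Nat.sub_le r 1)
      (y - algebraMap R _ (Jet.one p R A (r - 1) y))) = 0 :=
    Ideal.Quotient.eq_zero_iff_mem.2 (Ideal.mem_map_of_mem _ hy)
  have h2 := congrArg α h1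
  rw [map_sub, map_sub, map_sub, map_zero, AlgHom.commutes, AlgHom.commutes, AlgHom.commutes,
    sub_eq_zero] at h2
  exact h2

/-- The point of `L_δ^r(G)` given by a point of `J^r(G)` that `π` maps to the unit. -/
def LiePt.ofJet {r : ℕ} (ψ : Jet p R A r →ₐ[R] R)
    (h : ψ.comp (Jet.incl p (Nat.sub_le r 1)) = Jet.one p R A (r - 1)) : LiePt p R A r :=
  Ideal.Quotient.liftₐ (lieIdeal p R A r) ψ fun a ha => by
    have : lieIdeal p R A r ≤ RingHom.ker ψ := by
      refine Ideal.map_le_iff_le_comap.2 fun y hy => ?_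
      rw [Ideal.mem_comap, RingHom.mem_ker, ← AlgHom.comp_apply, h]
      exact hy
    exact this ha

/-- The multiplication of the group `J^n(G)(R)`: the composition of
`J^n(G) × J^n(G) = J^n(G × G)` with the map `J^n(G × G) → J^n(G)` induced by the multiplication
of `G`. -/
def Jet.mul {n : ℕ} (ψ ψ' : Jet p R A n →ₐ[R] R) : Jet p R A n →ₐ[R] R :=
  (Jet.pair p ψ ψ').comp (Jet.map p (Bialgebra.comulAlgHom R A) n)

theorem Jet.mul_comp_incl {m n : ℕ} (h : m ≤ n) (ψ ψ' : Jet p R A n →ₐ[R] R) :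
    (Jet.mul p ψ ψ').comp (Jet.incl p h) =
      Jet.mul p (ψ.comp (Jet.incl p h)) (ψ'.comp (Jet.incl p h)) := by
  rw [Jet.mul, Jet.mul, AlgHom.comp_assoc, Jet.map_comp_incl, ← AlgHom.comp_assoc]
  congr 1
  refine Jet.ext_of_ex p fun i hi => ?_
  rw [Jet.ex_pair, AlgHom.comp_assoc, Jet.incl_comp_incl, Jet.ex_pair, AlgHom.comp_assoc,
    AlgHom.comp_assoc, Jet.incl_comp_incl]

theorem Jet.one_mul_one (n : ℕ) :
    Jet.mul p (Jet.one p R A n) (Jet.one p R A n) = Jet.one p R A n := by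
  refine Jet.ext_of_ex p fun i hi => ?_
  rw [Jet.mul_comp_incl, Jet.one, Jet.nabla_comp_incl, Jet.ex_nabla, Jet.mul, Jet.ex_comp_map]
  have h := Jet.ex_pair p (le_refl i) (Jet.nabla p i (Bialgebra.counitAlgHom R A))
    (Jet.nabla p i (Bialgebra.counitAlgHom R A))
  rw [Jet.nabla_comp_incl, Jet.ex_nabla, Jet.incl_self, AlgHom.comp_id] at h
  rw [h]
  refine AlgHom.ext fun x => ?_
  have e : ∀ y : A ⊗[R] A, pairPt (Bialgebra.counitAlgHom R A) (Bialgebra.counitAlgHom R A) y =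
      Bialgebra.counitAlgHom R A (TensorProduct.lid R A
        (LinearMap.rTensor A (Coalgebra.counit (R := R) (A := A)) y)) := by
    intro y
    induction y with
    | zero => simp only [map_zero]
    | tmul a b => simp [pairPt]
    | add y z hy hz => simp only [map_add, hy, hz]
  refine (e (Bialgebra.comulAlgHom R A x)).trans ?_
  rw [Bialgebra.comulAlgHom_apply, Coalgebra.rTensor_counit_comul, TensorProduct.lid_tmul, one_smul]

/-- The group law `+_{δ,r}` of `L_δ^r(G)`, which is the one of `J^r(G)`. -/
def LiePt.add {r : ℕ} (α β : LiePt p R A r) : LiePt p R A r :=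
  LiePt.ofJet p (Jet.mul p (LiePt.toJet p α) (LiePt.toJet p β)) <| by
    rw [Jet.mul_comp_incl, LiePt.toJet_comp_incl, LiePt.toJet_comp_incl, Jet.one_mul_one]

variable (R A) in
/-- The neutral element of `L_δ^r(G)`. -/
def LiePt.zero (r : ℕ) : LiePt p R A r :=
  LiePt.ofJet p (Jet.one p R A r) (Jet.nabla_comp_incl p (Nat.sub_le r 1) _)

/-- The map `ex^r : L_δ^r(G) → G` on `R`-points, with values in the group `G(R)`: the composition
`L_δ^r(G) ⊆ J^r(G) → J^{r-1}(G) → ⋯ → G` of the inclusion and the morphisms `π_φ`. -/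
def LiePt.ex {r : ℕ} (α : LiePt p R A r) : WithConv (A →ₐ[R] R) :=
  WithConv.toConv (Jet.ex p r (LiePt.toJet p α))

/-- Transport along an equality of orders. -/
def LiePt.cast {r s : ℕ} (h : r = s) (α : LiePt p R A r) : LiePt p R A s := h ▸ α

/-- Congruence modulo `p^m` of two points of `L_δ^r(G)`: the induced `R/p^m`-points coincide. -/
def LiePt.ModEq {r : ℕ} (m : ℕ) (α β : LiePt p R A r) : Prop :=
  (Ideal.Quotient.mkₐ R (Ideal.span {(p : R) ^ m})).comp α =
    (Ideal.Quotient.mkₐ R (Ideal.span {(p : R) ^ m})).comp β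

/-- The map `L_δ^r(G) → L_δ^r(G')` on `R`-points induced by a homomorphism `G → G'`, given by a
homomorphism `f : O(G') → O(G)` of Hopf algebras. -/
def LiePt.map {A' : Type v} [CommRing A'] [HopfAlgebra R A'] (f : A' →ₐc[R] A) {r : ℕ}
    (α : LiePt p R A r) : LiePt p R A' r :=
  LiePt.ofJet p ((LiePt.toJet p α).comp (Jet.map p (f : A' →ₐ[R] A) r)) <| by
    rw [AlgHom.comp_assoc, Jet.map_comp_incl, ← AlgHom.comp_assoc, LiePt.toJet_comp_incl,
      Jet.one, Jet.nabla_comp_map, Jet.one]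
    congr 1
    exact BialgHom.counitAlgHom_comp f

variable [IsAdicComplete (Ideal.span {(p : R)}) R]

variable (R A) in
/-- The `δ`-maps `L_δ^r(G) × L_δ^s(G) → L_δ^{r+s}(G)` of order `max {r, s}`. -/
abbrev LieDeltaMap (r s : ℕ) : Type (max u w) :=
  DeltaMap p R (Lie p R A r ⊗[R] Lie p R A s) (Lie p R A (r + s)) (max r s)

/-- The value of a `δ`-map `L_δ^r(G) × L_δ^s(G) → L_δ^{r+s}(G)` at a pair of `R`-points. -/
def LieDeltaMap.app {r s : ℕ} (F : LieDeltaMap p R A r s) (α : LiePt p R A r)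
    (β : LiePt p R A s) : LiePt p R A (r + s) :=
  DeltaMap.onPoints p F (pairPt α β)

/-- The `δ`-map `F : L_δ^r(G) × L_δ^s(G) → L_δ^{r+s}(G)` lifts the commutator of `G` through the
maps `ex` on `R`-points. -/
def IsDeltaBracket {r s : ℕ} (F : LieDeltaMap p R A r s) : Prop :=
  ∀ α β, LiePt.ex p (LieDeltaMap.app p F α β) =
    LiePt.ex p α * LiePt.ex p β * (LiePt.ex p α)⁻¹ * (LiePt.ex p β)⁻¹

end Lie

/-! ### The general linear group -/

section GeneralLinear

/-- The algebra `R[x, det(x)⁻¹]` of functions on `GL_n`, where `x` is an `n × n` matrix of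
indeterminates. -/
def GLRing (n : ℕ) (R : Type w) [CommRing R] : Type w :=
  Localization.Away (Matrix.mvPolynomialX (Fin n) (Fin n) R).det

variable (n : ℕ) (R : Type w) [CommRing R]

instance : CommRing (GLRing n R) :=
  inferInstanceAs (CommRing (Localization.Away (Matrix.mvPolynomialX (Fin n) (Fin n) R).det))

instance : Algebra (MvPolynomial (Fin n × Fin n) R) (GLRing n R) :=
  inferInstanceAs (Algebra (MvPolynomial (Fin n × Fin n) R)
    (Localization.Away (Matrix.mvPolynomialX (Fin n) (Fin n) R).det))

instance : Algebra R (GLRing n R) :=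
  inferInstanceAs (Algebra R (Localization.Away (Matrix.mvPolynomialX (Fin n) (Fin n) R).det))

instance : IsScalarTower R (MvPolynomial (Fin n × Fin n) R) (GLRing n R) :=
  inferInstanceAs (IsScalarTower R (MvPolynomial (Fin n × Fin n) R)
    (Localization.Away (Matrix.mvPolynomialX (Fin n) (Fin n) R).det))

instance : IsLocalization.Away (Matrix.mvPolynomialX (Fin n) (Fin n) R).det (GLRing n R) :=
  inferInstanceAs (IsLocalization.Away (Matrix.mvPolynomialX (Fin n) (Fin n) R).det
    (Localization.Away (Matrix.mvPolynomialX (Fin n) (Fin n) R).det))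

/-- The generic invertible matrix `x`. -/
def GLRing.gen : Matrix (Fin n) (Fin n) (GLRing n R) :=
  (Matrix.mvPolynomialX (Fin n) (Fin n) R).map (algebraMap _ (GLRing n R))

theorem GLRing.isUnit_det_gen : IsUnit (GLRing.gen n R).det := by
  have h := IsLocalization.Away.algebraMap_isUnit (S := GLRing n R)
    (Matrix.mvPolynomialX (Fin n) (Fin n) R).det
  rwa [RingHom.map_det] at h

variable {n R} {S : Type v} [CommRing S] [Algebra R S]

/-- The homomorphism `R[x, det(x)⁻¹] → S` that sends `x` to an invertible matrix `M`. -/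
def GLRing.lift (M : Matrix (Fin n) (Fin n) S) (hM : IsUnit M.det) : GLRing n R →ₐ[R] S :=
  IsLocalization.liftAlgHom (M := Submonoid.powers (Matrix.mvPolynomialX (Fin n) (Fin n) R).det)
    (f := MvPolynomial.aeval fun v : Fin n × Fin n => M v.1 v.2) <| by
    rintro ⟨_, k, rfl⟩
    have h : MvPolynomial.aeval (R := R) (fun v : Fin n × Fin n => M v.1 v.2)
        (Matrix.mvPolynomialX (Fin n) (Fin n) R).det = M.det := by
      rw [AlgHom.map_det, Matrix.mvPolynomialX_mapMatrix_aeval]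
    simpa only [map_pow, h] using hM.pow k

theorem GLRing.lift_gen_apply (M : Matrix (Fin n) (Fin n) S) (hM : IsUnit M.det) (i j : Fin n) :
    GLRing.lift (R := R) M hM (GLRing.gen n R i j) = M i j := by
  have h := IsLocalization.lift_eq (S := GLRing n R)
    (M := Submonoid.powers (Matrix.mvPolynomialX (Fin n) (Fin n) R).det)
    (g := (MvPolynomial.aeval (R := R) fun v : Fin n × Fin n => M v.1 v.2).toRingHom)
    (fun y => by
      obtain ⟨_, k, rfl⟩ := y
      have h : MvPolynomial.aeval (R := R) (fun v : Fin n × Fin n => M v.1 v.2)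
          (Matrix.mvPolynomialX (Fin n) (Fin n) R).det = M.det := by
        rw [AlgHom.map_det, Matrix.mvPolynomialX_mapMatrix_aeval]
      exact (map_pow (MvPolynomial.aeval (R := R) fun v : Fin n × Fin n => M v.1 v.2) _ k).symm ▸
        (h ▸ hM.pow k :)) (MvPolynomial.X (i, j))
  refine h.trans ?_
  exact MvPolynomial.aeval_X _ _

theorem GLRing.lift_gen (M : Matrix (Fin n) (Fin n) S) (hM : IsUnit M.det) :
    (GLRing.gen n R).map (GLRing.lift (R := R) M hM) = M :=
  Matrix.ext fun i j => GLRing.lift_gen_apply M hM i j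

theorem GLRing.algHom_ext {f g : GLRing n R →ₐ[R] S}
    (h : (GLRing.gen n R).map f = (GLRing.gen n R).map g) : f = g := by
  refine IsLocalization.algHom_ext
    (Submonoid.powers (Matrix.mvPolynomialX (Fin n) (Fin n) R).det) ?_
  refine MvPolynomial.algHom_ext fun v => ?_
  exact congrFun (congrFun h v.1) v.2

theorem GLRing.isUnit_det_map (f : GLRing n R →ₐ[R] S) : IsUnit ((GLRing.gen n R).map f).det := by
  have h := (GLRing.isUnit_det_gen n R).map f
  rwa [AlgHom.map_det] at h

variable (n R)

/-- The homomorphism of the multiplication of matrices: `x ↦ u v`. -/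
def GLRing.comul : GLRing n R →ₐ[R] GLRing n R ⊗[R] GLRing n R :=
  GLRing.lift
    ((GLRing.gen n R).map (Algebra.TensorProduct.includeLeft (R := R) (S := R) (B := GLRing n R)) *
      (GLRing.gen n R).map (Algebra.TensorProduct.includeRight (R := R) (A := GLRing n R))) <| by
    rw [Matrix.det_mul]
    exact (GLRing.isUnit_det_map _).mul (GLRing.isUnit_det_map _)

/-- The homomorphism of the unit matrix: `x ↦ 1`. -/
def GLRing.counit : GLRing n R →ₐ[R] R := GLRing.lift 1 (by rw [Matrix.det_one]; exact isUnit_one)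

/-- The homomorphism of the inversion of matrices: `x ↦ x⁻¹`. -/
def GLRing.antipode : GLRing n R →ₐ[R] GLRing n R :=
  GLRing.lift (GLRing.gen n R)⁻¹ <| by
    rw [Matrix.det_nonsing_inv]
    exact (GLRing.isUnit_det_gen n R).ringInverse

theorem GLRing.map_comul (f : GLRing n R ⊗[R] GLRing n R →ₐ[R] S) :
    (GLRing.gen n R).map (f.comp (GLRing.comul n R)) =
      (GLRing.gen n R).map (f.comp Algebra.TensorProduct.includeLeft) *
        (GLRing.gen n R).map (f.comp Algebra.TensorProduct.includeRight) := by
  have h := congrArg (fun M => M.map f) (GLRing.lift_gen (R := R) (n := n)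
    ((GLRing.gen n R).map (Algebra.TensorProduct.includeLeft (R := R) (S := R) (B := GLRing n R)) *
      (GLRing.gen n R).map (Algebra.TensorProduct.includeRight (R := R) (A := GLRing n R)))
    (by rw [Matrix.det_mul]
        exact (GLRing.isUnit_det_map _).mul (GLRing.isUnit_det_map _)))
  simp only [Matrix.map_mul, Matrix.map_map] at h
  exact h

theorem GLRing.map_counit (f : R →ₐ[R] S) :
    (GLRing.gen n R).map (f.comp (GLRing.counit n R)) = 1 := by
  have h := congrArg (fun M => M.map f) (GLRing.lift_gen (R := R) (n := n) (1 : Matrix _ _ R)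
    (by rw [Matrix.det_one]; exact isUnit_one))
  simp only [Matrix.map_map, Matrix.map_one f (map_zero f) (map_one f)] at h
  exact h

theorem GLRing.map_comul_lift {f g : GLRing n R →ₐ[R] S} :
    (GLRing.gen n R).map ((Algebra.TensorProduct.lift f g fun _ _ => Commute.all _ _).comp
      (GLRing.comul n R)) = (GLRing.gen n R).map f * (GLRing.gen n R).map g := by
  rw [GLRing.map_comul, Algebra.TensorProduct.lift_comp_includeLeft]
  congr 2
  exact congrArg DFunLike.coe (Algebra.TensorProduct.lift_comp_includeRight f g
    fun _ _ => Commute.all _ _)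

instance : Bialgebra R (GLRing n R) :=
  Bialgebra.ofAlgHom (GLRing.comul n R) (GLRing.counit n R)
    (by
      refine GLRing.algHom_ext ?_
      rw [← AlgHom.comp_assoc, GLRing.map_comul, GLRing.map_comul]
      have h1 : ((Algebra.TensorProduct.assoc R R R (GLRing n R) (GLRing n R)
          (GLRing n R)).toAlgHom.comp (Algebra.TensorProduct.map (GLRing.comul n R)
            (.id R (GLRing n R)))).comp Algebra.TensorProduct.includeLeft =
          ((Algebra.TensorProduct.assoc R R R (GLRing n R) (GLRing n R)
            (GLRing n R)).toAlgHom.comp Algebra.TensorProduct.includeLeft).comp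
              (GLRing.comul n R) := by
        ext x
        simp
      have h2 : (Algebra.TensorProduct.map (.id R (GLRing n R)) (GLRing.comul n R)).comp
          Algebra.TensorProduct.includeRight = (Algebra.TensorProduct.includeRight (R := R)
            (A := GLRing n R)).comp (GLRing.comul n R) := by
        ext x
        simp
      rw [h1, h2, GLRing.map_comul, GLRing.map_comul, mul_assoc]
      congr 1
      · refine Matrix.ext fun i j => ?_
        simp
        rfl
      · congr 1
        · refine Matrix.ext fun i j => ?_
          simp
          rfl)
    (by
      refine GLRing.algHom_ext ?_
      rw [GLRing.map_comul]
      have h1 : (Algebra.TensorProduct.map (GLRing.counit n R) (.id R (GLRing n R))).comp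
          Algebra.TensorProduct.includeLeft = (Algebra.TensorProduct.includeLeft (R := R) (S := R)
            (A := R) (B := GLRing n R)).comp (GLRing.counit n R) := by
        ext x
        simp
      rw [h1, GLRing.map_counit, one_mul]
      refine Matrix.ext fun i j => ?_
      simp)
    (by
      refine GLRing.algHom_ext ?_
      rw [GLRing.map_comul]
      have h1 : (Algebra.TensorProduct.map (.id R (GLRing n R)) (GLRing.counit n R)).comp
          Algebra.TensorProduct.includeRight = (Algebra.TensorProduct.includeRight (R := R)
            (A := GLRing n R) (B := R)).comp (GLRing.counit n R) := by
        ext x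
        simp
      rw [h1, GLRing.map_counit, mul_one]
      refine Matrix.ext fun i j => ?_
      simp)

instance : HopfAlgebra R (GLRing n R) :=
  HopfAlgebra.ofAlgHom (GLRing.antipode n R)
    (GLRing.algHom_ext <| (GLRing.map_comul_lift n R).trans <| Eq.trans (by
      rw [GLRing.antipode, GLRing.lift_gen]
      exact Matrix.nonsing_inv_mul _ (GLRing.isUnit_det_gen n R)) (GLRing.map_counit n R _).symm)
    (GLRing.algHom_ext <| (GLRing.map_comul_lift n R).trans <| Eq.trans (by
      rw [GLRing.antipode, GLRing.lift_gen]
      exact Matrix.mul_nonsing_inv _ (GLRing.isUnit_det_gen n R)) (GLRing.map_counit n R _).symm)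

/-- The affine group scheme `Spec A` is linear: it is isomorphic to a closed subgroup scheme of some
`GL_n`. -/
def IsLinear (A : Type v) [CommRing A] [HopfAlgebra R A] : Prop :=
  ∃ (n : ℕ) (f : GLRing n R →ₐc[R] A), Function.Surjective f

end GeneralLinear

section Coordinates

variable (p : ℕ) [Fact p.Prime] {R : Type w} [CommRing R] [IsDomain R] [FrobeniusRing p R]
  {n : ℕ}

/-- The identification of the points of `L_δ^r(GL_n)` with `n × n` matrices: the matrix of the
values of the coordinates `δ^r x_ij`. -/
def LiePt.matrix {r : ℕ} (α : LiePt p R (GLRing n R) r) : Matrix (Fin n) (Fin n) R :=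
  Matrix.of fun i j =>
    α (Lie.mk p R (GLRing n R) r (Jet.var p r (GLRing.gen n R i j) r (le_refl r)))

end Coordinates

end

end DeltaLie

open DeltaLie

namespace DeltaLie

noncomputable section

/-! ### Calculus of `p`-derivations -/

section Calculus

variable (p : ℕ) [Fact p.Prime] {R : Type w} [CommRing R] [IsDomain R] [FrobeniusRing p R]

/-! On `L_δ^r(G)` the coordinates of order below `r` are those of the unit, so `φ^r b = φ^r(ε b) +
p^r ξ_b` there, where `ε` is the counit and `ξ_b` is `Lie.xi`. Hence `ex^r(α) = ε + p^r
φ^{-r}(α(ξ))` (`LiePt.ex_sub`), and for `r ≥ 1` the map `ex^r` identifies the `R`-points of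
`L_δ^r(G)` with the congruence subgroup `Ker(G(R) → G(R/p^r))` (`LiePt.ex_injective`,
`LiePt.exists_ex_eq`). Congruence mod `p^m` upstairs is congruence mod `p^(r+m)` in `G(R)`
(`LiePt.modEq_iff`). The commutator morphism is trivial when one argument is the unit
(`commHom_eq`), so commutators of levels `r` and `s` have level `r + s`.

Existence needs a morphism and not only a map on points. For `r ≥ 1` the uncompleted algebra `Lie p
R A r` is universal for maps satisfying the identities of `IsTwisted` (`Lie.isTwisted_xi`,
`Lie.algHom_ext`, `Lie.lift`). The commutator formula divided by `p^(r+s)`, with `φ^s ξ` for the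
first argument and `φ^r ξ` for the second, is again twisted (`IsTwisted.bracket`). The powers of `φ`
make both factors `φ^(r+s)`-semilinear; they account for the order `max {r, s}`.

Uniqueness: since `ex` is injective, two brackets agree on points, and a function on the jet space
of `L_δ^r × L_δ^s` is determined by its values at the points `∇P` (`JetHat.ext_of_eval_nabla`). The
reasons are that the residues of `a, δa, …, δ^n a` can be prescribed
(`exists_dvd_iterate_delta_sub`), that the residue field is infinite, and that smoothness gives
finitely many `ξ(t_i)` which generate modulo `p` and take arbitrary values on points.

For the congruences, embed `G` in a `GL_n` and write `ex^r(α) = 1 + p^r a`, `ex^s(β) = 1 + p^s b`.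
The matrix `c` of the bracket satisfies `c (1 + p^s b)(1 + p^r a) = ab - ba`
(`IsDeltaBracket.linearPart_mul`). Modulo `p` the bracket is the matrix commutator and the group law
is addition, so the Lie identities are those of a matrix ring. On `GL_n` the coordinate matrix is
`φ^r(a)`, and `φ^k` is the `p^k`-th power modulo `p`, which yields the exponents in the explicit
formula. -/

theorem ddelta_mul {σ : Type u} (f g : DPoly R σ) :
    ddelta p (f * g) = f ^ p * ddelta p g + ddelta p f * dfrob p g := by
  apply mul_left_cancel₀ (dpoly_p_ne_zero (R := R) (σ := σ) p)
  have h := dfrob_eq p (f * g)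
  rw [map_mul] at h
  have hf := dfrob_eq p f
  have hg := dfrob_eq p g
  rw [mul_pow] at h
  linear_combination (-1 : DPoly R σ) * h + hf * dfrob p g + f ^ p * hg

/-- The binomial identity is applied inside the subring, so the correction `c` has no higher order
than `f` and `g`. The error term `f g c` then vanishes on the jet space as soon as `g` does. -/
theorem exists_ddelta_add {σ : Type u} {n : ℕ} {f g : DPoly R σ} (hf : f ∈ upTo R σ n)
    (hg : g ∈ upTo R σ n) :
    ∃ c ∈ upTo R σ n, ddelta p (f + g) = ddelta p f + ddelta p g - f * g * c := by
  obtain ⟨c, hc⟩ := exists_add_pow_prime_eq (Fact.out : p.Prime) (⟨f, hf⟩ : upTo R σ n) ⟨g, hg⟩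
  have hc' := congrArg Subtype.val hc
  push_cast at hc'
  refine ⟨c, c.2, mul_left_cancel₀ (dpoly_p_ne_zero (R := R) (σ := σ) p) ?_⟩
  have h := dfrob_eq p (f + g)
  rw [map_add, dfrob_eq, dfrob_eq, hc'] at h
  linear_combination -h

/-- This measures the loss of precision under `δ`: since `φ` fixes `p`, a single factor `p` is lost.
-/
theorem ddelta_p_pow_mul {σ : Type u} (m : ℕ) (z : DPoly R σ) :
    ddelta p ((p : DPoly R σ) ^ (m + 1) * z) =
      (p : DPoly R σ) ^ m * (dfrob p z - (p : DPoly R σ) ^ ((m + 1) * p - (m + 1)) * z ^ p) := by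
  apply mul_left_cancel₀ (dpoly_p_ne_zero (R := R) (σ := σ) p)
  have h := dfrob_eq p ((p : DPoly R σ) ^ (m + 1) * z)
  rw [map_mul, map_pow, map_natCast, mul_pow, ← pow_mul] at h
  have e : (p : DPoly R σ) ^ ((m + 1) * p) = p * p ^ m * p ^ ((m + 1) * p - (m + 1)) := by
    rw [← pow_succ', ← pow_add]
    congr 1
    have : m + 1 ≤ (m + 1) * p := Nat.le_mul_of_pos_right _ (Fact.out : p.Prime).pos
    omega
  rw [e] at h
  linear_combination -h

theorem ddelta_zero {σ : Type u} : ddelta p (0 : DPoly R σ) = 0 := by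
  have h := dfrob_eq p (0 : DPoly R σ)
  rw [map_zero, zero_pow (Fact.out : p.Prime).ne_zero, zero_add, eq_comm, mul_eq_zero] at h
  exact h.resolve_left (dpoly_p_ne_zero p)

/-- The map `δ : R[x, …, x^{(n)}] → R[x, …, x^{(n+1)}]`. -/
def upTo.delta {σ : Type u} (n : ℕ) (g : upTo R σ n) : upTo R σ (n + 1) :=
  ⟨ddelta p (g : DPoly R σ), ddelta_mem_upTo p g.2⟩

theorem upTo.coe_delta {σ : Type u} (n : ℕ) (g : upTo R σ n) :
    (upTo.delta p n g : DPoly R σ) = ddelta p (g : DPoly R σ) := rfl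

theorem upTo.coe_natCast {σ : Type u} (n m : ℕ) : ((m : upTo R σ n) : DPoly R σ) = m := rfl

variable {B : Type u} [CommRing B] [Algebra R B]

/-- The inclusion `R[x, …, x^{(n)}] → R[x, …, x^{(n+1)}]`. -/
def upTo.succ {σ : Type u} (n : ℕ) : upTo R σ n →ₐ[R] upTo R σ (n + 1) :=
  Subalgebra.inclusion (upTo_mono (Nat.le_add_right n 1))

theorem upTo.coe_succ {σ : Type u} (n : ℕ) (g : upTo R σ n) :
    (upTo.succ n g : DPoly R σ) = g := by
  rw [upTo.succ, Subalgebra.coe_inclusion]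

theorem Jet.mk_eq_zero_iff {n : ℕ} {b : upTo R B n} :
    Jet.mk p n b = 0 ↔ b ∈ jetIdeal p R B n := Ideal.Quotient.eq_zero_iff_mem

theorem Jet.mk_succ {n : ℕ} (b : upTo R B n)  :
    Jet.mk p (n + 1) (upTo.succ n b) = Jet.incl p (Nat.le_add_right n 1) (Jet.mk p n b) := by
  rw [Jet.incl, Jet.lift_mk, AlgHom.comp_apply, upTo.succ]

theorem Jet.mk_succ_eq_zero {n : ℕ} {b : upTo R B n} (hb : b ∈ jetIdeal p R B n) :
    Jet.mk p (n + 1) (upTo.succ n b) = 0 := by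
  rw [Jet.mk_succ, (Jet.mk_eq_zero_iff p).2 hb, map_zero]

theorem Jet.mk_frob_eq_zero {n : ℕ} {b : upTo R B n}
    (hb : b ∈ jetIdeal p R B n) : 
   Jet.mk p (n + 1) (upTo.frob p n b) = 0 := by
  rw [← Jet.frob_mk, (Jet.mk_eq_zero_iff p).2 hb, map_zero]

theorem Jet.mk_delta_add_eq_zero {n : ℕ} {a b : upTo R B n} (hb : b ∈ jetIdeal p R B n)
    (h1 : Jet.mk p (n + 1) (upTo.delta p n a) = 0)
    (h2 : Jet.mk p (n + 1) (upTo.delta p n b) = 0) :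
    Jet.mk p (n + 1) (upTo.delta p n (a + b)) = 0 := by
  obtain ⟨c, hc, e⟩ := exists_ddelta_add p a.2 b.2
  have e' : upTo.delta p n (a + b) = upTo.delta p n a + upTo.delta p n b -
      upTo.succ n b *
      upTo.succ n (a * ⟨c, hc⟩) := by
    apply Subtype.ext
    refine e.trans ?_
    simp only [AddSubgroupClass.coe_sub, Subalgebra.coe_add, Subalgebra.coe_mul,
      upTo.coe_succ, upTo.coe_delta]
    ring
  rw [e', map_sub, map_add, map_mul, h1, h2, Jet.mk_succ_eq_zero p hb, zero_mul, add_zero,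
    sub_zero]

theorem Jet.mk_delta_mul_eq_zero {n : ℕ} (a : upTo R B n) {b : upTo R B n}
    (hb : b ∈ jetIdeal p R B n) (h : Jet.mk p (n + 1) (upTo.delta p n b) = 0) :
    Jet.mk p (n + 1) (upTo.delta p n (a * b)) = 0 := by
  have e : upTo.delta p n (a * b) =
      upTo.delta p n b * upTo.succ n a ^ p +
      upTo.delta p n a * upTo.frob p n b := by
    apply Subtype.ext
    refine (ddelta_mul p (a : DPoly R B) b).trans ?_
    simp only [Subalgebra.coe_add, Subalgebra.coe_mul, Subalgebra.coe_pow,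
      upTo.coe_succ, upTo.coe_delta, upTo.coe_frob]
    ring
  rw [e, map_add, map_mul, map_mul, h, Jet.mk_frob_eq_zero p hb, mul_zero, zero_mul, add_zero]

/-- `δ` is not additive, but in the rules for sums and products every error term contains `b` or `φ
b` with `b` in the ideal, and these vanish on `J^{n+1}`. So `δ` descends to a map from functions on
`J^n` to functions on `J^{n+1}`. -/
theorem Jet.mk_delta_eq_zero {n : ℕ} {a : upTo R B n} (ha : a ∈ jetIdeal p R B n) :
    Jet.mk p (n + 1) (upTo.delta p n a) = 0 := by
  refine Submodule.span_induction (p := fun a _ => Jet.mk p (n + 1) (upTo.delta p n a) = 0)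
    ?_ ?_ ?_ ?_ ha
  · rintro g ⟨f, hf, i, hi, hg⟩
    exact Jet.mk_eq_zero p (Nat.succ_le_succ hi) hf _ (by
      rw [Function.iterate_succ_apply', ← hg, upTo.coe_delta])
  · have : upTo.delta p n (0 : upTo R B n) = 0 := Subtype.ext (ddelta_zero p)
    rw [this, map_zero]
  · intro a b _ hb h1 h2
    exact Jet.mk_delta_add_eq_zero p hb h1 h2
  · intro a b hb h
    exact Jet.mk_delta_mul_eq_zero p a hb h

/-- If `u ≡ v` modulo `p ^ (m + 1)` on `J^n`, then `δ u ≡ δ v` modulo `p ^ m` on `J^{n+1}`. -/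
theorem Jet.dvd_mk_delta_sub {n m : ℕ} {u v : upTo R B n}
    (h : (p : Jet p R B n) ^ (m + 1) ∣ Jet.mk p n u - Jet.mk p n v) :
    (p : Jet p R B (n + 1)) ^ m ∣
      Jet.mk p (n + 1) (upTo.delta p n u) - Jet.mk p (n + 1) (upTo.delta p n v) := by
  obtain ⟨z', hz⟩ := h
  obtain ⟨z, rfl⟩ := Jet.mk_surjective p n z'
  -- The congruence holds only modulo relations; `w` collects them, and both `w` and `δ w` vanish on
  -- `J^{n+1}`.
  set w : upTo R B n := u - (v + (p : upTo R B n) ^ (m + 1) * z) with hw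
  have hwI : w ∈ jetIdeal p R B n := by
    refine Ideal.Quotient.eq_zero_iff_mem.1 ?_
    change Jet.mk p n w = 0
    rw [hw, map_sub, map_add, map_mul, map_pow, map_natCast, ← hz]; ring
  have hw0 := Jet.mk_succ_eq_zero p hwI
  have hu : u = (v + (p : upTo R B n) ^ (m + 1) * z) + w := by rw [hw]; ring
  obtain ⟨c, hc, e⟩ := exists_ddelta_add p
    (v + (p : upTo R B n) ^ (m + 1) * z : upTo R B n).2 w.2
  obtain ⟨c', hc', e'⟩ := exists_ddelta_add p v.2 ((p : upTo R B n) ^ (m + 1) * z).2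
  have e3 := ddelta_p_pow_mul p m (z : DPoly R B)
  let ι := upTo.succ (R := R) (σ := B) n
  have key : upTo.delta p n u = upTo.delta p n v + upTo.delta p n w -
      ι w * ι ((v + (p : upTo R B n) ^ (m + 1) * z) * ⟨c, hc⟩) +
      (p : upTo R B (n + 1)) ^ m * (upTo.frob p n z -
        (p : upTo R B (n + 1)) ^ ((m + 1) * p - (m + 1)) * ι z ^ p -
        p * (ι v * ι z * ι ⟨c', hc'⟩)) := by
    apply Subtype.ext
    have e0 : ((upTo.delta p n u : upTo R B (n + 1)) : DPoly R B) =
        ddelta p (((v + (p : upTo R B n) ^ (m + 1) * z : upTo R B n) : DPoly R B) +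
          (w : DPoly R B)) := by
      rw [hu]; rfl
    rw [e0, e]
    have e1 : ((v + (p : upTo R B n) ^ (m + 1) * z : upTo R B n) : DPoly R B) =
      v + ((p : upTo R B n) ^ (m + 1) * z : upTo R B n) := rfl
    rw [e1, e']
    have e2 : (((p : upTo R B n) ^ (m + 1) * z : upTo R B n) : DPoly R B) =
      (p : DPoly R B) ^ (m + 1) * z := by push_cast; rfl
    rw [e2, e3]
    simp only [AddSubgroupClass.coe_sub, Subalgebra.coe_add, Subalgebra.coe_mul,
      upTo.coe_succ, upTo.coe_delta, upTo.coe_frob, Subalgebra.coe_pow, ι,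
      upTo.coe_natCast]
    ring
  refine ⟨Jet.mk p (n + 1) (upTo.frob p n z -
        (p : upTo R B (n + 1)) ^ ((m + 1) * p - (m + 1)) * ι z ^ p -
        p * (ι v * ι z * ι ⟨c', hc'⟩)), ?_⟩
  rw [key, map_add, map_sub, map_add, map_mul (Jet.mk p (n + 1)) (ι w),
    Jet.mk_delta_eq_zero p hwI, hw0, map_mul (Jet.mk p (n + 1)) (_ ^ m), map_pow, map_natCast]
  ring

/-- The element `δ^i f`, for `f` a polynomial in the variables `x_b`, of `R[x, …, x^{(n)}]`. -/
def upTo.iterDelta {σ : Type u} {n i : ℕ} (hi : i ≤ n) (f : MvPolynomial σ R) : upTo R σ n :=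
  ⟨(ddelta p)^[i] (const f), iterate_ddelta_mem_upTo p hi f⟩

/-- Each application of `δ` costs one power of `p`, so `m` of the initial `m + i` remain after `i`
steps. -/
theorem Jet.dvd_mk_iterDelta_sub {i m : ℕ} {f g : MvPolynomial B R} {c : B}
    (h : MvPolynomial.aeval (id : B → B) f =
      MvPolynomial.aeval (id : B → B) g + (p : B) ^ (m + i) * c) :
    (p : Jet p R B i) ^ m ∣
      Jet.mk p i (upTo.iterDelta p le_rfl f) - Jet.mk p i (upTo.iterDelta p le_rfl g) := by
  have key : ∀ j ≤ i, (p : Jet p R B j) ^ (m + i - j) ∣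
      Jet.mk p j (upTo.iterDelta p le_rfl f) - Jet.mk p j (upTo.iterDelta p le_rfl g) := by
    intro j
    induction j with
    | zero =>
      intro _
      have h0 := congrArg (Jet.ofRing p (R := R)) h
      rw [map_add, map_mul, map_pow, map_natCast, Jet.ofRing_aeval, Jet.ofRing_aeval] at h0
      refine ⟨Jet.ofRing p c, ?_⟩
      refine (sub_eq_of_eq_add' h0 :)
    | succ j ih =>
      intro hj
      have h1 := ih (by omega)
      rw [show m + i - j = m + i - (j + 1) + 1 by omega] at h1
      have h2 := Jet.dvd_mk_delta_sub p h1
      have e : ∀ f : MvPolynomial B R, upTo.iterDelta p (le_refl (j + 1)) f =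
          upTo.delta p j (upTo.iterDelta p le_rfl f) := fun f =>
        Subtype.ext (Function.iterate_succ_apply' _ _ _)
      rwa [e, e]
  have := key i le_rfl
  rwa [Nat.add_sub_cancel] at this

/-- Since every element of `B` is a generator, this allows a polynomial to be replaced by the single
variable indexed by its value. -/
theorem Jet.mk_iterDelta_eq {n : ℕ} {f g : MvPolynomial B R}
    (h : MvPolynomial.aeval (id : B → B) f = MvPolynomial.aeval (id : B → B) g) :
    Jet.mk p n (upTo.iterDelta p le_rfl f) = Jet.mk p n (upTo.iterDelta p le_rfl g) := by
  induction n with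
  | zero =>
    have h0 := congrArg (Jet.ofRing p (R := R)) h
    rwa [Jet.ofRing_aeval, Jet.ofRing_aeval] at h0
  | succ n ih =>
    have hmem : upTo.iterDelta p le_rfl f - upTo.iterDelta p le_rfl g ∈ jetIdeal p R B n := by
      refine Ideal.Quotient.eq_zero_iff_mem.1 ?_
      change Jet.mk p n _ = 0
      rw [map_sub, ih, sub_self]
    have h0 := Jet.mk_delta_eq_zero p hmem
    set w := upTo.iterDelta p le_rfl f - upTo.iterDelta p le_rfl g with hw
    have hw0 := Jet.mk_succ_eq_zero p hmem
    obtain ⟨c, hc, e⟩ := exists_ddelta_add p (upTo.iterDelta p (le_refl n) g).2 w.2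
    have key : upTo.iterDelta p (le_refl (n + 1)) f = upTo.iterDelta p (le_refl (n + 1)) g +
        upTo.delta p n w - upTo.succ n w *
          upTo.succ n (upTo.iterDelta p le_rfl g * ⟨c, hc⟩) := by
      apply Subtype.ext
      have e1 : (upTo.iterDelta p (le_refl n) g : DPoly R B) + w = (ddelta p)^[n] (const f) := by
        rw [hw]; simp [upTo.iterDelta]
      rw [e1] at e
      simp only [AddSubgroupClass.coe_sub, Subalgebra.coe_add, Subalgebra.coe_mul,
        upTo.coe_succ, upTo.coe_delta, upTo.iterDelta, Function.iterate_succ_apply'] at e ⊢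
      rw [e]; ring
    rw [key, map_sub, map_add, h0, map_mul, hw0]; ring

end Calculus

/-! ### Perturbation of the last coordinate -/

section Perturb

variable (p : ℕ) [Fact p.Prime] {R : Type w} [CommRing R] [IsDomain R] [FrobeniusRing p R]
  {σ : Type u}

/-- Evaluation of differential polynomials at `x^{(i)} = δ^i e`. -/
def evalDelta (e : σ → R) : DPoly R σ →ₐ[R] R :=
  MvPolynomial.aeval fun v => (delta p)^[v.2] (e v.1)

theorem evalDelta_dfrob (e : σ → R) (f : DPoly R σ) :
    evalDelta p e (dfrob p f) = frob p (evalDelta p e f) := by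
  induction f using MvPolynomial.induction_on with
  | C r => simp [evalDelta]
  | add f g hf hg => simp only [map_add, hf, hg]
  | mul_X f v hf =>
    rw [map_mul, map_mul, hf, map_mul, map_mul, dfrob_X]
    congr 1
    simp only [evalDelta, map_add, map_mul, map_pow, map_natCast, MvPolynomial.aeval_X,
      Function.iterate_succ_apply', frob_eq]

theorem evalDelta_iterate_dfrob (e : σ → R) (i : ℕ) (f : DPoly R σ) :
    evalDelta p e ((dfrob p)^[i] f) = frobIter p i (evalDelta p e f) := by
  induction i with
  | zero => rfl
  | succ i ih => rw [Function.iterate_succ_apply', evalDelta_dfrob, ih]; rfl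

theorem evalDelta_ddelta (e : σ → R) (f : DPoly R σ) :
    evalDelta p e (ddelta p f) = delta p (evalDelta p e f) := by
  have h := evalDelta_dfrob p e f
  rw [dfrob_eq, frob_eq, map_add, map_mul, map_pow, map_natCast] at h
  exact mul_left_cancel₀ (p_ne_zero p R) (add_left_cancel h)

theorem evalDelta_iterate_ddelta (e : σ → R) (i : ℕ) (f : DPoly R σ) :
    evalDelta p e ((ddelta p)^[i] f) = (delta p)^[i] (evalDelta p e f) := by
  induction i with
  | zero => rfl
  | succ i ih => rw [Function.iterate_succ_apply', evalDelta_ddelta, ih, Function.iterate_succ_apply']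

theorem evalDelta_const (e : σ → R) (f : MvPolynomial σ R) :
    evalDelta p e (const f) = MvPolynomial.aeval e f := by
  rw [evalDelta, const, MvPolynomial.aeval_rename]
  rfl

theorem delta_zero : delta p (0 : R) = 0 := by
  have h := frob_eq p (0 : R)
  rw [map_zero, zero_pow (Fact.out : p.Prime).ne_zero, zero_add, eq_comm, mul_eq_zero] at h
  exact h.resolve_left (p_ne_zero p R)

theorem delta_one : delta p (1 : R) = 0 := by
  have h := frob_eq p (1 : R)
  rw [map_one, one_pow, left_eq_add, mul_eq_zero] at h
  exact h.resolve_left (p_ne_zero p R)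

theorem iterate_delta_zero (i : ℕ) : (delta p)^[i] (0 : R) = 0 :=
  Function.iterate_fixed (delta_zero p) i

/-- `φ^n f` is `p^n δ^n f` plus an integral polynomial in `f, …, δ^{n-1} f`. The induction uses
`φ^{n+1} f = (φ^n f)^p + p φ^n(δ f)`. -/
theorem map_iterate_dfrob_sub {S : Type v} [CommRing S] (ψ ψ' : DPoly R σ →+* S) (n : ℕ)
    (f : DPoly R σ) (h : ∀ k < n, ψ ((ddelta p)^[k] f) = ψ' ((ddelta p)^[k] f)) :
    ψ ((dfrob p)^[n] f) - ψ' ((dfrob p)^[n] f) =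
      (p : S) ^ n * (ψ ((ddelta p)^[n] f) - ψ' ((ddelta p)^[n] f)) := by
  induction n generalizing f with
  | zero => simp
  | succ n ih =>
    have h1 := ih f fun k hk => h k (by omega)
    rw [h n (Nat.lt_succ_self n), sub_self, mul_zero, sub_eq_zero] at h1
    have h2 := ih (ddelta p f) fun k hk => by
      rw [← Function.iterate_succ_apply]; exact h (k + 1) (by omega)
    rw [← Function.iterate_succ_apply] at h2
    rw [Function.iterate_succ_apply, dfrob_eq, iterate_map_add, iterate_map_mul, iterate_map_pow,
      iterate_dfrob_natCast, map_add, map_add, map_mul, map_mul, map_pow, map_pow, map_natCast,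
      map_natCast, h1, pow_succ', mul_assoc, ← h2]
    ring

/-- Evaluation at `x^{(i)} = δ^i e` for `i ≠ n`, and at `δ^n e` plus a variable for `i = n`. -/
def perturb (e : σ → R) (n : ℕ) : DPoly R σ →ₐ[R] MvPolynomial σ R :=
  MvPolynomial.aeval fun v => MvPolynomial.C ((delta p)^[v.2] (e v.1)) +
    if v.2 = n then MvPolynomial.X v.1 else 0

/-- The constant polynomial with the value of `evalDelta`. -/
def evalDeltaC (e : σ → R) : DPoly R σ →ₐ[R] MvPolynomial σ R :=
  (Algebra.ofId R (MvPolynomial σ R)).comp (evalDelta p e)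

theorem evalDeltaC_apply (e : σ → R) (f : DPoly R σ) :
    evalDeltaC p e f = MvPolynomial.C (evalDelta p e f) := rfl

theorem perturb_eq_of_mem_upTo (e : σ → R) {k n : ℕ} (hk : k < n) {f : DPoly R σ}
    (hf : f ∈ upTo R σ k) : perturb p e n f = evalDeltaC p e f := by
  refine upTo_induction (P := fun f => perturb p e n f = evalDeltaC p e f) ?_ ?_ ?_ ?_ hf
  · intro r; simp [perturb, evalDeltaC, evalDelta, MvPolynomial.algebraMap_eq]
  · intro a i hi
    rw [evalDeltaC_apply]
    have : i ≠ n := by omega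
    simp [perturb, evalDelta, this]
  · intro f g hf hg; rw [map_add, map_add, hf, hg]
  · intro f g hf hg; rw [map_mul, map_mul, hf, hg]

/-- The change of `δ^n f` when the coordinates `x^{(n)}` are changed. -/
def perturbDelta (e : σ → R) (n : ℕ) (f : MvPolynomial σ R) : MvPolynomial σ R :=
  perturb p e n ((ddelta p)^[n] (const f)) - evalDeltaC p e ((ddelta p)^[n] (const f))

/-- The iterates `δ^k f` with `k < n` do not involve the perturbed variables. As `φ^n` is a ring
homomorphism and the polynomial ring has no `p`-torsion, the rules for `perturbDelta` follow from
this identity by cancelling `p^n`. -/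
theorem p_pow_mul_perturbDelta (e : σ → R) (n : ℕ) (f : MvPolynomial σ R) :
    (p : MvPolynomial σ R) ^ n * perturbDelta p e n f =
      perturb p e n ((dfrob p)^[n] (const f)) - evalDeltaC p e ((dfrob p)^[n] (const f)) := by
  exact (map_iterate_dfrob_sub p (perturb p e n : DPoly R σ →+* MvPolynomial σ R)
    (evalDeltaC p e : DPoly R σ →+* MvPolynomial σ R) n (const f) fun k hk =>
      perturb_eq_of_mem_upTo p e hk (iterate_ddelta_mem_upTo p le_rfl f)).symm

theorem evalDeltaC_iterate_dfrob (e : σ → R) (n : ℕ) (f : MvPolynomial σ R) :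
    evalDeltaC p e ((dfrob p)^[n] (const f)) =
      MvPolynomial.C (frobIter p n (MvPolynomial.aeval e f)) := by
  rw [evalDeltaC_apply, evalDelta_iterate_dfrob, evalDelta_const]

theorem mvPolynomial_p_ne_zero : (p : MvPolynomial σ R) ≠ 0 := by
  rw [← map_natCast (MvPolynomial.C : R →+* MvPolynomial σ R), Ne, MvPolynomial.C_eq_zero]
  exact p_ne_zero p R

theorem perturbDelta_C (e : σ → R) (n : ℕ) (r : R) :
    perturbDelta p e n (MvPolynomial.C r) = 0 := by
  apply mul_left_cancel₀ (pow_ne_zero n (mvPolynomial_p_ne_zero (R := R) (σ := σ) p))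
  have : const (MvPolynomial.C r : MvPolynomial σ R) = MvPolynomial.C r := by simp [const]
  rw [p_pow_mul_perturbDelta, this, iterate_dfrob_C, mul_zero]
  simp [perturb, evalDeltaC, evalDelta, MvPolynomial.algebraMap_eq]

theorem perturbDelta_add (e : σ → R) (n : ℕ) (f g : MvPolynomial σ R) :
    perturbDelta p e n (f + g) = perturbDelta p e n f + perturbDelta p e n g := by
  apply mul_left_cancel₀ (pow_ne_zero n (mvPolynomial_p_ne_zero (R := R) (σ := σ) p))
  rw [mul_add, p_pow_mul_perturbDelta, p_pow_mul_perturbDelta, p_pow_mul_perturbDelta, map_add,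
    iterate_map_add, map_add, map_add]
  ring

theorem perturbDelta_mul (e : σ → R) (n : ℕ) (f g : MvPolynomial σ R) :
    perturbDelta p e n (f * g) =
      MvPolynomial.C (frobIter p n (MvPolynomial.aeval e f)) * perturbDelta p e n g +
      MvPolynomial.C (frobIter p n (MvPolynomial.aeval e g)) * perturbDelta p e n f +
      (p : MvPolynomial σ R) ^ n * perturbDelta p e n f * perturbDelta p e n g := by
  apply mul_left_cancel₀ (pow_ne_zero n (mvPolynomial_p_ne_zero (R := R) (σ := σ) p))
  have hf := p_pow_mul_perturbDelta p e n f
  have hg := p_pow_mul_perturbDelta p e n g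
  have hfg := p_pow_mul_perturbDelta p e n (f * g)
  rw [map_mul, iterate_map_mul, map_mul, map_mul, evalDeltaC_iterate_dfrob,
    evalDeltaC_iterate_dfrob] at hfg
  rw [evalDeltaC_iterate_dfrob] at hf hg
  rw [hfg, eq_add_of_sub_eq' hf.symm, eq_add_of_sub_eq' hg.symm]
  ring

theorem iterate_ddelta_X (n : ℕ) (b : σ) :
    (ddelta p)^[n] (MvPolynomial.X (b, 0) : DPoly R σ) = MvPolynomial.X (b, n) := by
  induction n with
  | zero => rfl
  | succ n ih =>
    rw [Function.iterate_succ_apply', ih]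
    apply mul_left_cancel₀ (dpoly_p_ne_zero (R := R) (σ := σ) p)
    have h := dfrob_eq p (MvPolynomial.X (b, n) : DPoly R σ)
    rw [dfrob_X] at h
    exact (add_left_cancel h).symm

theorem const_X (b : σ) : const (MvPolynomial.X b : MvPolynomial σ R) = MvPolynomial.X (b, 0) := by
  simp [const]

theorem perturbDelta_X (e : σ → R) (n : ℕ) (b : σ) :
    perturbDelta p e n (MvPolynomial.X b) = MvPolynomial.X b := by
  rw [perturbDelta, const_X, iterate_ddelta_X, evalDeltaC_apply]
  simp [perturb, evalDelta]

end Perturb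

theorem Jet.mk_iterDelta_X (p : ℕ) [Fact p.Prime] {R : Type w} [CommRing R] [IsDomain R]
    [FrobeniusRing p R] {B : Type u} [CommRing B] [Algebra R B] {n i : ℕ} (hi : i ≤ n) (b : B) :
    Jet.mk p n (upTo.iterDelta p hi (MvPolynomial.X b : MvPolynomial B R)) = Jet.var p n b i hi :=
  congrArg (Jet.mk p n) (Subtype.ext
    ((congrArg (ddelta p)^[i] (const_X b)).trans (iterate_ddelta_X p i b)))

/-! ### Twisted derivations and the presentation of `O(L_δ^r)` -/

section Twisted

variable (p : ℕ) [Fact p.Prime] {R : Type w} [CommRing R] [IsDomain R] [FrobeniusRing p R]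
  {A : Type u} [CommRing A] [Algebra R A] {S : Type v} [CommRing S] [Algebra R S]

/-- `a ↦ φ^n(ε a) + p^k Ξ a` behaves like a `φ^n`-linear homomorphism of rings, after division
by `p^k`. -/
structure IsTwisted (ε : A →ₐ[R] R) (k n : ℕ) (Ξ : A → S) : Prop where
  map_algebraMap : ∀ r, Ξ (algebraMap R A r) = 0
  map_add : ∀ a b, Ξ (a + b) = Ξ a + Ξ b
  map_mul : ∀ a b, Ξ (a * b) = algebraMap R S (frobIter p n (ε a)) * Ξ b +
    algebraMap R S (frobIter p n (ε b)) * Ξ a + (p : S) ^ k * Ξ a * Ξ b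

variable {p}

theorem IsTwisted.map_zero {ε : A →ₐ[R] R} {k n : ℕ} {Ξ : A → S} (h : IsTwisted p ε k n Ξ) :
    Ξ 0 = 0 := by
  simpa using h.map_algebraMap 0

theorem IsTwisted.map_smul {ε : A →ₐ[R] R} {k n : ℕ} {Ξ : A → S} (h : IsTwisted p ε k n Ξ)
    (r : R) (a : A) : Ξ (r • a) = algebraMap R S (frobIter p n r) * Ξ a := by
  rw [Algebra.smul_def, h.map_mul, h.map_algebraMap, AlgHom.commutes]
  simp

theorem IsTwisted.map_neg {ε : A →ₐ[R] R} {k n : ℕ} {Ξ : A → S} (h : IsTwisted p ε k n Ξ)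
    (a : A) : Ξ (-a) = -Ξ a := by
  have := h.map_smul (-1) a
  simpa using this

theorem IsTwisted.map_sub {ε : A →ₐ[R] R} {k n : ℕ} {Ξ : A → S} (h : IsTwisted p ε k n Ξ)
    (a b : A) : Ξ (a - b) = Ξ a - Ξ b := by
  rw [sub_eq_add_neg, h.map_add, h.map_neg, sub_eq_add_neg]

/-- `perturbDelta` and `Ξ` obey the same rules on constants, sums and products, so agreement on
variables suffices. This is what makes a twisted derivation respect the relations of order `n`. -/
theorem IsTwisted.aeval_perturbDelta {ε : A →ₐ[R] R} {n : ℕ} {Ξ : A → S}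
    (h : IsTwisted p ε n n Ξ) (f : MvPolynomial A R) :
    MvPolynomial.aeval Ξ (perturbDelta p ε n f) = Ξ (MvPolynomial.aeval (id : A → A) f) := by
  have hε : ∀ g : MvPolynomial A R, MvPolynomial.aeval ε g = ε (MvPolynomial.aeval id g) := by
    intro g
    rw [MvPolynomial.comp_aeval_apply]
    rfl
  induction f using MvPolynomial.induction_on with
  | C r => rw [perturbDelta_C, _root_.map_zero, MvPolynomial.aeval_C, h.map_algebraMap]
  | add f g hf hg => rw [perturbDelta_add, _root_.map_add, _root_.map_add, h.map_add, hf, hg]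
  | mul_X f b hf =>
    rw [perturbDelta_mul, perturbDelta_X, _root_.map_mul (MvPolynomial.aeval id), h.map_mul,
      MvPolynomial.aeval_X, hε f, MvPolynomial.aeval_X]
    simp only [_root_.map_add, _root_.map_mul, hf, MvPolynomial.aeval_C, MvPolynomial.aeval_X,
      map_natCast, map_pow, id]

end Twisted

/-! ### The functions `ξ_b` as universal generators of the algebra of `L_δ^r(G)` -/

section LiePresentation

variable (p : ℕ) [Fact p.Prime] {R : Type w} [CommRing R] [IsDomain R] [FrobeniusRing p R]
  {A : Type u} [CommRing A] [HopfAlgebra R A]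

variable (R) in
/-- The function `δ^r x_b - δ^r (ε b)` on `L_δ^r(G)`. -/
def Lie.xi (r : ℕ) (b : A) : Lie p R A r :=
  Lie.mk p R A r (Jet.var p r b r le_rfl) -
    algebraMap R _ ((delta p)^[r] (Bialgebra.counitAlgHom R A b))

theorem Lie.mk_surjective (r : ℕ) : Function.Surjective (Lie.mk p R A r) :=
  Ideal.Quotient.mk_surjective

theorem Lie.mk_incl (r : ℕ) (y : Jet p R A (r - 1)) :
    Lie.mk p R A r (Jet.incl p (Nat.sub_le r 1) y) = algebraMap R _ (Jet.one p R A (r - 1) y) := by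
  have hy : y - algebraMap R _ (Jet.one p R A (r - 1) y) ∈
      RingHom.ker (Jet.one p R A (r - 1)) := by
    rw [RingHom.mem_ker, map_sub, AlgHom.commutes]; exact sub_self _
  have h1 : Lie.mk p R A r (Jet.incl p (Nat.sub_le r 1)
      (y - algebraMap R _ (Jet.one p R A (r - 1) y))) = 0 :=
    Ideal.Quotient.eq_zero_iff_mem.2 (Ideal.mem_map_of_mem _ hy)
  rwa [map_sub, map_sub, AlgHom.commutes, AlgHom.commutes, sub_eq_zero] at h1

theorem Lie.mk_var_of_lt {r i : ℕ} (hi : i < r) (b : A) :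
    Lie.mk p R A r (Jet.var p r b i hi.le) =
      algebraMap R _ ((delta p)^[i] (Bialgebra.counitAlgHom R A b)) := by
  have h := Lie.mk_incl p (R := R) (A := A) r (Jet.var p (r - 1) b i (by omega))
  rwa [Jet.incl_var, Jet.one, Jet.nabla_var] at h

theorem Lie.mk_var_self (r : ℕ) (b : A) :
    Lie.mk p R A r (Jet.var p r b r le_rfl) = Lie.xi p R r b +
      algebraMap R _ ((delta p)^[r] (Bialgebra.counitAlgHom R A b)) := by
  rw [Lie.xi, sub_add_cancel]

/-- On `L_δ^r` the coordinates of order below `r` are frozen at the unit and only those of order `r`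
vary; this is the substitution made by `perturb`. -/
theorem Lie.mk_mk (r : ℕ) (g : upTo R A r) :
    Lie.mk p R A r (Jet.mk p r g) =
      MvPolynomial.aeval (Lie.xi p R r) (perturb p (Bialgebra.counitAlgHom R A) r (g : DPoly R A)) := by
  have : (Lie.mk p R A r).comp (Jet.mk p r) =
      ((MvPolynomial.aeval (Lie.xi p R r)).comp (perturb p (Bialgebra.counitAlgHom R A) r)).comp
        (upTo R A r).val := by
    refine upTo_algHom_ext fun b i hi => ?_
    change Lie.mk p R A r (Jet.var p r b i hi) = MvPolynomial.aeval (Lie.xi p R r)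
      (perturb p (Bialgebra.counitAlgHom R A) r (MvPolynomial.X (b, i)))
    rw [perturb, MvPolynomial.aeval_X]
    rcases hi.lt_or_eq with h | rfl
    · rw [Lie.mk_var_of_lt p h, if_neg h.ne, add_zero, MvPolynomial.aeval_C]
    · rw [Lie.mk_var_self, if_pos rfl, map_add, MvPolynomial.aeval_C, MvPolynomial.aeval_X, add_comm]
  exact DFunLike.congr_fun this g

theorem Lie.aeval_xi_perturbDelta (r : ℕ) (f : MvPolynomial A R) :
    MvPolynomial.aeval (Lie.xi p R r) (perturbDelta p (Bialgebra.counitAlgHom R A) r f) =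
      Lie.xi p R r (MvPolynomial.aeval (id : A → A) f) := by
  have h1 := Jet.mk_iterDelta_eq p (n := r) (f := f)
    (g := MvPolynomial.X (MvPolynomial.aeval (id : A → A) f)) (by rw [MvPolynomial.aeval_X, id])
  have h2 := congrArg (Lie.mk p R A r) h1
  rw [Lie.mk_mk] at h2
  have h3 : Jet.mk p r (upTo.iterDelta p le_rfl
      (MvPolynomial.X (MvPolynomial.aeval (id : A → A) f) : MvPolynomial A R)) =
        Jet.var p r (MvPolynomial.aeval (id : A → A) f) r le_rfl :=
    Jet.mk_iterDelta_X p le_rfl _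
  have hε : MvPolynomial.aeval (Bialgebra.counitAlgHom R A) f =
      Bialgebra.counitAlgHom R A (MvPolynomial.aeval id f) := by
    rw [MvPolynomial.comp_aeval_apply]
    rfl
  rw [h3, Lie.mk_var_self] at h2
  rw [perturbDelta, map_sub, evalDeltaC_apply, MvPolynomial.aeval_C, evalDelta_iterate_ddelta,
    evalDelta_const, hε, sub_eq_iff_eq_add]
  exact h2

/-- These are the rules of `perturbDelta` for two variables, with `ξ` substituted. `Lie.algHom_ext`
and `Lie.lift` add that `ξ` is universal. -/
theorem Lie.isTwisted_xi (r : ℕ) :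
    IsTwisted p (Bialgebra.counitAlgHom R A) r r (Lie.xi p R r) where
  map_algebraMap a := by
    have h := Lie.aeval_xi_perturbDelta p r (MvPolynomial.C a : MvPolynomial A R)
    rwa [perturbDelta_C, map_zero, MvPolynomial.aeval_C, eq_comm] at h
  map_add a b := by
    have h := Lie.aeval_xi_perturbDelta p r
      (MvPolynomial.X a + MvPolynomial.X b : MvPolynomial A R)
    rw [perturbDelta_add, perturbDelta_X, perturbDelta_X] at h
    simpa only [map_add, MvPolynomial.aeval_X, id] using h.symm
  map_mul a b := by
    have h := Lie.aeval_xi_perturbDelta p r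
      (MvPolynomial.X a * MvPolynomial.X b : MvPolynomial A R)
    rw [perturbDelta_mul, perturbDelta_X, perturbDelta_X] at h
    simpa only [map_add, map_mul, map_pow, map_natCast, MvPolynomial.aeval_X, MvPolynomial.aeval_C,
      id] using h.symm

theorem Lie.algHom_ext {S : Type v} [CommRing S] [Algebra R S] {r : ℕ}
    {ψ ψ' : Lie p R A r →ₐ[R] S} (h : ∀ b, ψ (Lie.xi p R r b) = ψ' (Lie.xi p R r b)) : ψ = ψ' := by
  have : ψ.comp (Lie.mk p R A r) = ψ'.comp (Lie.mk p R A r) := by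
    refine Jet.algHom_ext p fun b i hi => ?_
    rw [AlgHom.comp_apply, AlgHom.comp_apply]
    rcases hi.lt_or_eq with hlt | rfl
    · rw [Lie.mk_var_of_lt p hlt, AlgHom.commutes, AlgHom.commutes]
    · rw [Lie.mk_var_self, map_add, map_add, AlgHom.commutes, AlgHom.commutes, h]
  refine AlgHom.ext fun y => ?_
  obtain ⟨y, rfl⟩ := Lie.mk_surjective p r y
  exact DFunLike.congr_fun this y

/-- The homomorphism of algebras out of `O(J^r(G))` given by a twisted derivation. -/
def Jet.liftTwisted {S : Type v} [CommRing S] [Algebra R S] {r : ℕ} {Ξ : A → S}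
    (h : IsTwisted p (Bialgebra.counitAlgHom R A) r r Ξ) : Jet p R A r →ₐ[R] S :=
  Jet.lift p (((MvPolynomial.aeval Ξ).comp (perturb p (Bialgebra.counitAlgHom R A) r)).comp
    (upTo R A r).val) fun f hf i hi g hg => by
      have hf' : MvPolynomial.aeval (id : A → A) f = 0 := hf
      have hε : MvPolynomial.aeval (Bialgebra.counitAlgHom R A) f = 0 := by
        rw [← map_zero (Bialgebra.counitAlgHom R A), ← hf', MvPolynomial.comp_aeval_apply]
        rfl
      have h0 : evalDeltaC p (Bialgebra.counitAlgHom R A) ((ddelta p)^[i] (const f)) = 0 := by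
        rw [evalDeltaC_apply, evalDelta_iterate_ddelta, evalDelta_const, hε, iterate_delta_zero,
          map_zero]
      rw [AlgHom.comp_apply, AlgHom.comp_apply, Subalgebra.val_apply, hg]
      -- Relations of order below `r` only see the frozen coordinates and hold because `ε` kills
      -- `f`; the relation of order `r` holds because `Ξ` is twisted.
      rcases hi.lt_or_eq with hlt | rfl
      · rw [perturb_eq_of_mem_upTo p _ hlt (iterate_ddelta_mem_upTo p le_rfl f), h0, map_zero]
      · have h1 := h.aeval_perturbDelta f
        rwa [perturbDelta, h0, sub_zero, hf', h.map_zero] at h1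

theorem Jet.liftTwisted_var {S : Type v} [CommRing S] [Algebra R S] {r : ℕ} {Ξ : A → S}
    (h : IsTwisted p (Bialgebra.counitAlgHom R A) r r Ξ) (b : A) (i : ℕ) (hi : i ≤ r) :
    Jet.liftTwisted p h (Jet.var p r b i hi) =
      algebraMap R S ((delta p)^[i] (Bialgebra.counitAlgHom R A b)) + if i = r then Ξ b else 0 := by
  rw [Jet.liftTwisted, Jet.var, Jet.lift_mk, AlgHom.comp_apply, AlgHom.comp_apply,
    Subalgebra.val_apply, perturb, MvPolynomial.aeval_X, map_add, MvPolynomial.aeval_C]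
  congr 1
  split_ifs
  · rw [MvPolynomial.aeval_X]
  · rw [map_zero]

/-- The homomorphism of algebras out of `O(L_δ^r(G))` given by a twisted derivation. -/
def Lie.lift {S : Type v} [CommRing S] [Algebra R S] {r : ℕ} (hr : 1 ≤ r) {Ξ : A → S}
    (h : IsTwisted p (Bialgebra.counitAlgHom R A) r r Ξ) : Lie p R A r →ₐ[R] S :=
  Ideal.Quotient.liftₐ (lieIdeal p R A r) (Jet.liftTwisted p h) fun a ha => by
    -- For `r ≥ 1` the coordinates of order at most `r - 1` do not meet the perturbed order `r`, so
    -- the point lies over the unit section.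
    have h1 : (Jet.liftTwisted p h).comp (Jet.incl p (Nat.sub_le r 1)) =
        (Algebra.ofId R S).comp (Jet.one p R A (r - 1)) := by
      refine Jet.algHom_ext p fun b i hi => ?_
      rw [AlgHom.comp_apply, Jet.incl_var, Jet.liftTwisted_var, if_neg (by omega), add_zero,
        AlgHom.comp_apply, Jet.one, Jet.nabla_var]
      rfl
    have h2 : lieIdeal p R A r ≤ RingHom.ker (Jet.liftTwisted p h) := by
      refine Ideal.map_le_iff_le_comap.2 fun y hy => ?_
      rw [Ideal.mem_comap, RingHom.mem_ker, ← AlgHom.comp_apply, h1, AlgHom.comp_apply,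
        RingHom.mem_ker.1 hy, map_zero]
    exact h2 ha

theorem Lie.lift_xi {S : Type v} [CommRing S] [Algebra R S] {r : ℕ} (hr : 1 ≤ r) {Ξ : A → S}
    (h : IsTwisted p (Bialgebra.counitAlgHom R A) r r Ξ) (b : A) :
    Lie.lift p hr h (Lie.xi p R r b) = Ξ b := by
  rw [Lie.xi, map_sub, AlgHom.commutes]
  have : Lie.lift p hr h (Lie.mk p R A r (Jet.var p r b r le_rfl)) =
    Jet.liftTwisted p h (Jet.var p r b r le_rfl) := rfl
  rw [this, Jet.liftTwisted_var, if_pos rfl, add_sub_cancel_left]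

end LiePresentation

/-! ### Points of `L_δ^r(G)` and the map `ex` -/

section LiePoints

variable (p : ℕ) [Fact p.Prime] {R : Type w} [CommRing R] [IsDomain R] [FrobeniusRing p R]
  {A : Type u} [CommRing A] [HopfAlgebra R A]

theorem Lie.mk_frobPow (r : ℕ) (b : A) :
    Lie.mk p R A r (Jet.frobPow p R A r b) =
      algebraMap R _ (frobIter p r (Bialgebra.counitAlgHom R A b)) +
        (p : Lie p R A r) ^ r * Lie.xi p R r b := by
  have h := p_pow_mul_perturbDelta p (Bialgebra.counitAlgHom R A) r (MvPolynomial.X b)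
  rw [evalDeltaC_iterate_dfrob, perturbDelta_X, MvPolynomial.aeval_X, const_X] at h
  rw [Jet.frobPow_apply, Lie.mk_mk, eq_add_of_sub_eq' h.symm, map_add, map_mul, map_pow,
    map_natCast, MvPolynomial.aeval_C, MvPolynomial.aeval_X]

theorem LiePt.frobIter_ex {r : ℕ} (α : LiePt p R A r) (b : A) :
    frobIter p r ((LiePt.ex p α).ofConv b) =
      frobIter p r (Bialgebra.counitAlgHom R A b) + (p : R) ^ r * α (Lie.xi p R r b) := by
  rw [LiePt.ex, WithConv.ofConv_toConv, Jet.ex_apply, RingEquiv.apply_symm_apply, LiePt.toJet,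
    AlgHom.comp_apply, Lie.mk_frobPow, map_add, map_mul, map_pow, map_natCast, AlgHom.commutes]
  rfl

theorem frobIter_natCast_pow (n k : ℕ) : frobIter p n ((p : R) ^ k) = (p : R) ^ k := by
  rw [map_pow, map_natCast]

theorem LiePt.ex_sub {r : ℕ} (α : LiePt p R A r) (b : A) :
    (LiePt.ex p α).ofConv b - Bialgebra.counitAlgHom R A b =
      (p : R) ^ r * (frobIter p r).symm (α (Lie.xi p R r b)) := by
  apply (frobIter p r).injective
  rw [map_sub, LiePt.frobIter_ex, map_mul, frobIter_natCast_pow, RingEquiv.apply_symm_apply]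
  ring

/-- `p^r` can be cancelled in `R`, and the `ξ_b` generate. Every equality between points of `L_δ^r`
can thus be checked in the group `G(R)`. -/
theorem LiePt.ex_injective {r : ℕ} : Function.Injective (LiePt.ex p (R := R) (A := A) (r := r)) := by
  intro α β h
  refine Lie.algHom_ext p fun b => ?_
  apply mul_left_cancel₀ (pow_ne_zero r (p_ne_zero p R))
  have h1 := LiePt.frobIter_ex p α b
  rw [h, LiePt.frobIter_ex] at h1
  exact (add_left_cancel h1).symm

/-- Up to `φ^r`, which preserves divisibility by powers of `p`, the map `ex` multiplies differences
of the coordinates `ξ_b` by `p^r`. -/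
theorem LiePt.modEq_iff {r : ℕ} (m : ℕ) (α β : LiePt p R A r) :
    LiePt.ModEq p m α β ↔
      ∀ b, (p : R) ^ (r + m) ∣ (LiePt.ex p α).ofConv b - (LiePt.ex p β).ofConv b := by
  have key : ∀ b, (p : R) ^ (r + m) ∣ (LiePt.ex p α).ofConv b - (LiePt.ex p β).ofConv b ↔
      (p : R) ^ m ∣ α (Lie.xi p R r b) - β (Lie.xi p R r b) := by
    intro b
    have e : frobIter p r ((LiePt.ex p α).ofConv b - (LiePt.ex p β).ofConv b) =
        (p : R) ^ r * (α (Lie.xi p R r b) - β (Lie.xi p R r b)) := by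
      rw [map_sub, LiePt.frobIter_ex, LiePt.frobIter_ex]; ring
    rw [← mul_dvd_mul_iff_left (c := α _ - _) (pow_ne_zero r (p_ne_zero p R)), ← pow_add, ← e]
    exact ⟨dvd_frobIter p, dvd_of_dvd_frobIter p⟩
  simp only [key]
  constructor
  · intro h b
    have := DFunLike.congr_fun h (Lie.xi p R r b)
    rw [← Ideal.mem_span_singleton]
    exact Ideal.Quotient.eq.1 this
  · intro h
    refine Lie.algHom_ext p fun b => ?_
    exact Ideal.Quotient.eq.2 (Ideal.mem_span_singleton.2 (h b))

/-- The difference of the ring homomorphisms `φ^r ∘ P` and `φ^r ∘ ε`, divided by `p^r`, is a twisted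
derivation with values in `R`, hence a point by `Lie.lift`. -/
theorem LiePt.exists_ex_eq {r : ℕ} (hr : 1 ≤ r) (P : A →ₐ[R] R)
    (h : ∀ b, (p : R) ^ r ∣ P b - Bialgebra.counitAlgHom R A b) :
    ∃ α : LiePt p R A r, LiePt.ex p α = WithConv.toConv P := by
  have h' : ∀ b, ∃ c, frobIter p r (P b) =
      frobIter p r (Bialgebra.counitAlgHom R A b) + (p : R) ^ r * c := by
    intro b
    obtain ⟨c, hc⟩ := h b
    refine ⟨frobIter p r c, ?_⟩
    rw [eq_add_of_sub_eq' hc, map_add, map_mul, frobIter_natCast_pow]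
  choose c hc using h'
  have hp := pow_ne_zero r (p_ne_zero p R)
  have hT : IsTwisted p (Bialgebra.counitAlgHom R A) r r c :=
    { map_algebraMap := fun a => by
        have := hc (algebraMap R A a)
        rw [AlgHom.commutes, AlgHom.commutes, left_eq_add, mul_eq_zero] at this
        exact this.resolve_left hp
      map_add := fun a b => by
        have := hc (a + b)
        rw [map_add, map_add, hc, hc, map_add, map_add] at this
        apply mul_left_cancel₀ hp
        linear_combination -this
      map_mul := fun a b => by
        have := hc (a * b)
        rw [map_mul, map_mul, hc, hc, map_mul, map_mul] at this
        apply mul_left_cancel₀ hp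
        simp only [Algebra.algebraMap_self, RingHom.id_apply]
        linear_combination -this }
  refine ⟨Lie.lift p hr hT, WithConv.ofConv_injective (AlgHom.ext fun b => ?_)⟩
  apply (frobIter p r).injective
  rw [LiePt.frobIter_ex, Lie.lift_xi, ← hc, WithConv.ofConv_toConv]

theorem LiePt.toJet_ofJet {r : ℕ} (ψ : Jet p R A r →ₐ[R] R) (h) :
    LiePt.toJet p (LiePt.ofJet p ψ h) = ψ :=
  AlgHom.ext fun _ => rfl

theorem toConv_mul_toConv (P Q : A →ₐ[R] R) :
    WithConv.toConv P * WithConv.toConv Q =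
      WithConv.toConv ((pairPt P Q).comp (Bialgebra.comulAlgHom R A)) :=
  WithConv.ofConv_injective (AlgHom.ext fun c => AlgHom.convMul_apply _ _ c)

theorem LiePt.ex_add {r : ℕ} (α β : LiePt p R A r) :
    LiePt.ex p (LiePt.add p α β) = LiePt.ex p α * LiePt.ex p β := by
  have h := Jet.ex_pair p (le_refl r) (LiePt.toJet p α) (LiePt.toJet p β)
  simp only [Jet.incl_self, AlgHom.comp_id] at h
  rw [LiePt.ex, LiePt.add, LiePt.toJet_ofJet, Jet.mul, Jet.ex_comp_map, h, LiePt.ex, LiePt.ex,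
    toConv_mul_toConv]

theorem LiePt.ex_zero (r : ℕ) : LiePt.ex p (LiePt.zero p R A r) = 1 := by
  have h : LiePt.toJet p (LiePt.zero p R A r) = Jet.nabla p r (Bialgebra.counitAlgHom R A) :=
    LiePt.toJet_ofJet p _ _
  rw [LiePt.ex, h, Jet.ex_nabla]
  rfl

theorem LiePt.ex_map {A' : Type v} [CommRing A'] [HopfAlgebra R A'] (f : A' →ₐc[R] A) {r : ℕ}
    (α : LiePt p R A r) :
    LiePt.ex p (LiePt.map p f α) = WithConv.toConv ((LiePt.ex p α).ofConv.comp (f : A' →ₐ[R] A)) := by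
  rw [LiePt.ex, LiePt.map, LiePt.toJet_ofJet, Jet.ex_comp_map, LiePt.ex, WithConv.ofConv_toConv]

end LiePoints

/-! ### Functoriality of the groups of points under convolution -/

section ConvComp

variable {R : Type w} [CommRing R] {A : Type u} [CommRing A] [HopfAlgebra R A]

/-- Precomposition with a homomorphism of Hopf algebras, as a homomorphism of groups of points. -/
def compBialgHom {A' : Type v} [CommRing A'] [HopfAlgebra R A'] (f : A' →ₐc[R] A) (S : Type*)
    [CommRing S] [Algebra R S] : WithConv (A →ₐ[R] S) →* WithConv (A' →ₐ[R] S) where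
  toFun P := WithConv.toConv (P.ofConv.comp (f : A' →ₐ[R] A))
  map_one' := by
    refine WithConv.ofConv_injective (AlgHom.ext fun a => ?_)
    exact congrArg (algebraMap R S) (DFunLike.congr_fun (BialgHom.counitAlgHom_comp f) a)
  map_mul' P Q := WithConv.ofConv_injective (AlgHom.convMul_comp_bialgHom_distrib P Q f)

/-- Composition with a homomorphism of algebras, as a homomorphism of groups of points. -/
def algHomComp (A : Type u) [CommRing A] [HopfAlgebra R A] {S : Type*} [CommRing S] [Algebra R S]
    {T : Type*} [CommRing T] [Algebra R T] (h : S →ₐ[R] T) :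
    WithConv (A →ₐ[R] S) →* WithConv (A →ₐ[R] T) where
  toFun P := WithConv.toConv (h.comp P.ofConv)
  map_one' := WithConv.ofConv_injective (AlgHom.ext fun a => by
    change h (algebraMap R S _) = algebraMap R T _
    rw [AlgHom.commutes])
  map_mul' P Q := WithConv.ofConv_injective (AlgHom.comp_convMul_distrib h P Q)

end ConvComp

/-! ### The commutator homomorphism -/

section Commutator

open scoped commutatorElement

variable (R : Type w) [CommRing R] (A : Type u) [CommRing A] [HopfAlgebra R A]

/-- The homomorphism `O(G) → O(G × G)` of the commutator morphism. -/
def commHom : A →ₐ[R] A ⊗[R] A :=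
  (⁅(WithConv.toConv Algebra.TensorProduct.includeLeft : WithConv (A →ₐ[R] A ⊗[R] A)),
    WithConv.toConv Algebra.TensorProduct.includeRight⁆).ofConv

variable {R A}

theorem comp_commHom {S : Type v} [CommRing S] [Bialgebra R S] (h : A ⊗[R] A →ₐ[R] S) :
    WithConv.toConv (h.comp (commHom R A)) =
      ⁅WithConv.toConv (h.comp Algebra.TensorProduct.includeLeft),
        WithConv.toConv (h.comp Algebra.TensorProduct.includeRight)⁆ :=
  map_commutatorElement (algHomComp A h) _ _

theorem lift_comp_commHom {S : Type v} [CommRing S] [Bialgebra R S] (P Q : A →ₐ[R] S) :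
    WithConv.toConv ((Algebra.TensorProduct.lift P Q fun _ _ => .all _ _).comp (commHom R A)) =
      ⁅WithConv.toConv P, WithConv.toConv Q⁆ := by
  rw [comp_commHom, Algebra.TensorProduct.lift_comp_includeLeft]
  congr 2
  exact Algebra.TensorProduct.lift_comp_includeRight P Q fun _ _ => .all _ _

theorem pairPt_comp_commHom (P Q : A →ₐ[R] R) :
    WithConv.toConv ((pairPt P Q).comp (commHom R A)) =
      ⁅WithConv.toConv P, WithConv.toConv Q⁆ :=
  lift_comp_commHom P Q

variable (R A) in
/-- The projection of `A` on the augmentation ideal. -/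
def augProj : A →ₗ[R] A :=
  LinearMap.id - ((Algebra.ofId R A).comp (Bialgebra.counitAlgHom R A)).toLinearMap

theorem augProj_apply (a : A) :
    augProj R A a = a - algebraMap R A (Bialgebra.counitAlgHom R A a) := rfl

/-- Expansion of `id ⊗ id` with `id = augProj + ε`, arranged so that besides the part in `I ⊗ I`
only restrictions to the axes and to the origin of `G × G` appear. -/
theorem eq_map_augProj_add (z : A ⊗[R] A) :
    z = TensorProduct.map (augProj R A) (augProj R A) z +
      Algebra.TensorProduct.lift (Algebra.TensorProduct.includeLeft (R := R) (S := R) (A := A) (B := A))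
        ((Algebra.ofId R (A ⊗[R] A)).comp (Bialgebra.counitAlgHom R A)) (fun _ _ => .all _ _) z +
      Algebra.TensorProduct.lift ((Algebra.ofId R (A ⊗[R] A)).comp (Bialgebra.counitAlgHom R A))
        Algebra.TensorProduct.includeRight (fun _ _ => .all _ _) z -
      algebraMap R _ (pairPt (Bialgebra.counitAlgHom R A) (Bialgebra.counitAlgHom R A) z) := by
  induction z with
  | zero => simp only [map_zero, add_zero, sub_zero]
  | add x y hx hy =>
    simp only [map_add] at hx hy ⊢
    nth_rewrite 1 [hx, hy]
    ring
  | tmul a b =>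
    have e1 : ∀ r : R, (algebraMap R A r) ⊗ₜ[R] (1 : A) = algebraMap R (A ⊗[R] A) r := fun r => rfl
    have e2 : ∀ r : R, (1 : A) ⊗ₜ[R] (algebraMap R A r) = algebraMap R (A ⊗[R] A) r := fun r => by
      rw [← e1, Algebra.algebraMap_eq_smul_one, TensorProduct.tmul_smul, TensorProduct.smul_tmul']
    have e3 : ∀ x y : A, x ⊗ₜ[R] y = (x ⊗ₜ[R] (1 : A)) * ((1 : A) ⊗ₜ[R] y) := fun x y => by
      rw [Algebra.TensorProduct.tmul_mul_tmul, one_mul, mul_one]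
    simp only [TensorProduct.map_tmul, augProj_apply, pairPt, Algebra.TensorProduct.lift_tmul,
      AlgHom.comp_apply, Algebra.TensorProduct.includeLeft_apply,
      Algebra.TensorProduct.includeRight_apply, map_mul, Algebra.ofId_apply]
    rw [e3 a b, e3 (a - _) _, TensorProduct.sub_tmul, TensorProduct.tmul_sub, e1, e2]
    ring

/-- A commutator with the unit is the unit, so the pullback of `a` restricts to the constant `ε a`
on both axes. What remains lies in `I ⊗ I`, and this is why the levels `r` and `s` add. -/
theorem commHom_eq (a : A) :
    commHom R A a = TensorProduct.map (augProj R A) (augProj R A) (commHom R A a) +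
      algebraMap R _ (Bialgebra.counitAlgHom R A a) := by
  have h1 := lift_comp_commHom (Algebra.TensorProduct.includeLeft (R := R) (S := R) (A := A) (B := A))
    ((Algebra.ofId R (A ⊗[R] A)).comp (Bialgebra.counitAlgHom R A))
  have h2 := lift_comp_commHom ((Algebra.ofId R (A ⊗[R] A)).comp (Bialgebra.counitAlgHom R A))
    (Algebra.TensorProduct.includeRight (R := R) (A := A) (B := A))
  have h3 := pairPt_comp_commHom (Bialgebra.counitAlgHom R A) (Bialgebra.counitAlgHom R A)
  have h1' := DFunLike.congr_fun (congrArg WithConv.ofConv (h1.trans (commutatorElement_one_right _))) a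
  have h2' := DFunLike.congr_fun (congrArg WithConv.ofConv (h2.trans (commutatorElement_one_left _))) a
  have h3' := DFunLike.congr_fun (congrArg WithConv.ofConv (h3.trans (commutatorElement_one_left _))) a
  have h := eq_map_augProj_add (commHom R A a)
  have e := AlgHom.convOne_apply (R := R) (A := A ⊗[R] A) a
  rw [WithConv.ofConv_toConv, AlgHom.comp_apply] at h1' h2' h3'
  rw [h1', h2', h3'] at h
  refine h.trans ?_
  change _ + algebraMap R _ (Bialgebra.counitAlgHom R A a) +
    algebraMap R _ (Bialgebra.counitAlgHom R A a) -
    algebraMap R _ (Bialgebra.counitAlgHom R A a) = _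
  ring

end Commutator

/-! ### Pairing of twisted derivations -/

section Pairing

variable {p : ℕ} [Fact p.Prime] {R : Type w} [CommRing R] [IsDomain R] [FrobeniusRing p R]

theorem frobIter_frobIter (m n : ℕ) (x : R) :
    frobIter p m (frobIter p n x) = frobIter p (n + m) x := by
  rw [frobIter_apply, frobIter_apply, frobIter_apply, ← Function.iterate_add_apply, add_comm]

/-- Applied with a power of `φ` as `κ`, this raises the semilinearity exponent and keeps the power
of `p`. It brings the functions `ξ` of orders `r` and `s` to the common exponent `r + s`. -/
theorem IsTwisted.comp {A : Type u} [CommRing A] [Algebra R A] {S : Type*} [CommRing S]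
    [Algebra R S] {T : Type*} [CommRing T] [Algebra R T] {ε : A →ₐ[R] R} {k n m : ℕ} {Ξ : A → S}
    (h : IsTwisted p ε k n Ξ) (κ : S →+* T)
    (hκ : ∀ r, κ (algebraMap R S r) = algebraMap R T (frobIter p m r)) :
    IsTwisted p ε k (n + m) fun a => κ (Ξ a) where
  map_algebraMap r := by rw [h.map_algebraMap, _root_.map_zero]
  map_add a b := by rw [h.map_add, _root_.map_add]
  map_mul a b := by
    rw [h.map_mul]
    simp only [_root_.map_add, _root_.map_mul, map_pow, map_natCast, hκ, frobIter_frobIter]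

variable {A : Type u} [CommRing A] [HopfAlgebra R A] {S : Type v} [CommRing S] [Algebra R S]

theorem IsTwisted.map_augProj {k n : ℕ} {h : A → S}
    (hh : IsTwisted p (Bialgebra.counitAlgHom R A) k n h) (a : A) : h (augProj R A a) = h a := by
  rw [augProj_apply, hh.map_sub, hh.map_algebraMap, sub_zero]

theorem counit_augProj (a : A) : Bialgebra.counitAlgHom R A (augProj R A a) = 0 := by
  rw [augProj_apply, map_sub, AlgHom.commutes]
  exact sub_self _

theorem IsTwisted.map_augProj_mul {k n : ℕ} {h : A → S}
    (hh : IsTwisted p (Bialgebra.counitAlgHom R A) k n h) (a b : A) :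
    h (augProj R A a * augProj R A b) = (p : S) ^ k * h a * h b := by
  rw [hh.map_mul, counit_augProj, counit_augProj, hh.map_augProj, hh.map_augProj]
  simp

/-- The additive map `a ⊗ b ↦ h a * g b`. -/
def IsTwisted.pairing {r s n : ℕ} {h g : A → S}
    (hh : IsTwisted p (Bialgebra.counitAlgHom R A) r n h)
    (hg : IsTwisted p (Bialgebra.counitAlgHom R A) s n g) : A ⊗[R] A →+ S :=
  TensorProduct.liftAddHom
    (AddMonoidHom.mk' (fun a => AddMonoidHom.mk' (fun b => h a * g b)
      fun b b' => by rw [hg.map_add, mul_add])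
      fun a a' => AddMonoidHom.ext fun b => by
        simp only [AddMonoidHom.mk'_apply, AddMonoidHom.add_apply, hh.map_add, add_mul])
    -- Balancedness over `R` needs both maps to be semilinear for the same power `φ^n`.
    fun c a b => by
      simp only [AddMonoidHom.mk'_apply, hh.map_smul, hg.map_smul]
      ring

variable {r s n : ℕ} {h g : A → S} (hh : IsTwisted p (Bialgebra.counitAlgHom R A) r n h)
    (hg : IsTwisted p (Bialgebra.counitAlgHom R A) s n g)

theorem IsTwisted.pairing_tmul (a b : A) : hh.pairing hg (a ⊗ₜ b) = h a * g b := rfl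

theorem IsTwisted.pairing_smul (c : R) (z : A ⊗[R] A) :
    hh.pairing hg (c • z) = algebraMap R S (frobIter p n c) * hh.pairing hg z := by
  induction z with
  | zero => simp
  | add x y hx hy => rw [smul_add, _root_.map_add, hx, hy, _root_.map_add, mul_add]
  | tmul a b =>
    rw [TensorProduct.smul_tmul', pairing_tmul, pairing_tmul, hh.map_smul, mul_assoc]

theorem IsTwisted.pairing_algebraMap (c : R) :
    hh.pairing hg (algebraMap R (A ⊗[R] A) c) = 0 := by
  rw [Algebra.algebraMap_eq_smul_one, hh.pairing_smul hg, Algebra.TensorProduct.one_def,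
    pairing_tmul]
  have := hh.map_algebraMap 1
  rw [map_one] at this
  rw [this, zero_mul, mul_zero]

theorem IsTwisted.pairing_map_augProj (z : A ⊗[R] A) :
    hh.pairing hg (TensorProduct.map (augProj R A) (augProj R A) z) = hh.pairing hg z := by
  induction z with
  | zero => simp
  | add x y hx hy => rw [_root_.map_add, _root_.map_add, hx, hy, _root_.map_add]
  | tmul a b =>
    rw [TensorProduct.map_tmul, pairing_tmul, pairing_tmul, hh.map_augProj, hg.map_augProj]

/-- On products of augmentation elements only the quadratic term of the twisted rule survives; the
two tensor factors contribute `p^r` and `p^s`. -/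
theorem IsTwisted.pairing_map_augProj_mul (z z' : A ⊗[R] A) :
    hh.pairing hg (TensorProduct.map (augProj R A) (augProj R A) z *
      TensorProduct.map (augProj R A) (augProj R A) z') =
        (p : S) ^ (r + s) * hh.pairing hg z * hh.pairing hg z' := by
  induction z with
  | zero => simp
  | add x y hx hy =>
    rw [_root_.map_add, add_mul, _root_.map_add, hx, hy, _root_.map_add]
    ring
  | tmul a b =>
    induction z' with
    | zero => simp
    | add x y hx hy =>
      rw [_root_.map_add, mul_add, _root_.map_add, hx, hy, _root_.map_add]
      ring
    | tmul a' b' =>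
      rw [TensorProduct.map_tmul, TensorProduct.map_tmul, Algebra.TensorProduct.tmul_mul_tmul,
        pairing_tmul, pairing_tmul, pairing_tmul, hh.map_augProj_mul, hg.map_augProj_mul, pow_add]
      ring

/-- The bracket of two twisted derivations. -/
theorem IsTwisted.bracket :
    IsTwisted p (Bialgebra.counitAlgHom R A) (r + s) n fun a => hh.pairing hg (commHom R A a) where
  map_algebraMap c := by rw [AlgHom.commutes, hh.pairing_algebraMap hg]
  map_add a b := by rw [_root_.map_add, _root_.map_add]
  map_mul a b := by
    set L := hh.pairing hg with hL
    -- Each factor of `commHom (a * b)` is a scalar plus an element of `I ⊗ I`; multiplying out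
    -- gives the three terms of the twisted rule and a constant that `L` kills. As `S` may have
    -- `p`-torsion, the rule cannot be obtained by dividing by `p^(r+s)`.
    have e : L (commHom R A (a * b)) = L (Bialgebra.counitAlgHom R A a •
          TensorProduct.map (augProj R A) (augProj R A) (commHom R A b) +
        Bialgebra.counitAlgHom R A b •
          TensorProduct.map (augProj R A) (augProj R A) (commHom R A a) +
        TensorProduct.map (augProj R A) (augProj R A) (commHom R A a) *
          TensorProduct.map (augProj R A) (augProj R A) (commHom R A b) +
        algebraMap R _ (Bialgebra.counitAlgHom R A a * Bialgebra.counitAlgHom R A b)) := by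
      congr 1
      rw [_root_.map_mul, Algebra.smul_def, Algebra.smul_def, _root_.map_mul]
      nth_rewrite 1 [commHom_eq a, commHom_eq b]
      ring
    rw [e, _root_.map_add, _root_.map_add, _root_.map_add, hL, hh.pairing_algebraMap hg,
      hh.pairing_smul hg, hh.pairing_smul hg, hh.pairing_map_augProj hg, hh.pairing_map_augProj hg,
      hh.pairing_map_augProj_mul hg, add_zero]

end Pairing

/-! ### Existence of the bracket as a `δ`-map -/

section Existence

open scoped commutatorElement

variable (p : ℕ) [Fact p.Prime] {R : Type w} [CommRing R] [IsDomain R] [FrobeniusRing p R]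

theorem Jet.nabla_frobPow {B : Type u} [CommRing B] [Algebra R B] (n : ℕ) (P : B →ₐ[R] R) (b : B) :
    Jet.nabla p n P (Jet.frobPow p R B n b) = frobIter p n (P b) := by
  have h := DFunLike.congr_fun (Jet.ex_nabla p n P) b
  rw [Jet.ex_apply] at h
  rw [← h, RingEquiv.apply_symm_apply]

theorem pairPt_tmul {B : Type u} [CommRing B] [Algebra R B] {B' : Type v} [CommRing B'] [Algebra R B']
    (P : B →ₐ[R] R) (P' : B' →ₐ[R] R) (b : B) (b' : B') : pairPt P P' (b ⊗ₜ b') = P b * P' b' :=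
  Algebra.TensorProduct.lift_tmul _ _ _ _ _

variable {A : Type u} [CommRing A] [HopfAlgebra R A]

variable (R) in
/-- The function `φ^m y` on the jet space of order `n ≥ m`. -/
def Jet.frobLe {B : Type u} [CommRing B] [Algebra R B] {m n : ℕ} (h : m ≤ n) :
    B →+* Jet p R B n :=
  (Jet.incl p (R := R) (B := B) h).toRingHom.comp (Jet.frobPow p R B m)

theorem Jet.frobLe_algebraMap {B : Type u} [CommRing B] [Algebra R B] {m n : ℕ} (h : m ≤ n)
    (x : R) : Jet.frobLe p R h (algebraMap R B x) = algebraMap R _ (frobIter p m x) := by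
  rw [Jet.frobLe, RingHom.comp_apply, Jet.frobPow_algebraMap, ← frobIter_apply]
  exact (Jet.incl p h).commutes _

theorem Jet.nabla_frobLe {B : Type u} [CommRing B] [Algebra R B] {m n : ℕ} (h : m ≤ n)
    (P : B →ₐ[R] R) (b : B) :
    Jet.nabla p n P (Jet.frobLe p R h b) = frobIter p m (P b) := by
  rw [← Jet.nabla_frobPow, ← Jet.nabla_comp_incl p h]
  rfl

variable (R A) in
-- The first factor is twisted by `φ^s`, which exists on jets of order `max r s`; it thereby gets
-- the same semilinearity `φ^(r+s)` as the second factor, twisted by `φ^r`.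
theorem isTwisted_left (r s : ℕ) : IsTwisted p (Bialgebra.counitAlgHom R A) r (r + s) fun a =>
    Jet.frobLe p R (le_max_right r s) (Lie.xi p R r a ⊗ₜ[R] (1 : Lie p R A s)) :=
  (Lie.isTwisted_xi p r).comp ((Jet.frobLe p R (le_max_right r s)).comp
    (Algebra.TensorProduct.includeLeft (R := R) (S := R) (A := Lie p R A r)
      (B := Lie p R A s)).toRingHom)
    fun x => (congrArg (Jet.frobLe p R (le_max_right r s))
      (Algebra.TensorProduct.includeLeft (R := R) (S := R) (A := Lie p R A r)
      (B := Lie p R A s).commutes x)).trans (Jet.frobLe_algebraMap p _ x)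

variable (R A) in
theorem isTwisted_right (r s : ℕ) : IsTwisted p (Bialgebra.counitAlgHom R A) s (r + s) fun a =>
    Jet.frobLe p R (le_max_left r s) ((1 : Lie p R A r) ⊗ₜ[R] Lie.xi p R s a) := by
  rw [add_comm]
  exact (Lie.isTwisted_xi p s).comp ((Jet.frobLe p R (le_max_left r s)).comp
    (Algebra.TensorProduct.includeRight (R := R) (A := Lie p R A r)
      (B := Lie p R A s)).toRingHom)
    fun x => (congrArg (Jet.frobLe p R (le_max_left r s))
      (Algebra.TensorProduct.includeRight (R := R) (A := Lie p R A r)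
      (B := Lie p R A s).commutes x)).trans (Jet.frobLe_algebraMap p _ x)

theorem LiePt.frobIter_ex_augProj {r : ℕ} (α : LiePt p R A r) (a : A) :
    frobIter p r ((LiePt.ex p α).ofConv (augProj R A a)) = (p : R) ^ r * α (Lie.xi p R r a) := by
  rw [LiePt.frobIter_ex, counit_augProj, map_zero, zero_add, (Lie.isTwisted_xi p r).map_augProj]

variable [IsAdicComplete (Ideal.span {(p : R)}) R]

/-- Existence of the bracket. -/
theorem exists_isDeltaBracket (r s : ℕ) (hr : 1 ≤ r) :
    ∃ F : LieDeltaMap p R A r s, IsDeltaBracket p F := by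
  let hT := (isTwisted_left p R A r s).bracket (isTwisted_right p R A r s)
  -- The bracket takes its values in the uncompleted jet algebra; the outer map is the passage to
  -- the completion.
  refine ⟨(IsScalarTower.toAlgHom R _ _).comp (Lie.lift p (by omega) hT), fun α β => ?_⟩
  change _ = ⁅LiePt.ex p α, LiePt.ex p β⁆
  have happ : ∀ b, LieDeltaMap.app p ((IsScalarTower.toAlgHom R _ _).comp
      (Lie.lift p (by omega) hT)) α β (Lie.xi p R (r + s) b) =
      Jet.nabla p (max r s) (pairPt α β)
        ((isTwisted_left p R A r s).pairing (isTwisted_right p R A r s) (commHom R A b)) := by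
    intro b
    have h1 := JetHat.eval_of p (Jet.nabla p (max r s) (pairPt α β)) (Lie.lift p (by omega) hT
      (Lie.xi p R (r + s) b))
    rw [Lie.lift_xi] at h1
    rw [← h1, ← Lie.lift_xi p (by omega) hT]
    rfl
  -- Applying `φ^(r+s)` clears the inverse Frobenius in both `ex` maps: the first factor becomes
  -- `p^r φ^s(α ξ)` and the second `p^s φ^r(β ξ)`.
  have hpair : ∀ z : A ⊗[R] A, frobIter p (r + s)
      (pairPt (LiePt.ex p α).ofConv (LiePt.ex p β).ofConv
        (TensorProduct.map (augProj R A) (augProj R A) z)) =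
      (p : R) ^ (r + s) * Jet.nabla p (max r s) (pairPt α β)
        ((isTwisted_left p R A r s).pairing (isTwisted_right p R A r s) z) := by
    intro z
    induction z with
    | zero => simp
    | add x y hx hy => simp only [map_add, hx, hy, mul_add]
    | tmul a b =>
      have e1 : frobIter p (r + s) ((LiePt.ex p α).ofConv (augProj R A a)) =
          (p : R) ^ r * frobIter p s (α (Lie.xi p R r a)) := by
        rw [← frobIter_frobIter, LiePt.frobIter_ex_augProj, map_mul, frobIter_natCast_pow]
      have e2 : frobIter p (r + s) ((LiePt.ex p β).ofConv (augProj R A b)) =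
          (p : R) ^ s * frobIter p r (β (Lie.xi p R s b)) := by
        rw [add_comm, ← frobIter_frobIter, LiePt.frobIter_ex_augProj, map_mul, frobIter_natCast_pow]
      rw [TensorProduct.map_tmul, IsTwisted.pairing_tmul, pairPt_tmul,
        map_mul, e1, e2, map_mul (Jet.nabla p (max r s) _), Jet.nabla_frobLe, Jet.nabla_frobLe,
        pairPt_tmul, pairPt_tmul, map_one, map_one, mul_one, one_mul, pow_add]
      ring
  rw [show ⁅LiePt.ex p α, LiePt.ex p β⁆ = _ from
    (pairPt_comp_commHom (LiePt.ex p α).ofConv (LiePt.ex p β).ofConv).symm]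
  refine WithConv.ofConv_injective (AlgHom.ext fun b => (frobIter p (r + s)).injective ?_)
  rw [LiePt.frobIter_ex, happ, ← hpair, WithConv.ofConv_toConv, AlgHom.comp_apply]
  conv_rhs => rw [commHom_eq, map_add, map_add, AlgHom.commutes, add_comm]
  rfl

end Existence

/-! ### Functions on jet spaces are determined by their values on points -/

section Separation

variable (p : ℕ) [Fact p.Prime] {R : Type w} [CommRing R] [IsDomain R] [FrobeniusRing p R]

/-- Subtracting `p`-th powers, which agree to one more power of `p`, and dividing by `p` reduces the
claim to the shifted sequences. -/
theorem dvd_sub_of_ghost {n : ℕ} {c d : ℕ → R}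
    (h : ∀ i ≤ n, (p : R) ^ (i + 1) ∣ ghost p c i - ghost p d i) :
    ∀ i ≤ n, (p : R) ∣ c i - d i := by
  induction n generalizing c d with
  | zero =>
    intro i hi
    obtain rfl : i = 0 := by omega
    simpa [ghost] using h 0 le_rfl
  | succ n ih =>
    intro i hi
    cases i with
    | zero => simpa [ghost] using h 0 (Nat.zero_le _)
    | succ i =>
      refine ih (c := fun k => c (k + 1)) (d := fun k => d (k + 1)) (fun j hj => ?_) i (by omega)
      have h1 := h (j + 1) (by omega)
      have h2 := dvd_pow_p_sub p (h j (by omega))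
      have h3 := dvd_sub h1 h2
      rw [ghost, ghost, show ∀ a b a' b' : R, a + b - (a' + b') - (a - a') = b - b' by
        intros; ring, ← mul_sub, show j + 1 + 1 = (j + 1) + 1 from rfl, pow_succ' (p : R) (j + 1)] at h3
      exact (mul_dvd_mul_iff_left (p_ne_zero p R)).1 h3

/-- The residues of `a, δa, …, δ^n a` can be prescribed independently, so the points `∇a` fill the
reduction modulo `p` of the jet space of affine space. -/
theorem exists_dvd_iterate_delta_sub (n : ℕ) (c : ℕ → R) :
    ∃ a : R, ∀ i ≤ n, (p : R) ∣ (delta p)^[i] a - c i := by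
  -- With this `a` the top components agree exactly. Descending, `ghost_dvd` and the invertibility
  -- of `φ` give agreement of the `i`-th components modulo `p^(i+1)`.
  refine ⟨(frobIter p n).symm (ghost p c n),
    dvd_sub_of_ghost p (c := fun i => (delta p)^[i] _) fun i hi => ?_⟩
  rw [ghost_delta]
  induction hi using Nat.decreasingInduction with
  | self => simp
  | of_succ k hk ih =>
    have h1 := dvd_trans (Dvd.intro _ (pow_succ (p : R) (k + 1)).symm) ih
    have h2 := dvd_add h1 (ghost_dvd p c k)
    rw [sub_add_sub_cancel, show ∀ x : R, frobIter p (k + 1) x = frob p (frobIter p k x) from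
      fun _ => rfl, ← map_sub] at h2
    exact dvd_of_dvd_frobIter p (i := 1) h2

variable {ι : Type u} {k : Type*} [CommRing k] [IsDomain k] [Infinite k]

/-- Modulo `p` the polynomial vanishes at every point over the infinite domain `k`, by
`exists_dvd_iterate_delta_sub`, so all its coefficients are divisible by `p`. One factor is removed
and the argument repeated. -/
theorem dvd_of_dvd_evalDelta (κ : R →+* k) (hκ : Function.Surjective κ)
    (hker : RingHom.ker κ = Ideal.span {(p : R)}) {n m : ℕ} {g : DPoly R ι} (hg : g ∈ upTo R ι n)
    (h : ∀ a : ι → R, (p : R) ^ m ∣ evalDelta p a g) :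
    ∃ g' ∈ upTo R ι n, g = (p : DPoly R ι) ^ m * g' := by
  induction m generalizing g with
  | zero => exact ⟨g, hg, by simp⟩
  | succ m ih =>
    have hmap : MvPolynomial.map κ g = 0 := by
      refine MvPolynomial.funext fun c => ?_
      rw [map_zero]
      have hc : ∀ i, ∃ a : R, ∀ j ≤ n, κ ((delta p)^[j] a) = c (i, j) := by
        intro i
        choose d hd using fun j => hκ (c (i, j))
        obtain ⟨a, ha⟩ := exists_dvd_iterate_delta_sub p n d
        refine ⟨a, fun j hj => ?_⟩
        rw [← hd, ← sub_eq_zero, ← map_sub, ← RingHom.mem_ker, hker, Ideal.mem_span_singleton]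
        exact ha j hj
      choose a ha using hc
      have key : MvPolynomial.eval c (MvPolynomial.map κ g) = κ (evalDelta p a g) := by
        refine upTo_induction (P := fun g => MvPolynomial.eval c (MvPolynomial.map κ g) =
          κ (evalDelta p a g)) ?_ ?_ ?_ ?_ hg
        · intro r; simp [evalDelta]
        · intro i j hj; simp [evalDelta, ha i j hj]
        · intro f g hf hg; simp only [map_add, hf, hg]
        · intro f g hf hg; simp only [map_mul, hf, hg]
      rw [key, ← RingHom.mem_ker, hker, Ideal.mem_span_singleton]
      exact dvd_trans (dvd_pow_self _ (Nat.succ_ne_zero m)) (h a)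
    have hdvd : MvPolynomial.C (p : R) ∣ g := by
      rw [MvPolynomial.C_dvd_iff_dvd_coeff]
      intro i
      rw [← Ideal.mem_span_singleton, ← hker, RingHom.mem_ker, ← MvPolynomial.coeff_map, hmap,
        MvPolynomial.coeff_zero]
    obtain ⟨g', rfl⟩ := hdvd
    have hg' : g' ∈ upTo R ι n := by
      classical
      rw [upTo, MvPolynomial.mem_supported] at hg ⊢
      rwa [MvPolynomial.vars_C_mul _ (p_ne_zero p R)] at hg
    obtain ⟨g'', hg'', rfl⟩ := ih hg' fun a => by
      have := h a
      rw [map_mul, map_natCast, map_natCast, pow_succ'] at this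
      exact (mul_dvd_mul_iff_left (p_ne_zero p R)).1 this
    refine ⟨g'', hg'', ?_⟩
    rw [map_natCast, pow_succ']
    ring

theorem upTo.algHom_ext {n : ℕ} {S : Type v} [CommRing S] [Algebra R S]
    {θ θ' : upTo R ι n →ₐ[R] S}
    (h : ∀ b i (hi : i ≤ n), θ ⟨MvPolynomial.X (b, i), X_mem_upTo hi⟩ =
      θ' ⟨MvPolynomial.X (b, i), X_mem_upTo hi⟩) : θ = θ' := by
  refine AlgHom.adjoin_ext (s := MvPolynomial.X '' {v : ι × ℕ | v.2 ≤ n}) ?_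
  rintro _ ⟨⟨b, i⟩, hi, rfl⟩
  exact h b i hi

variable {B : Type v} [CommRing B] [Algebra R B] {t : ι → B}

theorem upTo.map_iterDelta (t : ι → B) {n i : ℕ} (hi : i ≤ n) (f : MvPolynomial ι R) :
    upTo.map R t n (upTo.iterDelta p hi f) = upTo.iterDelta p hi (MvPolynomial.rename t f) :=
  Subtype.ext ((upTo.coe_map t n _).trans ((dmap_iterate p t i (const f)).trans
    (congrArg (ddelta p)^[i] (dmap_const t f))))

theorem Jet.incl_mk_iterDelta {n i : ℕ} (hi : i ≤ n) (f : MvPolynomial B R) :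
    Jet.incl p hi (Jet.mk p i (upTo.iterDelta p le_rfl f)) =
      Jet.mk p n (upTo.iterDelta p hi f) := by
  rw [Jet.incl, Jet.lift_mk, AlgHom.comp_apply]
  exact congrArg (Jet.mk p n) (Subtype.ext (Subalgebra.coe_inclusion _ _))

theorem Jet.exists_dvd_sub_mk_map
    (ht : ∀ (m : ℕ) (b : B), ∃ (g : MvPolynomial ι R) (c : B),
      b = MvPolynomial.aeval t g + (p : B) ^ m * c) (n m : ℕ) (z : Jet p R B n) :
    ∃ g : upTo R ι n, (p : Jet p R B n) ^ m ∣ z - Jet.mk p n (upTo.map R t n g) := by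
  obtain ⟨⟨z, hz⟩, rfl⟩ := Jet.mk_surjective p n z
  suffices h : ∃ hz : z ∈ upTo R B n, ∃ g : upTo R ι n,
      (p : Jet p R B n) ^ m ∣ Jet.mk p n ⟨z, hz⟩ - Jet.mk p n (upTo.map R t n g) from h.2
  refine upTo_induction (P := fun z => ∃ hz : z ∈ upTo R B n, ∃ g : upTo R ι n,
    (p : Jet p R B n) ^ m ∣ Jet.mk p n ⟨z, hz⟩ - Jet.mk p n (upTo.map R t n g)) ?_ ?_ ?_ ?_ hz
  · intro r
    refine ⟨(upTo R B n).algebraMap_mem r, algebraMap R _ r, ?_⟩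
    rw [AlgHom.commutes, AlgHom.commutes]
    have : Jet.mk p n ⟨MvPolynomial.C r, (upTo R B n).algebraMap_mem r⟩ =
        algebraMap R (Jet p R B n) r := (Jet.mk p n).commutes r
    rw [this, sub_self]
    exact dvd_zero _
  · intro b i hi
    -- The extra `i` powers of `p` compensate the loss under `δ^i`.
    obtain ⟨g, c, hb⟩ := ht (m + i) b
    refine ⟨X_mem_upTo hi, upTo.iterDelta p hi g, ?_⟩
    have h := Jet.dvd_mk_iterDelta_sub p (i := i) (m := m) (f := MvPolynomial.X b)
      (g := MvPolynomial.rename t g) (c := c) (by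
        rw [MvPolynomial.aeval_X, MvPolynomial.aeval_rename]; exact hb)
    have h1 := map_dvd (Jet.incl p hi) h
    rw [map_pow, map_natCast, map_sub, Jet.incl_mk_iterDelta, Jet.incl_mk_iterDelta,
      ← upTo.map_iterDelta, Jet.mk_iterDelta_X] at h1
    exact h1
  · rintro x y ⟨hx, g, hg⟩ ⟨hy, g', hg'⟩
    refine ⟨add_mem hx hy, g + g', ?_⟩
    have e : Jet.mk p n ⟨x + y, add_mem hx hy⟩ = Jet.mk p n ⟨x, hx⟩ + Jet.mk p n ⟨y, hy⟩ := by
      rw [← map_add]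
      exact congrArg (Jet.mk p n) (Subtype.ext (by rw [Subalgebra.coe_add]))
    rw [e, map_add, map_add, add_sub_add_comm]
    exact dvd_add hg hg'
  · rintro x y ⟨hx, g, hg⟩ ⟨hy, g', hg'⟩
    refine ⟨mul_mem hx hy, g * g', ?_⟩
    have e : Jet.mk p n ⟨x * y, mul_mem hx hy⟩ = Jet.mk p n ⟨x, hx⟩ * Jet.mk p n ⟨y, hy⟩ := by
      rw [← map_mul]
      exact congrArg (Jet.mk p n) (Subtype.ext (by rw [Subalgebra.coe_mul]))
    rw [e, map_mul, map_mul, show ∀ a b c d : Jet p R B n, a * b - c * d =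
      a * (b - d) + (a - c) * d by intros; ring]
    exact dvd_add (Dvd.dvd.mul_left hg' _) (Dvd.dvd.mul_right hg _)

variable [IsAdicComplete (Ideal.span {(p : R)}) R]

theorem Jet.nabla_mk_map (P : B →ₐ[R] R) (n : ℕ) (g : upTo R ι n) :
    Jet.nabla p n P (Jet.mk p n (upTo.map R t n g)) =
      evalDelta p (fun i => P (t i)) (g : DPoly R ι) := by
  have : ((Jet.nabla p n P).comp (Jet.mk p n)).comp (upTo.map R t n) =
      (evalDelta p (fun i => P (t i))).comp (upTo R ι n).val := by
    refine upTo.algHom_ext fun b i hi => ?_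
    rw [AlgHom.comp_apply, AlgHom.comp_apply, AlgHom.comp_apply, Subalgebra.val_apply, evalDelta,
      MvPolynomial.aeval_X]
    have e : upTo.map R t n ⟨MvPolynomial.X (b, i), X_mem_upTo hi⟩ =
      ⟨MvPolynomial.X (t b, i), X_mem_upTo hi⟩ :=
        Subtype.ext ((upTo.coe_map t n _).trans (by simp [dmap]))
    rw [e]
    exact Jet.nabla_var p n P (t b) i hi
  exact DFunLike.congr_fun this g

/-- Modulo `p^m` a function on the jet space is a differential polynomial in the `t i`. Since the `t
i` take all values on `R`-points, vanishing at every `∇P` makes this polynomial divisible by `p^m`,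
and `m` is arbitrary. -/
theorem JetHat.ext_of_eval_nabla (κ : R →+* k) (hκ : Function.Surjective κ)
    (hker : RingHom.ker κ = Ideal.span {(p : R)})
    (ht : ∀ (m : ℕ) (b : B), ∃ (g : MvPolynomial ι R) (c : B),
      b = MvPolynomial.aeval t g + (p : B) ^ m * c)
    (hP : ∀ a : ι → R, ∃ P : B →ₐ[R] R, ∀ i, P (t i) = a i) {n : ℕ} {y y' : JetHat p R B n}
    (h : ∀ P, JetHat.eval p (Jet.nabla p n P) y = JetHat.eval p (Jet.nabla p n P) y') :
    y = y' := by
  rw [← sub_eq_zero]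
  set x := y - y' with hx
  have h0 : ∀ P, JetHat.eval p (Jet.nabla p n P) x = 0 := fun P => by
    rw [hx, map_sub, h P, sub_self]
  refine AdicCompletion.ext_evalₐ fun m => ?_
  rw [map_zero]
  obtain ⟨z, hz⟩ := Ideal.Quotient.mk_surjective (AdicCompletion.evalₐ _ m x)
  have hz' : ∀ P, (p : R) ^ m ∣ Jet.nabla p n P z := by
    intro P
    have h1 : Ideal.Quotient.mk (Ideal.span {(p : R)} ^ m) (JetHat.eval p (Jet.nabla p n P) x) = _ :=
      IsAdicComplete.mk_liftAlgHom (Ideal.span {(p : R)}) _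
        (fun hkl => Jet.evalMod_compat p (Jet.nabla p n P) hkl) m x
    rw [h0, map_zero, AlgHom.comp_apply, AlgHom.restrictScalars_apply, ← hz] at h1
    have h2 : Ideal.Quotient.mk (Ideal.span {(p : R)} ^ m) (Jet.nabla p n P z) = 0 := h1.symm
    rwa [Ideal.Quotient.eq_zero_iff_mem, Ideal.span_singleton_pow, Ideal.mem_span_singleton] at h2
  rw [← hz, Ideal.Quotient.eq_zero_iff_mem, Ideal.span_singleton_pow, Ideal.mem_span_singleton]
  obtain ⟨g, z', hg⟩ := Jet.exists_dvd_sub_mk_map p ht n m z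
  obtain ⟨g', hg', e⟩ := dvd_of_dvd_evalDelta p κ hκ hker g.2 (m := m) fun a => by
    obtain ⟨P, hPa⟩ := hP a
    have h1 := Jet.nabla_mk_map p (t := t) P n g
    rw [eq_sub_of_add_eq (add_comm (Jet.mk p n _) _ |>.trans (sub_eq_iff_eq_add.1 hg).symm),
      map_sub, map_mul, map_pow, map_natCast, funext hPa] at h1
    rw [← h1]
    exact dvd_sub (hz' P) (dvd_mul_right _ _)
  have e' : g = (p : upTo R ι n) ^ m * ⟨g', hg'⟩ := Subtype.ext (by
    rw [e, Subalgebra.coe_mul, Subalgebra.coe_pow, upTo.coe_natCast])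
  rw [sub_eq_iff_eq_add.1 hg, e', map_mul, map_pow, map_natCast, map_mul, map_pow, map_natCast]
  exact dvd_add (dvd_mul_right _ _) (dvd_mul_right _ _)

end Separation

/-! ### Coordinates at a point of a smooth scheme -/

section Coord

variable {R : Type w} [CommRing R] {A : Type u} [CommRing A] [Algebra R A]

/-- The elements `t i` are coordinates at the point `ε`, with dual tangent vectors `D i`. -/
structure IsCoordSystem {ι : Type*} [Fintype ι] (ε : A →ₐ[R] R) (t : ι → A) (D : ι → A →ₗ[R] R) :
    Prop where
  map_coord : ∀ i, ε (t i) = 0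
  leibniz : ∀ i a b, D i (a * b) = ε a * D i b + ε b * D i a
  dual_same : ∀ i, D i (t i) = 1
  dual_ne : ∀ i j, i ≠ j → D i (t j) = 0
  sub_mem : ∀ a, ε a = 0 → a - ∑ i, D i a • t i ∈ RingHom.ker ε ^ 2

/-- Smoothness makes the conormal module `I/I²` of the section isomorphic to the pullback of the
differentials, which is free of finite rank because `R` is local. A basis lifts to elements `t i` of
`I`, and the `D i` are its coordinates composed with `d`. -/
theorem exists_isCoordSystem [IsLocalRing R] [Algebra.Smooth R A] (ε : A →ₐ[R] R) :
    ∃ (ι : Type (max u w)) (_ : Fintype ι) (t : ι → A) (D : ι → A →ₗ[R] R), IsCoordSystem ε t D := by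
  let _ : Algebra A R := ε.toRingHom.toAlgebra
  have _ : IsScalarTower R A R := IsScalarTower.of_algebraMap_eq fun r => (ε.commutes r).symm
  have hsurj : Function.Surjective (algebraMap A R) := fun r => ⟨algebraMap R A r, ε.commutes r⟩
  have hsm : ∀ (a : A) (v : R ⊗[A] Ω[A⁄R]), a • v = ε a • v := fun a v =>
    (algebraMap_smul R a v).symm
  obtain ⟨l, hl⟩ := (Algebra.FormallySmooth.iff_split_injection (R := R) (P := A) (A := R) hsurj).1
    inferInstance
  have hinj : Function.Injective (KaehlerDifferential.kerCotangentToTensor R A R) :=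
    Function.LeftInverse.injective (g := l) fun x => LinearMap.congr_fun hl x
  -- In the conormal sequence of the surjection `A → R` the next term is the module of differentials
  -- of `R` over `R`, which is zero.
  have hsurj' : Function.Surjective (KaehlerDifferential.kerCotangentToTensor R A R) := by
    intro v
    refine (KaehlerDifferential.exact_kerCotangentToTensor_mapBaseChange R A R hsurj v).1 ?_
    have : Subsingleton (Ω[R⁄R]) := KaehlerDifferential.subsingleton_of_surjective R R
      Function.surjective_id
    exact Subsingleton.elim _ _
  have : Module.Free R (R ⊗[A] Ω[A⁄R]) := Module.free_of_flat_of_isLocalRing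
  let b := Module.Free.chooseBasis R (R ⊗[A] Ω[A⁄R])
  have hδ : ∀ v : R ⊗[A] Ω[A⁄R], ∃ a : A, ε a = 0 ∧ (1 : R) ⊗ₜ[A] KaehlerDifferential.D R A a = v := by
    intro v
    obtain ⟨x, rfl⟩ := hsurj' v
    obtain ⟨y, rfl⟩ := Ideal.toCotangent_surjective _ x
    exact ⟨y, y.2, rfl⟩
  choose t ht using fun i => hδ (b i)
  let δ : A →ₗ[R] R ⊗[A] Ω[A⁄R] :=
    { toFun := fun a => (1 : R) ⊗ₜ[A] KaehlerDifferential.D R A a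
      map_add' := fun x y => by rw [map_add, TensorProduct.tmul_add]
      map_smul' := fun r x => by
        rw [Derivation.map_smul, RingHom.id_apply, ← algebraMap_smul A r (KaehlerDifferential.D R A x),
          TensorProduct.tmul_smul, hsm, AlgHom.commutes]
        rfl }
  have hδmul : ∀ x y, δ (x * y) = ε x • δ y + ε y • δ x := by
    intro x y
    change (1 : R) ⊗ₜ[A] KaehlerDifferential.D R A (x * y) = _
    rw [Derivation.leibniz, TensorProduct.tmul_add, TensorProduct.tmul_smul, TensorProduct.tmul_smul,
      hsm, hsm]
    rfl
  have hδt : ∀ i, δ (t i) = b i := fun i => (ht i).2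
  refine ⟨Module.Free.ChooseBasisIndex R (R ⊗[A] Ω[A⁄R]), inferInstance, t,
    fun i => (b.coord i).comp δ, ⟨fun i => (ht i).1, ?_, ?_, ?_, ?_⟩⟩
  · intro i x y
    rw [LinearMap.comp_apply, hδmul, map_add, map_smul, map_smul]
    rfl
  · intro i
    simp [hδt]
  · intro i j hij
    simp [hδt, hij.symm]
  · intro a ha
    have hmem : a - ∑ i, b.coord i (δ a) • t i ∈ RingHom.ker ε := by
      rw [RingHom.mem_ker, map_sub, ha, map_sum, zero_sub, neg_eq_zero]
      exact Finset.sum_eq_zero fun i _ => by rw [map_smul, (ht i).1, smul_zero]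
    refine (Ideal.toCotangent_eq_zero _ (⟨_, hmem⟩ : RingHom.ker (algebraMap A R))).1 (hinj ?_)
    rw [map_zero]
    change δ (a - ∑ i, b.coord i (δ a) • t i) = 0
    rw [map_sub, map_sum]
    simp only [map_smul, hδt, Module.Basis.coord_apply, b.sum_repr, sub_self]

variable {ι : Type*} [Fintype ι] {ε : A →ₐ[R] R} {t : ι → A} {D : ι → A →ₗ[R] R}

/-- Formal smoothness gives some lift. Its values at the `t i` are off by multiples of `q^k`, and
this error is removed along the tangent vectors `D i`. -/
theorem IsCoordSystem.exists_lift (h : IsCoordSystem ε t D) [Algebra.FormallySmooth R A] (q : R)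
    (c : ι → R) {k : ℕ} (hk : 1 ≤ k) (Q : A →ₐ[R] R ⧸ Ideal.span {q} ^ k)
    (hQ : ∀ i, Q (t i) = Ideal.Quotient.mk _ (c i))
    (hQε : ∀ a, Ideal.Quotient.factorₐ R (Ideal.pow_le_pow_right hk) (Q a) =
      Ideal.Quotient.mk (Ideal.span {q} ^ 1) (ε a)) :
    ∃ Q' : A →ₐ[R] R ⧸ Ideal.span {q} ^ (k + 1),
      (Ideal.Quotient.factorₐ R (Ideal.pow_le_pow_right (Nat.le_add_right k 1))).comp Q' = Q ∧
      ∀ i, Q' (t i) = Ideal.Quotient.mk _ (c i) := by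
  classical
  set g := Ideal.Quotient.factorₐ R
    (Ideal.pow_le_pow_right (I := Ideal.span {q}) (Nat.le_add_right k 1)) with hg
  have hgmk : ∀ x : R, g (Ideal.Quotient.mk _ x) = Ideal.Quotient.mk _ x := fun x => rfl
  have hmem : ∀ (n : ℕ) (x : R), Ideal.Quotient.mk (Ideal.span {q} ^ n) x = 0 ↔ q ^ n ∣ x := by
    intro n x
    rw [Ideal.Quotient.eq_zero_iff_mem, Ideal.span_singleton_pow, Ideal.mem_span_singleton]
  have hker : ∀ y, g y = 0 → ∃ e : R, y = Ideal.Quotient.mk _ (q ^ k * e) := by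
    intro y hy
    obtain ⟨y, rfl⟩ := Ideal.Quotient.mk_surjective y
    rw [hgmk, hmem] at hy
    obtain ⟨e, rfl⟩ := hy
    exact ⟨e, rfl⟩
  have hsurj : Function.Surjective g := fun y => by
    obtain ⟨y, rfl⟩ := Ideal.Quotient.mk_surjective y
    exact ⟨Ideal.Quotient.mk _ y, rfl⟩
  have hnil : IsNilpotent (RingHom.ker (g : (R ⧸ Ideal.span {q} ^ (k + 1)) →+* (R ⧸ Ideal.span {q} ^ k))) := by
    refine ⟨2, ?_⟩
    rw [pow_two, Ideal.zero_eq_bot, eq_bot_iff, Ideal.mul_le]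
    intro x hx y hy
    obtain ⟨e, rfl⟩ := hker x hx
    obtain ⟨e', rfl⟩ := hker y hy
    rw [Ideal.mem_bot, ← map_mul, hmem]
    exact dvd_trans (pow_dvd_pow q (show k + 1 ≤ k + k by omega)) ⟨e * e', by ring⟩
  let Q₀ := Algebra.FormallySmooth.liftOfSurjective Q g hsurj hnil
  have hQ₀ : ∀ a, g (Q₀ a) = Q a := Algebra.FormallySmooth.liftOfSurjective_apply Q g hsurj hnil
  have he : ∀ i, ∃ e : R, Q₀ (t i) = Ideal.Quotient.mk _ (c i) + Ideal.Quotient.mk _ (q ^ k * e) := by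
    intro i
    obtain ⟨e, he⟩ := hker (Q₀ (t i) - Ideal.Quotient.mk _ (c i)) (by
      rw [map_sub, hQ₀, hQ, hgmk, sub_self])
    exact ⟨e, by rw [← he]; ring⟩
  choose e he using he
  let X : A →ₗ[R] R := ∑ i, e i • D i
  have hX : ∀ a b, X (a * b) = ε a * X b + ε b * X a := by
    intro a b
    simp only [X, LinearMap.sum_apply, LinearMap.smul_apply, h.leibniz, smul_eq_mul,
      Finset.mul_sum, ← Finset.sum_add_distrib]
    exact Finset.sum_congr rfl fun i _ => by ring
  have hXt : ∀ i, X (t i) = e i := by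
    intro i
    simp only [X, LinearMap.sum_apply, LinearMap.smul_apply, smul_eq_mul]
    rw [Finset.sum_eq_single i (fun j _ hj => by rw [h.dual_ne j i hj, mul_zero])
      (fun hi => absurd (Finset.mem_univ i) hi), h.dual_same, mul_one]
  have hX1 : X 1 = 0 := by
    have := hX 1 1
    rw [mul_one, map_one ε, one_mul] at this
    exact (left_eq_add.1 this)
  have hqε : ∀ a, ∃ x : R, Q₀ a = Ideal.Quotient.mk _ (ε a + q * x) := by
    intro a
    obtain ⟨y, hy⟩ := Ideal.Quotient.mk_surjective (Q₀ a)
    have h1 := hQε a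
    rw [← hQ₀, ← hy, hgmk] at h1
    obtain ⟨x, hx⟩ := (hmem 1 (y - ε a)).1 (by rw [map_sub, ← h1, sub_eq_zero]; rfl)
    refine ⟨x, ?_⟩
    rw [← hy, eq_add_of_sub_eq' hx, pow_one]
  -- Subtracting `q^k X` preserves multiplicativity: `X` is a derivation at `ε`, the lift agrees
  -- with `ε` modulo `q`, and `q^(2k)` vanishes since `k ≥ 1`.
  let Q' : A →ₐ[R] R ⧸ Ideal.span {q} ^ (k + 1) := AlgHom.ofLinearMap
    (Q₀.toLinearMap - (Algebra.linearMap R _).comp (q ^ k • X))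
    (by
      rw [LinearMap.sub_apply, LinearMap.comp_apply, LinearMap.smul_apply, hX1, smul_zero, map_zero,
        sub_zero]
      exact map_one Q₀)
    (by
      intro a b
      obtain ⟨x, hx⟩ := hqε a
      obtain ⟨y, hy⟩ := hqε b
      have hgoal : Q₀ (a * b) - Ideal.Quotient.mk _ (q ^ k * X (a * b)) =
          (Q₀ a - Ideal.Quotient.mk _ (q ^ k * X a)) *
            (Q₀ b - Ideal.Quotient.mk _ (q ^ k * X b)) := by
        rw [map_mul, hx, hy, ← map_mul, ← map_sub, ← map_sub, ← map_sub, ← map_mul, ← sub_eq_zero,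
          ← map_sub, hmem, hX]
        obtain ⟨k, rfl⟩ := Nat.exists_eq_add_of_le' hk
        refine ⟨x * X b + y * X a - q ^ k * X a * X b, ?_⟩
        ring
      exact hgoal)
  have hQ'a : ∀ a, Q' a = Q₀ a - Ideal.Quotient.mk _ (q ^ k * X a) := fun a => rfl
  refine ⟨Q', AlgHom.ext fun a => ?_, fun i => ?_⟩
  · rw [AlgHom.comp_apply, hQ'a, map_sub, hQ₀, hgmk, (hmem k _).2 (dvd_mul_right _ _), sub_zero]
  · rw [hQ'a, he, hXt, add_sub_cancel_right]

/-- Successive lifting as in Hensel's lemma. It starts with `ε` modulo `q^r`, which already has the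
required values at the `t i`, since these are divisible by `q^r`. -/
theorem IsCoordSystem.exists_algHom (h : IsCoordSystem ε t D) [Algebra.FormallySmooth R A] (q : R)
    [IsAdicComplete (Ideal.span {q}) R] (c : ι → R) {r : ℕ} (hr : 1 ≤ r) (hc : ∀ i, q ^ r ∣ c i) :
    ∃ P : A →ₐ[R] R, (∀ i, P (t i) = c i) ∧ ∀ a, q ^ r ∣ P a - ε a := by
  have hmem : ∀ (n : ℕ) (x : R), Ideal.Quotient.mk (Ideal.span {q} ^ n) x = 0 ↔ q ^ n ∣ x := by
    intro n x
    rw [Ideal.Quotient.eq_zero_iff_mem, Ideal.span_singleton_pow, Ideal.mem_span_singleton]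
  let T (n : ℕ) : Type _ := {Q : A →ₐ[R] R ⧸ Ideal.span {q} ^ (r + n) //
    (∀ i, Q (t i) = Ideal.Quotient.mk _ (c i)) ∧
    ∀ a, Ideal.Quotient.factorₐ R (Ideal.pow_le_pow_right (hr.trans (Nat.le_add_right r n))) (Q a) =
      Ideal.Quotient.mk (Ideal.span {q} ^ 1) (ε a)}
  have hT : ∀ n (Q : T n), ∃ Q' : T (n + 1),
      (Ideal.Quotient.factorₐ R (Ideal.pow_le_pow_right (Nat.le_add_right (r + n) 1))).comp Q'.1 =
        Q.1 := by
    rintro n ⟨Q, hQ, hQε⟩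
    obtain ⟨Q', h1, h2⟩ := h.exists_lift q c (hr.trans (Nat.le_add_right r n)) Q hQ hQε
    refine ⟨⟨Q', h2, fun a => ?_⟩, h1⟩
    rw [← hQε, ← h1, AlgHom.comp_apply]
    obtain ⟨y, hy⟩ := Ideal.Quotient.mk_surjective (Q' a)
    rw [← hy]
    rfl
  choose next hnext using hT
  let Q₀ : T 0 := ⟨(Ideal.Quotient.mkₐ R _).comp ε, fun i => by
    rw [AlgHom.comp_apply, h.map_coord, map_zero]; exact ((hmem (r + 0) (c i)).2 (hc i)).symm, fun a => rfl⟩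
  let Q (n : ℕ) : T n := Nat.rec Q₀ next n
  -- The `n`-th lift lives modulo `q^(r+n)`; truncation to `q^n` fits it to the indexing of the
  -- limit.
  let f (n : ℕ) : A →ₐ[R] R ⧸ Ideal.span {q} ^ n :=
    (Ideal.Quotient.factorₐ R (Ideal.pow_le_pow_right (Nat.le_add_left n r))).comp (Q n).1
  have hQf : ∀ (m n : ℕ) (hmn : m ≤ r + n), m ≤ n → ∀ a,
      Ideal.Quotient.factorₐ R (Ideal.pow_le_pow_right hmn) ((Q n).1 a) = f m a := by
    intro m n hmn hle a
    induction n, hle using Nat.le_induction with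
    | base => rfl
    | succ n hle ih =>
      rw [← ih (by omega)]
      have := DFunLike.congr_fun (hnext n (Q n)) a
      rw [← this, AlgHom.comp_apply]
      change _ = Ideal.Quotient.factorₐ R _ (Ideal.Quotient.factorₐ R _ ((Q (n + 1)).1 a))
      obtain ⟨y, hy⟩ := Ideal.Quotient.mk_surjective ((Q (n + 1)).1 a)
      rw [← hy]
      rfl
  have hf : ∀ {m n : ℕ} (hle : m ≤ n),
      (Ideal.Quotient.factorₐ R (Ideal.pow_le_pow_right hle)).comp (f n) = f m := by
    intro m n hle
    refine AlgHom.ext fun a => ?_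
    rw [← hQf m n (by omega) hle, AlgHom.comp_apply, AlgHom.comp_apply]
    obtain ⟨y, hy⟩ := Ideal.Quotient.mk_surjective ((Q n).1 a)
    rw [← hy]
    rfl
  have hQ0 : ∀ n a, Ideal.Quotient.factorₐ R (Ideal.pow_le_pow_right (Nat.le_add_right r n))
      ((Q n).1 a) = Ideal.Quotient.mk (Ideal.span {q} ^ r) (ε a) := by
    intro n a
    induction n with
    | zero => rfl
    | succ n ih =>
      rw [← ih]
      have := DFunLike.congr_fun (hnext n (Q n)) a
      rw [← this, AlgHom.comp_apply]
      change _ = Ideal.Quotient.factorₐ R _ (Ideal.Quotient.factorₐ R _ ((Q (n + 1)).1 a))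
      obtain ⟨y, hy⟩ := Ideal.Quotient.mk_surjective ((Q (n + 1)).1 a)
      rw [← hy]
      rfl
  have hP := IsAdicComplete.mk_liftAlgHom (Ideal.span {q}) f hf
  refine ⟨IsAdicComplete.liftAlgHom (Ideal.span {q}) f hf, fun i => ?_, fun a => ?_⟩
  · refine IsHausdorff.eq_iff_smodEq (I := Ideal.span {q}) |>.2 fun k => ?_
    rw [smul_eq_mul, Ideal.mul_top, SModEq]
    refine (hP k _).trans ?_
    change Ideal.Quotient.factorₐ R (Ideal.pow_le_pow_right (Nat.le_add_left k r)) ((Q k).1 (t i)) = _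
    rw [(Q k).2.1]
    rfl
  · rw [← hmem, map_sub, sub_eq_zero]
    refine (hP r a).trans ?_
    exact hQ0 r a

end Coord

/-! ### Coordinates on `L_δ^r(G)` -/

section Generation

variable (p : ℕ) {R : Type w} [CommRing R]

/-- The elements `t i` generate the algebra `B` modulo `p`. -/
def GeneratesMod {B : Type u} [CommRing B] [Algebra R B] {ι : Type v} (t : ι → B) : Prop :=
  ∀ b, Ideal.Quotient.mk (Ideal.span {(p : B)}) b ∈
    ((Ideal.Quotient.mkₐ R (Ideal.span {(p : B)})).comp (MvPolynomial.aeval t)).range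

/-- Generation modulo `p` is applied again to each remainder, as in a `p`-adic expansion. -/
theorem GeneratesMod.exists_aeval_add {B : Type u} [CommRing B] [Algebra R B] {ι : Type v}
    {t : ι → B} (h : GeneratesMod p (R := R) t) (m : ℕ) (b : B) :
    ∃ (g : MvPolynomial ι R) (c : B), b = MvPolynomial.aeval t g + (p : B) ^ m * c := by
  induction m with
  | zero => exact ⟨0, b, by simp⟩
  | succ m ih =>
    obtain ⟨g, c, hb⟩ := ih
    obtain ⟨g', hg'⟩ := h c
    obtain ⟨c', hc'⟩ := Ideal.mem_span_singleton.1 (Ideal.Quotient.eq.1 hg'.symm)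
    refine ⟨g + (p : MvPolynomial ι R) ^ m * g', c', ?_⟩
    rw [map_add, map_mul, map_pow, map_natCast, hb, pow_succ]
    have : c = MvPolynomial.aeval t g' + p * c' := eq_add_of_sub_eq' hc'
    rw [this]
    ring

theorem GeneratesMod.tmul {B : Type u} [CommRing B] [Algebra R B] {C : Type v} [CommRing C]
    [Algebra R C] {ι κ : Type*} {t : ι → B} {s : κ → C} (ht : GeneratesMod p (R := R) t)
    (hs : GeneratesMod p (R := R) s) :
    GeneratesMod p (R := R)
      (Sum.elim (fun i => t i ⊗ₜ[R] (1 : C)) (fun j => (1 : B) ⊗ₜ[R] s j)) := by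
  intro y
  induction y with
  | zero => rw [map_zero]; exact zero_mem _
  | add x y hx hy => rw [map_add]; exact add_mem hx hy
  | tmul b c =>
    obtain ⟨g, b', rfl⟩ := ht.exists_aeval_add p 1 b
    obtain ⟨g', c', rfl⟩ := hs.exists_aeval_add p 1 c
    refine ⟨MvPolynomial.rename Sum.inl g * MvPolynomial.rename Sum.inr g', ?_⟩
    have e1 : MvPolynomial.aeval (Sum.elim (fun i => t i ⊗ₜ[R] (1 : C))
        (fun j => (1 : B) ⊗ₜ[R] s j)) (MvPolynomial.rename Sum.inl g) =
          MvPolynomial.aeval t g ⊗ₜ[R] (1 : C) := by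
      rw [MvPolynomial.aeval_rename]
      exact (MvPolynomial.comp_aeval_apply t
        (Algebra.TensorProduct.includeLeft (R := R) (S := R) (B := C)) g).symm
    have e2 : MvPolynomial.aeval (Sum.elim (fun i => t i ⊗ₜ[R] (1 : C))
        (fun j => (1 : B) ⊗ₜ[R] s j)) (MvPolynomial.rename Sum.inr g') =
          (1 : B) ⊗ₜ[R] MvPolynomial.aeval s g' := by
      rw [MvPolynomial.aeval_rename]
      exact (MvPolynomial.comp_aeval_apply s
        (Algebra.TensorProduct.includeRight (R := R) (A := B)) g').symm
    have ep : ∀ (x : B) (y : C), ((p : B) * x) ⊗ₜ[R] y = (p : B ⊗[R] C) * x ⊗ₜ y := by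
      intro x y
      rw [← nsmul_eq_mul, ← nsmul_eq_mul, TensorProduct.smul_tmul']
    have ep' : ∀ (x : B) (y : C), x ⊗ₜ[R] ((p : C) * y) = (p : B ⊗[R] C) * x ⊗ₜ y := by
      intro x y
      rw [← nsmul_eq_mul, ← nsmul_eq_mul, TensorProduct.tmul_smul]
    change Ideal.Quotient.mk _ (MvPolynomial.aeval _ _) = _
    rw [map_mul, e1, e2, Algebra.TensorProduct.tmul_mul_tmul, mul_one, one_mul, Ideal.Quotient.eq,
      Ideal.mem_span_singleton, pow_one, pow_one, TensorProduct.add_tmul, TensorProduct.tmul_add,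
      ep, ep', add_assoc, ← mul_add, sub_add_cancel_left]
    exact (dvd_mul_right _ _).neg_right

end Generation

/-! ### The functions `ξ(t_i)` as coordinates on `L_δ^r(G)`; uniqueness of `δ`-maps -/

section LieCoord

variable (p : ℕ) [Fact p.Prime] {R : Type w} [CommRing R] [IsDomain R] [FrobeniusRing p R]
  {A : Type u} [CommRing A] [HopfAlgebra R A] {ι : Type*} [Fintype ι] {t : ι → A}
  {D : ι → A →ₗ[R] R}

/-- For `r ≥ 1` the quadratic term of the twisted rule dies modulo `p`, so there `ξ` kills `I²` as
well as constants and depends only on the class in `I/I²`, which the `t i` span. -/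
theorem Lie.generatesMod_xi (h : IsCoordSystem (Bialgebra.counitAlgHom R A) t D) {r : ℕ}
    (hr : 1 ≤ r) : GeneratesMod p (R := R) fun i => Lie.xi p R r (t i) := by
  have hT := Lie.isTwisted_xi p (R := R) (A := A) r
  set I : Ideal (Lie p R A r) := Ideal.span {(p : Lie p R A r)} with hI
  set ε := Bialgebra.counitAlgHom R A with hε
  have hpI : ∀ x : Lie p R A r, Ideal.Quotient.mk I ((p : Lie p R A r) ^ r * x) = 0 := by
    intro x
    rw [Ideal.Quotient.eq_zero_iff_mem, hI, Ideal.mem_span_singleton]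
    exact (dvd_pow_self _ (by omega)).mul_right x
  have hsq : ∀ b ∈ RingHom.ker ε ^ 2, Ideal.Quotient.mk I (Lie.xi p R r b) = 0 := by
    intro b hb
    rw [pow_two] at hb
    induction hb using Submodule.mul_induction_on' with
    | mem_mul_mem x hx y hy =>
      rw [hT.map_mul, show ε x = 0 from hx, show ε y = 0 from hy,
        map_zero, map_zero, zero_mul, zero_mul, zero_add, zero_add, mul_assoc, hpI]
    | add x _ y _ hx hy => rw [hT.map_add, map_add, hx, hy, add_zero]
  have hsum : ∀ (s : Finset ι) (f : ι → A),
      Lie.xi p R r (∑ i ∈ s, f i) = ∑ i ∈ s, Lie.xi p R r (f i) := by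
    intro s f
    classical
    induction s using Finset.induction_on with
    | empty => simpa using hT.map_zero
    | insert i s hi ih => rw [Finset.sum_insert hi, Finset.sum_insert hi, hT.map_add, ih]
  have hxi : ∀ b, Ideal.Quotient.mk I (Lie.xi p R r b) ∈
      ((Ideal.Quotient.mkₐ R I).comp (MvPolynomial.aeval fun i => Lie.xi p R r (t i))).range := by
    intro b
    have h0 := h.sub_mem (b - algebraMap R A (ε b)) (by
      rw [map_sub, AlgHom.commutes]; exact sub_self _)
    have h1 := hsq _ h0
    rw [hT.map_sub, hT.map_sub, hT.map_algebraMap, sub_zero, hsum, map_sub, sub_eq_zero] at h1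
    rw [h1, map_sum]
    refine sum_mem fun i _ => ?_
    rw [hT.map_smul]
    refine ⟨MvPolynomial.C (frobIter p r (D i (b - algebraMap R A (ε b)))) * MvPolynomial.X i, ?_⟩
    change Ideal.Quotient.mk I (MvPolynomial.aeval _ _) = _
    rw [map_mul, MvPolynomial.aeval_C, MvPolynomial.aeval_X]
  intro y
  obtain ⟨z, rfl⟩ := Lie.mk_surjective p r y
  obtain ⟨g, rfl⟩ := Jet.mk_surjective p r z
  rw [Lie.mk_mk]
  induction perturb p (Bialgebra.counitAlgHom R A) r (g : DPoly R A) using MvPolynomial.induction_on with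
  | C a =>
    rw [MvPolynomial.aeval_C]
    exact Subalgebra.algebraMap_mem _ a
  | add f g hf hg => rw [map_add, map_add]; exact add_mem hf hg
  | mul_X f b hf =>
    rw [map_mul, map_mul, MvPolynomial.aeval_X]
    exact mul_mem hf (hxi b)

variable [IsAdicComplete (Ideal.span {(p : R)}) R]

theorem LiePt.exists_apply_xi_eq [Algebra.FormallySmooth R A]
    (h : IsCoordSystem (Bialgebra.counitAlgHom R A) t D) {r : ℕ}
    (hr : 1 ≤ r) (a : ι → R) : ∃ α : LiePt p R A r, ∀ i, α (Lie.xi p R r (t i)) = a i := by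
  obtain ⟨P, hP, hPε⟩ := h.exists_algHom (p : R)
    (fun i => (p : R) ^ r * (frobIter p r).symm (a i)) hr fun i => dvd_mul_right _ _
  obtain ⟨α, hα⟩ := LiePt.exists_ex_eq p hr P hPε
  refine ⟨α, fun i => ?_⟩
  have h1 := LiePt.ex_sub p α (t i)
  rw [hα, WithConv.ofConv_toConv, hP, h.map_coord, sub_zero] at h1
  exact (frobIter p r).symm.injective
    (mul_left_cancel₀ (pow_ne_zero r (p_ne_zero p R)) h1).symm

/-- The coordinates `ξ(t_i)` of both factors together satisfy the hypotheses of
`JetHat.ext_of_eval_nabla`, and every point of the product is a pair. -/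
theorem LieDeltaMap.ext_of_app [IsLocalRing R] [Algebra.Smooth R A] {k : Type*} [CommRing k]
    [IsDomain k] [Infinite k] (κ : R →+* k) (hκ : Function.Surjective κ)
    (hker : RingHom.ker κ = Ideal.span {(p : R)}) {r s : ℕ} (hr : 1 ≤ r) (hs : 1 ≤ s)
    {F F' : LieDeltaMap p R A r s}
    (hF : ∀ α β, LieDeltaMap.app p F α β = LieDeltaMap.app p F' α β) : F = F' := by
  obtain ⟨ι, _, t, D, h⟩ := exists_isCoordSystem (Bialgebra.counitAlgHom R A)
  refine AlgHom.ext fun y => ?_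
  refine JetHat.ext_of_eval_nabla p κ hκ hker
    (((Lie.generatesMod_xi p h hr).tmul p (Lie.generatesMod_xi p h hs)).exists_aeval_add p)
    (fun a => ?_) fun P => ?_
  · obtain ⟨α, hα⟩ := LiePt.exists_apply_xi_eq p h hr fun i => a (Sum.inl i)
    obtain ⟨β, hβ⟩ := LiePt.exists_apply_xi_eq p h hs fun i => a (Sum.inr i)
    refine ⟨pairPt α β, ?_⟩
    rintro (i | i)
    · rw [Sum.elim_inl, pairPt_tmul, map_one, mul_one, hα]
    · rw [Sum.elim_inr, pairPt_tmul, map_one, one_mul, hβ]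
  · have hP : P = pairPt (P.comp Algebra.TensorProduct.includeLeft)
        (P.comp Algebra.TensorProduct.includeRight) := by
      refine Algebra.TensorProduct.ext' fun b c => ?_
      rw [pairPt_tmul, AlgHom.comp_apply, AlgHom.comp_apply, ← map_mul]
      simp
    rw [hP]
    exact DFunLike.congr_fun (hF _ _) y

end LieCoord

/-! ### Matrices of points of linear groups -/

section PointMatrix

variable {R : Type w} [CommRing R] {A : Type u} [CommRing A] [HopfAlgebra R A] {n : ℕ}

variable (R n) in
/-- The matrix of an `R`-point of `GL_n`. -/
def GLRing.pointMatrix : WithConv (GLRing n R →ₐ[R] R) →* Matrix (Fin n) (Fin n) R where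
  toFun P := (GLRing.gen n R).map P.ofConv
  map_one' := GLRing.map_counit n R (AlgHom.id R R)
  map_mul' P Q := by
    refine Eq.trans (congrArg _ (funext fun c => ?_)) (GLRing.map_comul_lift n R)
    exact AlgHom.convMul_apply _ _ c

/-- The matrix of the image in `GL_n` of an `R`-point of a group scheme. -/
def pointMatrix (f : GLRing n R →ₐc[R] A) : WithConv (A →ₐ[R] R) →* Matrix (Fin n) (Fin n) R :=
  (GLRing.pointMatrix R n).comp (compBialgHom f R)

theorem pointMatrix_apply (f : GLRing n R →ₐc[R] A) (P : WithConv (A →ₐ[R] R)) (i j : Fin n) :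
    pointMatrix f P i j = P.ofConv (f (GLRing.gen n R i j)) := rfl

theorem GLRing.counit_gen (i j : Fin n) :
    Bialgebra.counitAlgHom R (GLRing n R) (GLRing.gen n R i j) = (1 : Matrix (Fin n) (Fin n) R) i j :=
  congrFun (congrFun (GLRing.map_counit n R (AlgHom.id R R)) i) j

theorem counit_map_gen (f : GLRing n R →ₐc[R] A) (i j : Fin n) :
    Bialgebra.counitAlgHom R A (f (GLRing.gen n R i j)) = (1 : Matrix (Fin n) (Fin n) R) i j :=
  (DFunLike.congr_fun (BialgHom.counitAlgHom_comp f) (GLRing.gen n R i j)).trans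
    (GLRing.counit_gen i j)

end PointMatrix

/-! ### The matrix `a` in `ex^r(α) = 1 + p^r a`, and the bracket in terms of it -/

section LinearPart

variable (p : ℕ) [Fact p.Prime] {R : Type w} [CommRing R] [IsDomain R] [FrobeniusRing p R]
  {A : Type u} [CommRing A] [HopfAlgebra R A] {n : ℕ} (f : GLRing n R →ₐc[R] A)

/-- The matrix `a` such that `1 + p^r a` is the matrix of `ex^r(α)`. -/
def LiePt.linearPart {r : ℕ} (α : LiePt p R A r) : Matrix (Fin n) (Fin n) R :=
  Matrix.of fun i j => (frobIter p r).symm (α (Lie.xi p R r (f (GLRing.gen n R i j))))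

theorem LiePt.pointMatrix_ex {r : ℕ} (α : LiePt p R A r) :
    pointMatrix f (LiePt.ex p α) = 1 + (p : R) ^ r • LiePt.linearPart p f α := by
  ext i j
  rw [pointMatrix_apply, eq_add_of_sub_eq' (LiePt.ex_sub p α _), counit_map_gen]
  rfl

/-- The reduction modulo `p^m` of `LiePt.linearPart`. -/
def LiePt.linearPartMod {r : ℕ} (m : ℕ) (α : LiePt p R A r) :
    Matrix (Fin n) (Fin n) (R ⧸ Ideal.span {(p : R) ^ m}) :=
  (Ideal.Quotient.mk _).mapMatrix (LiePt.linearPart p f α)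

theorem LiePt.linearPartMod_eq_iff {r m : ℕ} (α β : LiePt p R A r) :
    LiePt.linearPartMod p f m α = LiePt.linearPartMod p f m β ↔
      ∀ i j, (p : R) ^ m ∣ LiePt.linearPart p f α i j - LiePt.linearPart p f β i j := by
  simp only [← Matrix.ext_iff, ← Ideal.mem_span_singleton, ← Ideal.Quotient.eq]
  rfl

variable {f}

/-- A point of a closed subgroup of `GL_n` is determined modulo any power of `p` by its matrix. This
turns the congruences into matrix identities. -/
theorem LiePt.modEq_iff_linearPartMod (hf : Function.Surjective f) {r m : ℕ} (α β : LiePt p R A r) :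
    LiePt.ModEq p m α β ↔ LiePt.linearPartMod p f m α = LiePt.linearPartMod p f m β := by
  rw [LiePt.modEq_iff, LiePt.linearPartMod_eq_iff]
  have key : ∀ i j, (LiePt.ex p α).ofConv (f (GLRing.gen n R i j)) -
      (LiePt.ex p β).ofConv (f (GLRing.gen n R i j)) =
        (p : R) ^ r * (LiePt.linearPart p f α i j - LiePt.linearPart p f β i j) := by
    intro i j
    rw [← pointMatrix_apply, ← pointMatrix_apply, LiePt.pointMatrix_ex, LiePt.pointMatrix_ex]
    simp only [Matrix.add_apply, Matrix.smul_apply, smul_eq_mul]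
    ring
  constructor
  · intro h i j
    have h1 := h (f (GLRing.gen n R i j))
    rw [key, pow_add] at h1
    exact (mul_dvd_mul_iff_left (pow_ne_zero r (p_ne_zero p R))).1 h1
  · intro h
    have e : ((Ideal.Quotient.mkₐ R (Ideal.span {(p : R) ^ (r + m)})).comp
        (LiePt.ex p α).ofConv).comp (f : GLRing n R →ₐ[R] A) =
        ((Ideal.Quotient.mkₐ R (Ideal.span {(p : R) ^ (r + m)})).comp
        (LiePt.ex p β).ofConv).comp (f : GLRing n R →ₐ[R] A) := by
      refine GLRing.algHom_ext (Matrix.ext fun i j => ?_)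
      refine Ideal.Quotient.eq.2 (Ideal.mem_span_singleton.2 ?_)
      have h1 := mul_dvd_mul_left ((p : R) ^ r) (h i j)
      rw [← pow_add, ← key] at h1
      exact h1
    intro b
    obtain ⟨x, rfl⟩ := hf b
    exact Ideal.mem_span_singleton.1 (Ideal.Quotient.eq.1 (DFunLike.congr_fun e x))

variable (f)

theorem LiePt.linearPart_cast {r s : ℕ} (h : r = s) (α : LiePt p R A r) :
    LiePt.linearPart p f (LiePt.cast p h α) = LiePt.linearPart p f α := by
  subst h
  rfl

theorem LiePt.linearPart_eq_of_pointMatrix {r : ℕ} (α : LiePt p R A r) {M : Matrix (Fin n) (Fin n) R}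
    (h : pointMatrix f (LiePt.ex p α) = 1 + (p : R) ^ r • M) : LiePt.linearPart p f α = M := by
  rw [LiePt.pointMatrix_ex] at h
  exact smul_right_injective _ (pow_ne_zero r (p_ne_zero p R)) (add_left_cancel h)

theorem LiePt.linearPart_zero (r : ℕ) : LiePt.linearPart p f (LiePt.zero p R A r) = 0 :=
  LiePt.linearPart_eq_of_pointMatrix p f _ (by rw [LiePt.ex_zero, map_one, smul_zero, add_zero])

theorem LiePt.linearPart_add {r : ℕ} (α β : LiePt p R A r) :
    LiePt.linearPart p f (LiePt.add p α β) = LiePt.linearPart p f α + LiePt.linearPart p f β +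
      (p : R) ^ r • (LiePt.linearPart p f α * LiePt.linearPart p f β) := by
  refine LiePt.linearPart_eq_of_pointMatrix p f _ ?_
  rw [LiePt.ex_add, map_mul, LiePt.pointMatrix_ex, LiePt.pointMatrix_ex]
  simp only [add_mul, mul_add, one_mul, mul_one, smul_mul_assoc, mul_smul_comm, smul_add]
  abel

theorem LiePt.linearPartMod_zero (r m : ℕ) : LiePt.linearPartMod p f m (LiePt.zero p R A r) = 0 := by
  rw [LiePt.linearPartMod, LiePt.linearPart_zero, map_zero]

theorem LiePt.linearPartMod_cast {r s : ℕ} (h : r = s) (m : ℕ) (α : LiePt p R A r) :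
    LiePt.linearPartMod p f m (LiePt.cast p h α) = LiePt.linearPartMod p f m α := by
  rw [LiePt.linearPartMod, LiePt.linearPart_cast, LiePt.linearPartMod]

theorem mapMatrix_mk_pow_smul {r : ℕ} (hr : 1 ≤ r) (M : Matrix (Fin n) (Fin n) R) :
    (Ideal.Quotient.mk (Ideal.span {(p : R) ^ 1})).mapMatrix ((p : R) ^ r • M) = 0 := by
  ext i j
  refine Ideal.Quotient.eq_zero_iff_mem.2 (Ideal.mem_span_singleton.2 ?_)
  exact (pow_dvd_pow _ hr).mul_right _

theorem LiePt.linearPartMod_add {r : ℕ} (hr : 1 ≤ r) (α β : LiePt p R A r) :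
    LiePt.linearPartMod p f 1 (LiePt.add p α β) =
      LiePt.linearPartMod p f 1 α + LiePt.linearPartMod p f 1 β := by
  rw [LiePt.linearPartMod, LiePt.linearPart_add, map_add, map_add, mapMatrix_mk_pow_smul p hr,
    add_zero]
  rfl

variable [IsAdicComplete (Ideal.span {(p : R)}) R]

section Bracket

variable {r s : ℕ} {F : LieDeltaMap p R A r s} (hF : IsDeltaBracket p F)
include hF

/-- With `X = 1 + p^r a` and `Y = 1 + p^s b`, the commutator equation reads `(1 + p^(r+s) c) Y X = X
Y`, and `X Y - Y X = p^(r+s) (ab - ba)`. Multiplying by `Y X` avoids inverses. -/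
theorem IsDeltaBracket.linearPart_mul (α : LiePt p R A r) (β : LiePt p R A s) :
    LiePt.linearPart p f (LieDeltaMap.app p F α β) *
      (pointMatrix f (LiePt.ex p β) * pointMatrix f (LiePt.ex p α)) =
        LiePt.linearPart p f α * LiePt.linearPart p f β -
          LiePt.linearPart p f β * LiePt.linearPart p f α := by
  have h : pointMatrix f (LiePt.ex p (LieDeltaMap.app p F α β)) *
      (pointMatrix f (LiePt.ex p β) * pointMatrix f (LiePt.ex p α)) =
        pointMatrix f (LiePt.ex p α) * pointMatrix f (LiePt.ex p β) := by
    rw [← map_mul, ← map_mul, ← map_mul, hF]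
    congr 1
    group
  refine smul_right_injective _ (pow_ne_zero (r + s) (p_ne_zero p R)) ?_
  rw [LiePt.pointMatrix_ex p f (LieDeltaMap.app p F α β), add_mul, one_mul, ← eq_sub_iff_add_eq',
    smul_mul_assoc] at h
  change (p : R) ^ (r + s) • _ = (p : R) ^ (r + s) • _
  rw [h, LiePt.pointMatrix_ex, LiePt.pointMatrix_ex]
  simp only [add_mul, mul_add, one_mul, mul_one, smul_mul_assoc, mul_smul_comm, smul_add, smul_sub,
    smul_smul, pow_add]
  rw [mul_comm ((p : R) ^ s)]
  abel

/-- In `linearPart_mul` the factor `Y X` is invertible, hence so is its reduction, and `c` modulo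
`p^m` is determined by `a` and `b` modulo `p^m`. -/
theorem IsDeltaBracket.linearPartMod_congr {m : ℕ} {α₁ α₂ : LiePt p R A r} {β₁ β₂ : LiePt p R A s}
    (hα : LiePt.linearPartMod p f m α₁ = LiePt.linearPartMod p f m α₂)
    (hβ : LiePt.linearPartMod p f m β₁ = LiePt.linearPartMod p f m β₂) :
    LiePt.linearPartMod p f m (LieDeltaMap.app p F α₁ β₁) =
      LiePt.linearPartMod p f m (LieDeltaMap.app p F α₂ β₂) := by
  set κ := (Ideal.Quotient.mk (Ideal.span {(p : R) ^ m})).mapMatrix (m := Fin n) with hκ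
  have hX : ∀ {k : ℕ} {γ₁ γ₂ : LiePt p R A k},
      LiePt.linearPartMod p f m γ₁ = LiePt.linearPartMod p f m γ₂ →
        κ (pointMatrix f (LiePt.ex p γ₁)) = κ (pointMatrix f (LiePt.ex p γ₂)) := by
    intro k γ₁ γ₂ h
    rw [LiePt.linearPartMod_eq_iff] at h
    rw [LiePt.pointMatrix_ex, LiePt.pointMatrix_ex, map_add, map_add]
    congr 1
    ext i j
    refine Ideal.Quotient.eq.2 (Ideal.mem_span_singleton.2 ?_)
    rw [Matrix.smul_apply, Matrix.smul_apply, smul_eq_mul, smul_eq_mul, ← mul_sub]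
    exact (h i j).mul_left _
  have h1 := congrArg κ (hF.linearPart_mul p f α₁ β₁)
  have h2 := congrArg κ (hF.linearPart_mul p f α₂ β₂)
  rw [map_mul, map_mul, map_sub, map_mul, map_mul] at h1 h2
  rw [hX hα, hX hβ, show κ (LiePt.linearPart p f α₁) = κ (LiePt.linearPart p f α₂) from hα,
    show κ (LiePt.linearPart p f β₁) = κ (LiePt.linearPart p f β₂) from hβ, ← h2] at h1
  have hu : IsUnit (κ (pointMatrix f (LiePt.ex p β₂)) * κ (pointMatrix f (LiePt.ex p α₂))) := by
    rw [← map_mul, ← map_mul]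
    exact ((Group.isUnit _).map (pointMatrix f)).map κ
  exact hu.mul_right_cancel h1

theorem IsDeltaBracket.linearPartMod_app (hr : 1 ≤ r) (hs : 1 ≤ s) (α : LiePt p R A r)
    (β : LiePt p R A s) :
    LiePt.linearPartMod p f 1 (LieDeltaMap.app p F α β) =
      LiePt.linearPartMod p f 1 α * LiePt.linearPartMod p f 1 β -
        LiePt.linearPartMod p f 1 β * LiePt.linearPartMod p f 1 α := by
  have h := congrArg (Ideal.Quotient.mk (Ideal.span {(p : R) ^ 1})).mapMatrix
    (hF.linearPart_mul p f α β)
  rw [LiePt.pointMatrix_ex, LiePt.pointMatrix_ex] at h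
  simp only [map_mul, map_add, map_sub, mapMatrix_mk_pow_smul p hr, mapMatrix_mk_pow_smul p hs,
    map_one, add_zero, mul_one] at h
  exact h

end Bracket

end LinearPart

/-! ### The coordinates `δ^r x` on `GL_n` -/

section GeneralLinear

variable (p : ℕ) [Fact p.Prime] {R : Type w} [CommRing R] [IsDomain R] [FrobeniusRing p R] {n : ℕ}

theorem iterate_delta_one_apply {r : ℕ} (hr : 1 ≤ r) (i j : Fin n) :
    (delta p)^[r] ((1 : Matrix (Fin n) (Fin n) R) i j) = 0 := by
  obtain ⟨r, rfl⟩ := Nat.exists_eq_add_of_le' hr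
  rw [Matrix.one_apply]
  split_ifs
  · rw [Function.iterate_succ_apply, delta_one, iterate_delta_zero]
  · exact iterate_delta_zero p _

/-- For `r ≥ 1` the iterate `δ^r` kills the entries `0` and `1` of the unit matrix, so `δ^r x` and
`ξ` coincide; `linearPart` contains the twist `φ^{-r}`. -/
theorem LiePt.matrix_eq {r : ℕ} (hr : 1 ≤ r) (α : LiePt p R (GLRing n R) r) (i j : Fin n) :
    LiePt.matrix p α i j =
      frobIter p r (LiePt.linearPart p (BialgHom.id R (GLRing n R)) α i j) := by
  change α (Lie.mk p R _ r (Jet.var p r (GLRing.gen n R i j) r le_rfl)) =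
    frobIter p r ((frobIter p r).symm (α (Lie.xi p R r (GLRing.gen n R i j))))
  rw [RingEquiv.apply_symm_apply, Lie.mk_var_self, GLRing.counit_gen, iterate_delta_one_apply p hr,
    map_zero]
  simp

theorem mk_frobIter (k : ℕ) (x : R) :
    Ideal.Quotient.mk (Ideal.span {(p : R)}) (frobIter p k x) =
      Ideal.Quotient.mk (Ideal.span {(p : R)}) x ^ p ^ k := by
  induction k with
  | zero => rw [pow_zero, pow_one]; rfl
  | succ k ih =>
    rw [pow_succ, pow_mul, ← ih, ← map_pow]
    exact Ideal.Quotient.eq.2 (Ideal.mem_span_singleton.2 (dvd_frob_sub_pow p _))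

variable [IsAdicComplete (Ideal.span {(p : R)}) R]

theorem IsDeltaBracket.dvd_matrix_sub {r s : ℕ} (hr : 1 ≤ r) (hs : 1 ≤ s)
    {F : LieDeltaMap p R (GLRing n R) r s} (hF : IsDeltaBracket p F)
    (α : LiePt p R (GLRing n R) r) (β : LiePt p R (GLRing n R) s) (i j : Fin n) :
    (p : R) ∣ LiePt.matrix p (LieDeltaMap.app p F α β) i j -
      ((LiePt.matrix p α).map (· ^ p ^ s) * (LiePt.matrix p β).map (· ^ p ^ r) -
        (LiePt.matrix p β).map (· ^ p ^ r) * (LiePt.matrix p α).map (· ^ p ^ s)) i j := by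
  set a := LiePt.linearPart p (BialgHom.id R (GLRing n R)) α
  set b := LiePt.linearPart p (BialgHom.id R (GLRing n R)) β
  set c := LiePt.linearPart p (BialgHom.id R (GLRing n R)) (LieDeltaMap.app p F α β)
  let π := Ideal.Quotient.mk (Ideal.span {(p : R)})
  have hc : (p : R) ∣ c i j - (a * b - b * a) i j := by
    have h := congrFun (congrFun
      (hF.linearPartMod_app p (BialgHom.id R (GLRing n R)) hr hs α β) i) j
    have h1 := Ideal.mem_span_singleton.1 ((Ideal.Quotient.eq (x := c i j)
      (y := (a * b - b * a) i j)).1 (h.trans ?_))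
    · rwa [pow_one] at h1
    · rw [LiePt.linearPartMod, LiePt.linearPartMod, ← map_mul, ← map_mul, ← map_sub]
      rfl
  -- Applying `φ^(r+s)` to `c ≡ ab - ba` turns `c` into the coordinate matrix of the bracket, while
  -- `a` and `b` become its images under `φ^s` and `φ^r`, that is, `p^s`-th and `p^r`-th powers
  -- modulo `p`.
  have hc' : π (frobIter p (r + s) (c i j)) =
      π (frobIter p (r + s) ((a * b - b * a) i j)) := by
    rw [← sub_eq_zero, ← map_sub, ← map_sub, Ideal.Quotient.eq_zero_iff_mem,
      Ideal.mem_span_singleton]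
    have h := dvd_frobIter p (k := 1) (i := r + s) (x := c i j - (a * b - b * a) i j)
      (by rwa [pow_one])
    rwa [pow_one] at h
  have ha : ∀ k l, π (frobIter p (r + s) (a k l)) = π (LiePt.matrix p α k l) ^ p ^ s := by
    intro k l
    rw [← mk_frobIter, LiePt.matrix_eq p hr, frobIter_frobIter]
  have hb : ∀ k l, π (frobIter p (r + s) (b k l)) = π (LiePt.matrix p β k l) ^ p ^ r := by
    intro k l
    rw [← mk_frobIter, LiePt.matrix_eq p hs, frobIter_frobIter, add_comm s r]
  rw [← Ideal.mem_span_singleton, ← Ideal.Quotient.eq, LiePt.matrix_eq p (by omega)]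
  refine hc'.trans ?_
  simp only [Matrix.sub_apply, Matrix.mul_apply, Matrix.map_apply, map_sub, map_sum, map_mul, map_pow,
    ha, hb, π]

end GeneralLinear

/-! ### Properties of the bracket -/

section Properties

variable (p : ℕ) [Fact p.Prime] {R : Type w} [CommRing R] [IsDomain R] [FrobeniusRing p R]
  [IsAdicComplete (Ideal.span {(p : R)}) R] {A : Type u} [CommRing A] [HopfAlgebra R A]

/-- Homomorphisms of groups preserve commutators, and the injectivity of `ex` lifts this back. -/
theorem LieDeltaMap.app_map {A' : Type v} [CommRing A'] [HopfAlgebra R A'] (f : A' →ₐc[R] A)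
    {r s : ℕ} {F : LieDeltaMap p R A r s} {F' : LieDeltaMap p R A' r s} (hF : IsDeltaBracket p F)
    (hF' : IsDeltaBracket p F') (α : LiePt p R A r) (β : LiePt p R A s) :
    LieDeltaMap.app p F' (LiePt.map p f α) (LiePt.map p f β) =
      LiePt.map p f (LieDeltaMap.app p F α β) := by
  have hmap : ∀ {k : ℕ} (γ : LiePt p R A k),
      LiePt.ex p (LiePt.map p f γ) = compBialgHom f R (LiePt.ex p γ) := fun γ => LiePt.ex_map p f γ
  refine LiePt.ex_injective p ?_
  rw [hF', hmap, hmap, hmap, hF]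
  simp only [map_mul, map_inv]

variable {n : ℕ} {f : GLRing n R →ₐc[R] A} (hf : Function.Surjective f)
  {F : ∀ r s : ℕ, LieDeltaMap p R A r s}
  (hF : ∀ r s : ℕ, 1 ≤ r → 1 ≤ s → IsDeltaBracket p (F r s)) {r s t : ℕ} (hr : 1 ≤ r) (hs : 1 ≤ s)
include hf hF hr hs

theorem modEq_app {m : ℕ} {α₁ α₂ : LiePt p R A r} {β₁ β₂ : LiePt p R A s}
    (hα : LiePt.ModEq p m α₁ α₂) (hβ : LiePt.ModEq p m β₁ β₂) :
    LiePt.ModEq p m (LieDeltaMap.app p (F r s) α₁ β₁) (LieDeltaMap.app p (F r s) α₂ β₂) := by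
  rw [LiePt.modEq_iff_linearPartMod p hf] at *
  exact (hF r s hr hs).linearPartMod_congr p f hα hβ

theorem modEq_app_add (α₁ α₂ : LiePt p R A r) (β : LiePt p R A s) :
    LiePt.ModEq p 1 (LieDeltaMap.app p (F r s) (LiePt.add p α₁ α₂) β)
      (LiePt.add p (LieDeltaMap.app p (F r s) α₁ β) (LieDeltaMap.app p (F r s) α₂ β)) := by
  rw [LiePt.modEq_iff_linearPartMod p hf, LiePt.linearPartMod_add p f (by omega)]
  simp only [(hF r s hr hs).linearPartMod_app p f hr hs, LiePt.linearPartMod_add p f hr]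
  noncomm_ring

theorem modEq_app_antisymm (α : LiePt p R A r) (β : LiePt p R A s) :
    LiePt.ModEq p 1
      (LiePt.add p (LieDeltaMap.app p (F r s) α β)
        (LiePt.cast p (Nat.add_comm s r) (LieDeltaMap.app p (F s r) β α)))
      (LiePt.zero p R A (r + s)) := by
  rw [LiePt.modEq_iff_linearPartMod p hf, LiePt.linearPartMod_add p f (by omega),
    LiePt.linearPartMod_cast, LiePt.linearPartMod_zero,
    (hF r s hr hs).linearPartMod_app p f hr hs, (hF s r hs hr).linearPartMod_app p f hs hr]
  abel

theorem modEq_app_jacobi (ht : 1 ≤ t) (e : s + t + r = r + s + t)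
    (e' : t + r + s = r + s + t) (α : LiePt p R A r) (β : LiePt p R A s) (γ : LiePt p R A t) :
    LiePt.ModEq p 1
      (LiePt.add p
        (LiePt.add p
          (LieDeltaMap.app p (F (r + s) t) (LieDeltaMap.app p (F r s) α β) γ)
          (LiePt.cast p e
            (LieDeltaMap.app p (F (s + t) r) (LieDeltaMap.app p (F s t) β γ) α)))
        (LiePt.cast p e'
          (LieDeltaMap.app p (F (t + r) s) (LieDeltaMap.app p (F t r) γ α) β)))
      (LiePt.zero p R A (r + s + t)) := by
  -- Transport along equal orders does not change the linear part, so what remains is the Jacobi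
  -- identity for commutators in a matrix ring.
  rw [LiePt.modEq_iff_linearPartMod p hf, LiePt.linearPartMod_add p f (by omega),
    LiePt.linearPartMod_add p f (by omega), LiePt.linearPartMod_cast, LiePt.linearPartMod_cast,
    LiePt.linearPartMod_zero,
    (hF (r + s) t (by omega) ht).linearPartMod_app p f (by omega) ht,
    (hF (s + t) r (by omega) hr).linearPartMod_app p f (by omega) hr,
    (hF (t + r) s (by omega) hs).linearPartMod_app p f (by omega) hs,
    (hF r s hr hs).linearPartMod_app p f hr hs, (hF s t hs ht).linearPartMod_app p f hs ht,
    (hF t r ht hr).linearPartMod_app p f ht hr]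
  noncomm_ring

end Properties

/-- Both brackets have the same image under the injective `ex`, so they agree on points. The residue
map is the zeroth Witt component, and its target is infinite because it is algebraically closed. -/
theorem BaseRing.ext_of_isDeltaBracket (p : ℕ) [Fact p.Prime] {A : Type u} [CommRing A] [HopfAlgebra (BaseRing p) A]
    [Algebra.Smooth (BaseRing p) A] {r s : ℕ} (hr : 1 ≤ r) (hs : 1 ≤ s)
    {F F' : LieDeltaMap p (BaseRing p) A r s} (hF : IsDeltaBracket p F)
    (hF' : IsDeltaBracket p F') : F = F' := by
  have : Infinite (AlgebraicClosure (ZMod p)) := IsAlgClosed.instInfinite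
  let κ : BaseRing p →+* AlgebraicClosure (ZMod p) :=
    (WittVector.constantCoeff : WittVector p (AlgebraicClosure (ZMod p)) →+* _)
  refine LieDeltaMap.ext_of_app p κ
    (fun x => ⟨WittVector.teichmuller p x, WittVector.teichmuller_coeff_zero p x⟩)
    WittVector.ker_constantCoeff hr hs fun α β => LiePt.ex_injective p ?_
  rw [hF, hF']

end

end DeltaLie

theorem mainTheorem4 (p : ℕ) [Fact p.Prime] (hp : p ≠ 2) :
    -- existence and uniqueness of the bracket
    (∀ (A : Type u) [CommRing A] [HopfAlgebra (BaseRing p) A] [Algebra.Smooth (BaseRing p) A],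
      IsLinear (BaseRing p) A →
      ∀ r s : ℕ, 1 ≤ r → 1 ≤ s →
        ∃! F : LieDeltaMap p (BaseRing p) A r s, IsDeltaBracket p F) ∧
    -- functoriality
    (∀ (A : Type u) [CommRing A] [HopfAlgebra (BaseRing p) A] [Algebra.Smooth (BaseRing p) A]
      (A' : Type v) [CommRing A'] [HopfAlgebra (BaseRing p) A'] [Algebra.Smooth (BaseRing p) A'],
      IsLinear (BaseRing p) A → IsLinear (BaseRing p) A' →
      ∀ (f : A' →ₐc[BaseRing p] A) (r s : ℕ), 1 ≤ r → 1 ≤ s →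
      ∀ (F : LieDeltaMap p (BaseRing p) A r s) (F' : LieDeltaMap p (BaseRing p) A' r s),
        IsDeltaBracket p F → IsDeltaBracket p F' →
        ∀ (α : LiePt p (BaseRing p) A r) (β : LiePt p (BaseRing p) A s),
          LieDeltaMap.app p F' (LiePt.map p f α) (LiePt.map p f β) =
            LiePt.map p f (LieDeltaMap.app p F α β)) ∧
    -- congruences, linearity, antisymmetry and the Jacobi identity
    (∀ (A : Type u) [CommRing A] [HopfAlgebra (BaseRing p) A] [Algebra.Smooth (BaseRing p) A],
      IsLinear (BaseRing p) A →
      ∀ F : ∀ r s : ℕ, LieDeltaMap p (BaseRing p) A r s,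
        (∀ r s : ℕ, 1 ≤ r → 1 ≤ s → IsDeltaBracket p (F r s)) →
        ∀ r s : ℕ, 1 ≤ r → 1 ≤ s →
        (∀ (m : ℕ) (α₁ α₂ : LiePt p (BaseRing p) A r) (β₁ β₂ : LiePt p (BaseRing p) A s),
          LiePt.ModEq p m α₁ α₂ → LiePt.ModEq p m β₁ β₂ →
          LiePt.ModEq p m (LieDeltaMap.app p (F r s) α₁ β₁)
            (LieDeltaMap.app p (F r s) α₂ β₂)) ∧
        (∀ (α₁ α₂ : LiePt p (BaseRing p) A r) (β : LiePt p (BaseRing p) A s),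
          LiePt.ModEq p 1 (LieDeltaMap.app p (F r s) (LiePt.add p α₁ α₂) β)
            (LiePt.add p (LieDeltaMap.app p (F r s) α₁ β)
              (LieDeltaMap.app p (F r s) α₂ β))) ∧
        (∀ (α : LiePt p (BaseRing p) A r) (β : LiePt p (BaseRing p) A s),
          LiePt.ModEq p 1
            (LiePt.add p (LieDeltaMap.app p (F r s) α β)
              (LiePt.cast p (Nat.add_comm s r) (LieDeltaMap.app p (F s r) β α)))
            (LiePt.zero p (BaseRing p) A (r + s))) ∧
        (∀ t : ℕ, 1 ≤ t → ∀ (α : LiePt p (BaseRing p) A r) (β : LiePt p (BaseRing p) A s)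
          (γ : LiePt p (BaseRing p) A t),
          LiePt.ModEq p 1
            (LiePt.add p
              (LiePt.add p
                (LieDeltaMap.app p (F (r + s) t) (LieDeltaMap.app p (F r s) α β) γ)
                (LiePt.cast p (show s + t + r = r + s + t by omega)
                  (LieDeltaMap.app p (F (s + t) r) (LieDeltaMap.app p (F s t) β γ) α)))
              (LiePt.cast p (show t + r + s = r + s + t by omega)
                (LieDeltaMap.app p (F (t + r) s) (LieDeltaMap.app p (F t r) γ α) β)))
            (LiePt.zero p (BaseRing p) A (r + s + t)))) ∧
    -- the bracket of the general linear group
    (∀ (n r s : ℕ), 1 ≤ r → 1 ≤ s →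
      ∀ F : LieDeltaMap p (BaseRing p) (GLRing n (BaseRing p)) r s, IsDeltaBracket p F →
        ∀ (α : LiePt p (BaseRing p) (GLRing n (BaseRing p)) r)
          (β : LiePt p (BaseRing p) (GLRing n (BaseRing p)) s) (i j : Fin n),
          (p : BaseRing p) ∣ LiePt.matrix p (LieDeltaMap.app p F α β) i j -
            ((LiePt.matrix p α).map (· ^ p ^ s) * (LiePt.matrix p β).map (· ^ p ^ r) -
              (LiePt.matrix p β).map (· ^ p ^ r) * (LiePt.matrix p α).map (· ^ p ^ s)) i j) := by
  refine ⟨fun A _ _ _ _ r s hr hs => ?_, fun A _ _ _ A' _ _ _ _ _ f r s _ _ F F' hF hF' α β => ?_,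
    fun A _ _ _ hA F hF r s hr hs => ?_, fun n r s hr hs F hF α β i j => ?_⟩
  · obtain ⟨F, hF⟩ := exists_isDeltaBracket (R := BaseRing p) (A := A) p r s hr
    exact ⟨F, hF, fun F' hF' => BaseRing.ext_of_isDeltaBracket p hr hs hF' hF⟩
  · exact LieDeltaMap.app_map p f hF hF' α β
  · obtain ⟨n, f, hf⟩ := hA
    exact ⟨fun m α₁ α₂ β₁ β₂ hα hβ => modEq_app p hf hF hr hs hα hβ,
      modEq_app_add p hf hF hr hs, modEq_app_antisymm p hf hF hr hs,
      fun t ht => modEq_app_jacobi p hf hF hr hs ht _ _⟩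
  · exact hF.dvd_matrix_sub p hr hs α β i j
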